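/- **Setting.** Let $\mathfrak k$ be a finite-dimensional real inner product space (for instance the Lie algebra of a compact connected Lie group with an $\mathrm{Ad}$-invariant inner product) with orthonormal basis $\{X_k\}$, and let $s>t/2>0$. Put $\mathcal A=L^2([0,1];\mathfrak k)$, and let $\bar{\mathcal A}$ be the Banach space of distributions $A=da/d\tau$ with $a\in C([0,1];\mathfrak k)$, $a_0=0$, normed by $\|a\|_\infty$, so that $\mathcal A\subset\bar{\mathcal A}$. Put $\bar{\mathcal A}_{\mathbb C}=\bar{\mathcal A}+i\bar{\mathcal A}$, and write $c$ for the anti-derivative of $C\in\bar{\mathcal A}_{\mathbb C}$ vanishing at $0$. Let $\tilde P_s$ on $\bar{\mathcal A}$ and $\tilde M_{s,t}$ on $\bar{\mathcal A}_{\mathbb C}$ be the Borel probability measures such that, for all continuous linear functionals $\phi,\psi$ on $\bar{\mathcal A}$, $$\int e^{i\phi(A)}\,d\tilde P_s(A)=e^{-\frac s2\|\phi\|^2},\qquad \int e^{i\phi(A)+i\psi(B)}\,d\tilde M_{s,t}(A+iB)=e^{-\frac14(2(s-t/2)\|\phi\|^2+t\|\psi\|^2)},$$ where $\|\cdot\|$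 is the norm as a functional on $\mathcal A$. All $L^2$ spaces are complex. A *frame* is a finite orthonormal set $e=\{e_1,\dots,e_d\}\subset\mathcal A$ such that each $\langle e_j,\cdot\rangle$ extends continuously to $\bar{\mathcal A}$ (hence complex-linearly to $\bar{\mathcal A}_{\mathbb C}$); write $\langle e,\cdot\rangle=(\langle e_1,\cdot\rangle,\dots,\langle e_d,\cdot\rangle)$. **Transform.** $\tilde S_{s,t}$ is the linear isometry $L^2(\bar{\mathcal A},\tilde P_s)\to L^2(\bar{\mathcal A}_{\mathbb C},\tilde M_{s,t})$ with $\tilde S_{s,t}[\phi(\langle e,\cdot\rangle)](C)=(S_{s,t}\phi)(\langle e,C\rangle)$ for every frame $e$ and every measurable $\phi$ on $\mathbb R^d$ with $\phi(\langle e,\cdot\rangle)\in L^2$, where $$S_{s,t}\phi(z)=\int_{\mathbb R^d}(2\pi t)^{-d/2}e^{-\sum_j(z_j-x_j)^2/2t}\,\phi(x)\,dx .$$ **Chaos spaces.** On polynomials, $e^{-L/2}=\sum_k\frac{(-1)^k}{2^kk!}L^k$ for a second-order constant coefficient operator $L$; let $A_{s,t}=(s-\frac t2)\sum_k\partial_{x_k}^2+\frac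 t2\sum_k\partial_{y_k}^2$ on $\mathbb C^d$. $\mathcal F_{n,s}(\bar{\mathcal A})$ is the $L^2$ closure of the functions $(e^{-s\Delta/2}p)(\langle e,A\rangle)$, with $e$ a frame and $p$ a homogeneous polynomial of degree $n$ on $\mathbb R^d$ with complex coefficients. $\mathcal{HF}_{n,s,t}(\bar{\mathcal A}_{\mathbb C})$ is the $L^2$ closure of the functions $\Phi(\langle e,C\rangle)$, with $e$ a frame and $\Phi$ a holomorphic function on $\mathbb C^d$ of the form $e^{-A_{s,t}/2}q$, with $q$ a homogeneous polynomial of degree $n$ in the real coordinates $x_k,y_k$ with complex coefficients. **Integrals.** Let $\Delta_n=\{0\le\tau_1\le\dots\le\tau_n\le1\}$. For $H=\{H_{k_1,\dots,k_n}\}\subset L^2(\Delta_n;\mathbb C)$ the multiple Wiener integrals $$I_n(H)=\sum_{k_1,\dots,k_n}\int_{\Delta_n}H_{k_1,\dots,k_n}\,da^{k_1}_{\tau_1}\cdots da^{k_n}_{\tau_n},\qquad J_n(H)=\sum_{k_1,\dots,k_n}\int_{\Delta_n}H_{k_1,\dots,k_n}\,dc^{k_1}_{\tau_1}\cdots dc^{k_n}_{\tau_n}$$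 are the bounded linear maps into $L^2(\tilde P_s)$ and $L^2(\tilde M_{s,t})$ determined as follows: if $H$ consists of the components, restricted to $\Delta_n$, of $\sum_\alpha c_\alpha\, e_{\alpha_1}(\tau_1)\otimes\cdots\otimes e_{\alpha_n}(\tau_n)$ with $e$ a frame and $c_\alpha\in\mathbb C$ symmetric in $\alpha\in\{1,\dots,d\}^n$, and $p(x)=\frac1{n!}\sum_\alpha c_\alpha x_{\alpha_1}\cdots x_{\alpha_n}$, then $I_n(H)(A)=(e^{-s\Delta/2}p)(\langle e,A\rangle)$ and $J_n(H)(C)=(e^{-A_{s,t}/2}p_{\mathbb C})(\langle e,C\rangle)$, where $p_{\mathbb C}$ is the analytic continuation of $p$. **Theorem.** The maps $\tilde S_{s,t}$, $I_n$ and $J_n$ exist and are unique, and for every $n\ge0$: 1. $\tilde S_{s,t}$ takes $\mathcal F_{n,s}(\bar{\mathcal A})$ onto $\mathcal{HF}_{n,s,t}(\bar{\mathcal A}_{\mathbb C})$; 2. for every family $H$ of square-integrable complex-valued functions on $\Delta_n$, $\tilde S_{s,t}(I_n(H))=J_n(H)$, that is, $$\tilde S_{s,t}\Big(\sum\int_{\Delta_n}H_{k_1,\dots,k_n}\,da^{k_1}_{\tau_1}\cdots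 da^{k_n}_{\tau_n}\Big)=\sum\int_{\Delta_n}H_{k_1,\dots,k_n}\,dc^{k_1}_{\tau_1}\cdots dc^{k_n}_{\tau_n}.$$ -/

import Mathlib

open MeasureTheory

noncomputable section

namespace WienerSB

/-! ### The spaces of connections -/

section Spaces

variable (V : Type*) [NormedAddCommGroup V] [InnerProductSpace ℝ V]

/-- Lebesgue measure on `[0,1]`, as a measure on `ℝ`. -/
abbrev unitVol : Measure ℝ := volume.restrict (Set.Icc (0 : ℝ) 1)

/-- `𝒜 = L²([0,1]; V)`. -/
abbrev Conn : Type _ := Lp V 2 unitVol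

/-- The paths `a ∈ C([0,1]; V)` with `a 0 = 0`. -/
def pathSpace : Submodule ℝ C(unitInterval, V) where
  carrier := {a | a 0 = 0}
  add_mem' := by
    intro a b ha hb
    simp only [Set.mem_ofPred_eq] at *
    simp [ha, hb]
  zero_mem' := by simp
  smul_mem' := by
    intro r a ha
    simp only [Set.mem_ofPred_eq] at *
    simp [ha]

/-- The Banach space `Ā` of generalized connections `A = da/dτ` with `a` a continuous path,
`a 0 = 0`, normed by the supremum norm of `a`.  The distribution `A` and its unique
anti-derivative `a` determine each other, and `A` is stored as `a`. -/
abbrev GenConn : Type _ := ↥(pathSpace V)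

/-- `Ā_ℂ`, the generalized connections `C = A + i B` with values in `V_ℂ = V + i V`,
stored as the pair `(A, B)`. -/
abbrev GenConnC : Type _ := GenConn V × GenConn V

instance : MeasurableSpace (GenConn V) := borel _

instance : BorelSpace (GenConn V) := ⟨rfl⟩

end Spaces

section Defs

theorem integrable_conn {V : Type*} [NormedAddCommGroup V] (f : Conn V) : Integrable f unitVol :=
  (Lp.memLp f).integrable (by norm_num)

variable {V : Type*} [NormedAddCommGroup V] [InnerProductSpace ℝ V] [FiniteDimensional ℝ V]

/-- The path `τ ↦ ∫₀^τ f` of a square-integrable connection `f`. -/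
def primitive (f : Conn V) : GenConn V :=
  ⟨⟨fun τ => ∫ x in (0 : ℝ)..(τ : ℝ), f x ∂unitVol,
    ((integrable_conn f).continuous_primitive 0).comp continuous_subtype_val⟩,
    by change ∫ x in (0 : ℝ)..((0 : unitInterval) : ℝ), f x ∂unitVol = 0; simp⟩

theorem norm_primitive_le (f : Conn V) : ‖primitive f‖ ≤ 1 * ‖f‖ := by
  rw [one_mul]
  change ‖(primitive f : C(unitInterval, V))‖ ≤ ‖f‖
  rw [ContinuousMap.norm_le _ (norm_nonneg _)]
  intro τ
  change ‖∫ x in (0 : ℝ)..(τ : ℝ), f x ∂unitVol‖ ≤ ‖f‖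
  have h1 : ‖∫ x in (0 : ℝ)..(τ : ℝ), f x ∂unitVol‖ ≤ ∫ x, ‖f x‖ ∂unitVol := by
    rw [intervalIntegral.integral_of_le τ.2.1]
    exact (norm_integral_le_integral_norm _).trans
      (setIntegral_le_integral (integrable_conn f).norm (by filter_upwards with x; positivity))
  have h2 : ∫ x, ‖f x‖ ∂unitVol = (eLpNorm f 1 unitVol).toReal := by
    rw [integral_norm_eq_lintegral_enorm (integrable_conn f).1, eLpNorm_one_eq_lintegral_enorm]
  have hp : IsProbabilityMeasure unitVol := ⟨by simp [unitVol]⟩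
  have h3 : eLpNorm f 1 unitVol ≤ eLpNorm f 2 unitVol :=
    eLpNorm_le_eLpNorm_of_exponent_le (by norm_num) (Lp.aestronglyMeasurable f)
  rw [Lp.norm_def]
  exact h1.trans (h2.le.trans (ENNReal.toReal_mono (Lp.eLpNorm_ne_top f) h3))

/-- The inclusion `𝒜 ⊆ Ā`. -/
def incl : Conn V →L[ℝ] GenConn V :=
  LinearMap.mkContinuous
    { toFun := primitive
      map_add' := by
        intro f g
        apply Subtype.ext
        ext τ
        change ∫ x in (0 : ℝ)..(τ : ℝ), (f + g : Conn V) x ∂unitVol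
          = (∫ x in (0 : ℝ)..(τ : ℝ), f x ∂unitVol) + ∫ x in (0 : ℝ)..(τ : ℝ), g x ∂unitVol
        rw [← intervalIntegral.integral_add (integrable_conn f).intervalIntegrable
          (integrable_conn g).intervalIntegrable]
        apply intervalIntegral.integral_congr_ae
        filter_upwards [Lp.coeFn_add f g] with x hx _
        simpa using hx
      map_smul' := by
        intro r f
        apply Subtype.ext
        ext τ
        change ∫ x in (0 : ℝ)..(τ : ℝ), (r • f : Conn V) x ∂unitVol
          = r • ∫ x in (0 : ℝ)..(τ : ℝ), f x ∂unitVol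
        rw [← intervalIntegral.integral_smul]
        apply intervalIntegral.integral_congr_ae
        filter_upwards [Lp.coeFn_smul r f] with x hx _
        simpa using hx } 1 norm_primitive_le

/-- The norm of a continuous linear functional on `Ā` as a linear functional on `𝒜`. -/
def connNorm (φ : StrongDual ℝ (GenConn V)) : ℝ := ‖φ.comp incl‖

/-! ### The Gaussian measures -/

/-- `P` is the Gaussian measure `P̃_s` on `Ā` (white noise of variance `s`), given by its
Fourier transform. -/
structure IsWhiteNoise (s : ℝ) (P : Measure (GenConn V)) : Prop where
  isProbabilityMeasure : IsProbabilityMeasure P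
  fourier : ∀ φ : StrongDual ℝ (GenConn V),
    ∫ A, Complex.exp (Complex.I * (φ A : ℂ)) ∂P
      = Complex.exp ((-(s / 2) * connNorm φ ^ 2 : ℝ) : ℂ)

/-- `M` is the Gaussian measure `M̃_{s,t}` on `Ā_ℂ`, given by its Fourier transform; here
`r = 2 (s - t / 2)`. -/
structure IsComplexWhiteNoise (s t : ℝ) (M : Measure (GenConnC V)) : Prop where
  isProbabilityMeasure : IsProbabilityMeasure M
  fourier : ∀ φ ψ : StrongDual ℝ (GenConn V),
    ∫ C, Complex.exp (Complex.I * (φ C.1 : ℂ) + Complex.I * (ψ C.2 : ℂ)) ∂M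
      = Complex.exp
          ((-(1 / 4) * (2 * (s - t / 2) * connNorm φ ^ 2 + t * connNorm ψ ^ 2) : ℝ) : ℂ)

/-! ### Cylinder functions and the transform -/

variable (V) in
/-- A finite orthonormal set `e₁, …, e_d` in `𝒜` such that each functional `⟨e_j, ·⟩` extends to
a continuous linear functional `ext j` on `Ā` (the extension is unique since `𝒜` is dense). -/
structure Frame (d : ℕ) where
  e : Fin d → Conn V
  orthonormal : Orthonormal ℝ e
  ext : Fin d → StrongDual ℝ (GenConn V)
  ext_incl : ∀ j f, ext j (incl f) = inner ℝ (e j) f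

/-- `A ↦ (⟨e₁, A⟩, …, ⟨e_d, A⟩)`. -/
def Frame.coord {d : ℕ} (F : Frame V d) (A : GenConn V) : Fin d → ℝ := fun j => F.ext j A

/-- `C ↦ (⟨e₁, C⟩, …, ⟨e_d, C⟩)`, through the complex-linear extensions
`⟨e_j, A + i B⟩ = ⟨e_j, A⟩ + i ⟨e_j, B⟩`. -/
def Frame.coordC {d : ℕ} (F : Frame V d) (C : GenConnC V) : Fin d → ℂ :=
  fun j => (F.ext j C.1 : ℂ) + Complex.I * (F.ext j C.2 : ℂ)

/-- The analytic continuation to `ℂ^d` of the Gaussian density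
`P_t(x) = (2πt)^{-d/2} exp(-x²/2t)`. -/
def gaussDensity {d : ℕ} (t : ℝ) (z : Fin d → ℂ) : ℂ :=
  (((2 * Real.pi * t) ^ (-(d : ℝ) / 2) : ℝ) : ℂ)
    * Complex.exp (-(∑ j, z j ^ 2) / (2 * (t : ℂ)))

/-- The finite-dimensional transform `S_{s,t} φ (z) = ∫ P_t(z - x) φ(x) dx`.  Its formula does not
involve `s`, which only enters through the domain `L²(ℝ^d, P_s)`. -/
def finTransform {d : ℕ} (t : ℝ) (φ : (Fin d → ℝ) → ℂ) (z : Fin d → ℂ) : ℂ :=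
  ∫ x : Fin d → ℝ, gaussDensity t (fun j => z j - (x j : ℂ)) * φ x

/-- `S` is the Segal–Bargmann transform: it acts on every square-integrable cylinder function by
the finite-dimensional transform. -/
def IsSegalBargmann (t : ℝ) {P : Measure (GenConn V)} {M : Measure (GenConnC V)}
    (S : Lp ℂ 2 P →ₗᵢ[ℂ] Lp ℂ 2 M) : Prop :=
  ∀ (d : ℕ) (F : Frame V d) (φ : (Fin d → ℝ) → ℂ), Measurable φ →
    ∀ hφ : MemLp (fun A => φ (F.coord A)) 2 P,
      (S hφ.toLp : GenConnC V → ℂ) =ᵐ[M] fun C => finTransform t φ (F.coordC C)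

/-! ### Hermite subspaces -/

/-- The operator `L = ∑ᵢ gᵢ ∂ᵢ²` on polynomials. -/
def polyLap {σ : Type*} [Fintype σ] (g : σ → ℝ) :
    MvPolynomial σ ℂ →ₗ[ℂ] MvPolynomial σ ℂ :=
  ∑ i, (g i : ℂ) • ((MvPolynomial.pderiv i).toLinearMap ∘ₗ (MvPolynomial.pderiv i).toLinearMap)

/-- `e^{-L/2} p = ∑ₖ (-1/2)ᵏ Lᵏ p / k!` for a polynomial `p` and `L = ∑ᵢ gᵢ ∂ᵢ²`; the terms with
`k > deg p` vanish. -/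
def expNegHalf {σ : Type*} [Fintype σ] (g : σ → ℝ) (p : MvPolynomial σ ℂ) : MvPolynomial σ ℂ :=
  ∑ k ∈ Finset.range (p.totalDegree + 1), ((-1 / 2 : ℂ) ^ k / (k.factorial : ℂ)) • (polyLap g ^ k) p

/-- The coefficients of `sΔ` on `ℝ^d`. -/
def realCoeff (d : ℕ) (s : ℝ) : Fin d → ℝ := fun _ => s

/-- The coefficients of `A_{s,t} = (s - t/2) ∑ ∂²/∂x_k² + (t/2) ∑ ∂²/∂y_k²` on `ℂ^d = ℝ^{2d}`;
`Sum.inl k` stands for `x_k` and `Sum.inr k` for `y_k`. -/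
def complexCoeff (d : ℕ) (s t : ℝ) : Fin d ⊕ Fin d → ℝ :=
  Sum.elim (fun _ => s - t / 2) (fun _ => t / 2)

/-- The function on `ℝ^d` given by a polynomial with complex coefficients. -/
def evalR {d : ℕ} (p : MvPolynomial (Fin d) ℂ) (x : Fin d → ℝ) : ℂ :=
  MvPolynomial.eval (fun j => (x j : ℂ)) p

/-- The function on `ℂ^d` given by a polynomial in the real coordinates `x_k, y_k`. -/
def evalXY {d : ℕ} (p : MvPolynomial (Fin d ⊕ Fin d) ℂ) (z : Fin d → ℂ) : ℂ :=
  MvPolynomial.eval (Sum.elim (fun j => ((z j).re : ℂ)) (fun j => ((z j).im : ℂ))) p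

/-- `ℱ_{n,s}(ℝ^d) = e^{-sΔ/2} 𝒫_n(ℝ^d)`. -/
def hermiteFin (n d : ℕ) (s : ℝ) : Set ((Fin d → ℝ) → ℂ) :=
  {φ | ∃ p : MvPolynomial (Fin d) ℂ, p.IsHomogeneous n ∧ φ = evalR (expNegHalf (realCoeff d s) p)}

/-- `ℋℱ_{n,s,t}(ℂ^d)`: the holomorphic functions in `e^{-A_{s,t}/2} 𝒫_n(ℂ^d)`, where `𝒫_n(ℂ^d)`
are the homogeneous polynomials of degree `n` in the real coordinates. -/
def holHermiteFin (n d : ℕ) (s t : ℝ) : Set ((Fin d → ℂ) → ℂ) :=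
  {Φ | Differentiable ℂ Φ ∧ ∃ p : MvPolynomial (Fin d ⊕ Fin d) ℂ, p.IsHomogeneous n ∧
    Φ = evalXY (expNegHalf (complexCoeff d s t) p)}

/-- The `n`-th level Hermite subspace `ℱ_{n,s}(Ā)` of `L²(Ā, P)`. -/
def hermiteSpace (n : ℕ) (s : ℝ) (P : Measure (GenConn V)) : Set (Lp ℂ 2 P) :=
  closure {f | ∃ (d : ℕ) (F : Frame V d), ∃ φ ∈ hermiteFin n d s,
    (f : GenConn V → ℂ) =ᵐ[P] fun A => φ (F.coord A)}

/-- The `n`-th level holomorphic Hermite subspace `ℋℱ_{n,s,t}(Ā_ℂ)` of `L²(Ā_ℂ, M)`. -/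
def holHermiteSpace (n : ℕ) (s t : ℝ) (M : Measure (GenConnC V)) : Set (Lp ℂ 2 M) :=
  closure {f | ∃ (d : ℕ) (F : Frame V d), ∃ Φ ∈ holHermiteFin n d s t,
    (f : GenConnC V → ℂ) =ᵐ[M] fun C => Φ (F.coordC C)}

/-! ### Multiple Wiener integrals -/

/-- The simplex `0 ≤ τ₁ ≤ … ≤ τ_n ≤ 1`. -/
def simplex (n : ℕ) : Set (Fin n → ℝ) := {τ | (∀ i, τ i ∈ Set.Icc (0 : ℝ) 1) ∧ Monotone τ}

/-- The families `H = {H_{k₁,…,k_n}}` of square-integrable complex functions on the simplex, i.e.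
the components of an element of `L²(Δ_n; V_ℂ^{⊗n})`. -/
abbrev Kernel (ι : Type*) (n : ℕ) : Type _ :=
  (Fin n → ι) → Lp ℂ 2 ((volume : Measure (Fin n → ℝ)).restrict (simplex n))

/-- The component `k` of the tensor-valued function `∑_α c_α e_{α₁}(τ₁) ⊗ ⋯ ⊗ e_{α_n}(τ_n)`.
Every finite linear combination of products `f₁ ⊗ ⋯ ⊗ f_n` of functions of finite variation has
this form for some frame (an element of `𝒜` has a version of finite variation exactly if its
functional extends continuously to `Ā`), and it is symmetric under the joint permutation of
arguments and tensor factors exactly if `c` is. -/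
def elemKernel {ι : Type*} [Fintype ι] (X : OrthonormalBasis ι ℝ V) {n d : ℕ} (F : Frame V d)
    (c : (Fin n → Fin d) → ℂ) (k : Fin n → ι) (τ : Fin n → ℝ) : ℂ :=
  ∑ α : Fin n → Fin d, c α * ∏ i, ((inner ℝ (X (k i)) (F.e (α i) (τ i)) : ℝ) : ℂ)

/-- The polynomial `p` with `p(⟨e, A⟩) = (1/n!) ∑_α c_α ⟨e_{α₁}, A⟩ ⋯ ⟨e_{α_n}, A⟩`, which is the
multiple Stratonovich integral of `∑_α c_α e_{α₁} ⊗ ⋯ ⊗ e_{α_n}`. -/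
def stratPoly {n d : ℕ} (c : (Fin n → Fin d) → ℂ) : MvPolynomial (Fin d) ℂ :=
  (1 / (n.factorial : ℂ)) • ∑ α : Fin n → Fin d, c α • ∏ i, MvPolynomial.X (α i)

/-- The analytic continuation `p_ℂ(x, y) = p(x + i y)` of a polynomial, in real coordinates. -/
def complexify {d : ℕ} (p : MvPolynomial (Fin d) ℂ) : MvPolynomial (Fin d ⊕ Fin d) ℂ :=
  MvPolynomial.aeval
    (fun j => MvPolynomial.X (Sum.inl j) + MvPolynomial.C Complex.I * MvPolynomial.X (Sum.inr j)) p

/-- `I` is the multiple Wiener (Itô) integral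
`H ↦ ∑_k ∫_{Δ_n} H_{k₁,…,k_n} da^{k₁}_{τ₁} ⋯ da^{k_n}_{τ_n}`: the bounded linear map which on the
restriction to `Δ_n` of a symmetric elementary `f` is `e^{-sΔ_𝒜/2}` of the Stratonovich integral
of `f`. -/
def IsWienerIntegral {ι : Type*} [Fintype ι] (X : OrthonormalBasis ι ℝ V) (n : ℕ) (s : ℝ)
    {P : Measure (GenConn V)} (I : Kernel ι n →L[ℂ] Lp ℂ 2 P) : Prop :=
  ∀ (d : ℕ) (F : Frame V d) (c : (Fin n → Fin d) → ℂ),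
    (∀ (π : Equiv.Perm (Fin n)) (α : Fin n → Fin d), c (α ∘ π) = c α) →
    ∀ H : Kernel ι n,
      (∀ k, (H k : (Fin n → ℝ) → ℂ) =ᵐ[volume.restrict (simplex n)] elemKernel X F c k) →
      (I H : GenConn V → ℂ) =ᵐ[P]
        fun A => evalR (expNegHalf (realCoeff d s) (stratPoly c)) (F.coord A)

/-- `J` is the complex multiple Wiener (Itô) integral
`H ↦ ∑_k ∫_{Δ_n} H_{k₁,…,k_n} dc^{k₁}_{τ₁} ⋯ dc^{k_n}_{τ_n}`: the bounded linear map which on the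
restriction to `Δ_n` of a symmetric elementary `f` is `e^{-Ã_{s,t}/2}` of the complex Stratonovich
integral of `f`. -/
def IsComplexWienerIntegral {ι : Type*} [Fintype ι] (X : OrthonormalBasis ι ℝ V) (n : ℕ)
    (s t : ℝ) {M : Measure (GenConnC V)} (J : Kernel ι n →L[ℂ] Lp ℂ 2 M) : Prop :=
  ∀ (d : ℕ) (F : Frame V d) (c : (Fin n → Fin d) → ℂ),
    (∀ (π : Equiv.Perm (Fin n)) (α : Fin n → Fin d), c (α ∘ π) = c α) →
    ∀ H : Kernel ι n,
      (∀ k, (H k : (Fin n → ℝ) → ℂ) =ᵐ[volume.restrict (simplex n)] elemKernel X F c k) →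
      (J H : GenConnC V → ℂ) =ᵐ[M]
        fun C => evalXY (expNegHalf (complexCoeff d s t) (complexify (stratPoly c))) (F.coordC C)

end Defs

end WienerSB

end

open WienerSB

/-!
The transform is forced on exponentials. For a continuous functional `φ` on `Ā`, the cylinder
function `A ↦ exp (i φ(A))` must go to the function `C ↦ exp (-t‖φ‖²/2) exp (i φ(C))`, with `φ`
extended complex-linearly, because the heat kernel multiplies a character by a constant. The
Fourier transforms of `P` and `M` show that both families have the same Gram matrix
(`inner_holExp`), and the characters span a dense subspace of `L²(P)` (`span_character_dense`),
so there is exactly one linear isometry with these values. It acts on every square-integrable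
cylinder function by the heat kernel integral: that integral depends continuously on the function
at each point `z`, the coordinates of a frame have law `N(0, s)^d`, and an isometry is continuous,
so the formula passes from combinations of characters to all functions of the coordinates
(`exists_unique_segalBargmann`).

On polynomials, integration by parts gives that the heat kernel integral sends `e^{-sΔ/2} p` to
the analytic continuation of `e^{-(s-t)Δ/2} p`. On holomorphic functions `∂_y² = -∂_x²`, so
`A_{s,t} = (s - t)Δ` there, and the image is `e^{-A_{s,t}/2} p_ℂ` (`IsSegalBargmann.hermite`).
Conversely, if `e^{-A_{s,t}/2} q` is holomorphic with `q` homogeneous of degree `n`, then its top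
homogeneous part `q` is holomorphic as well, so it is `p_ℂ` for a homogeneous `p`. Hence the
generators of the two chaos spaces correspond, and an isometry of a complete space carries
closures to closures (`IsSegalBargmann.image_hermiteSpace`).

For the multiple Wiener integral, the Hermite polynomials of a symmetric tensor `c` satisfy
`‖e^{-sΔ/2} p‖² = (sⁿ / n!) ∑ |c_α|²` (`integral_norm_sq_hermite`), and the `n!` images of the
simplex under permutations of the coordinates cover the cube, so the right side is at most `sⁿ`
times the squared norm of the kernel on the simplex (`sum_norm_sq_coeff_le`). Two elementary
kernels can be written along a common frame, so the elementary pairs (kernel, integral) form the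
graph of a bounded linear map. Its domain is dense: on the simplex the symmetrization of the
indicator of a box with ordered disjoint sides reduces to that indicator
(`elemKernel_boxFrame`), and such boxes cover the simplex up to a null set
(`dense_span_elementary`). This gives `I_n`, its uniqueness, and the uniqueness of `J_n`. Since
the transform sends the Hermite polynomial of `c` to its complex counterpart, `S ∘ I_n` has the
defining property of `J_n`, which proves both the existence of `J_n` and `S (I_n H) = J_n H`.
-/

noncomputable section

namespace WienerSB

/-! ### Extension of densely defined maps -/

section Extension

variable {E F : Type*} [NormedAddCommGroup E] [NormedAddCommGroup F]

/-- Two families with the same Gram matrix, the first one total, are related by a linear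
isometry. -/
theorem exists_linearIsometry_of_inner_eq [InnerProductSpace ℂ E] [InnerProductSpace ℂ F]
    [CompleteSpace F] {α : Type*} (v : α → E) (w : α → F)
    (h : ∀ x y, inner ℂ (w x) (w y) = inner ℂ (v x) (v y))
    (hv : (Submodule.span ℂ (Set.range v)).topologicalClosure = ⊤) :
    ∃ U : E →ₗᵢ[ℂ] F, ∀ x, U (v x) = w x := by
  set e : (α →₀ ℂ) →ₗ[ℂ] E := Finsupp.linearCombination ℂ v with he
  set f : (α →₀ ℂ) →ₗ[ℂ] F := Finsupp.linearCombination ℂ w with hf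
  have hinner : ∀ a b, inner ℂ (f a) (f b) = inner ℂ (e a) (e b) := by
    intro a b
    simp only [he, hf, Finsupp.linearCombination_apply, Finsupp.sum, sum_inner, inner_sum,
      inner_smul_left, inner_smul_right, h]
  have hnorm : ∀ a, ‖f a‖ = ‖e a‖ := by
    intro a
    rw [@norm_eq_sqrt_re_inner ℂ, @norm_eq_sqrt_re_inner ℂ, hinner]
  have hdense : DenseRange e := by
    have : (Set.range e) = (Submodule.span ℂ (Set.range v) : Set E) := by
      rw [he, ← LinearMap.coe_range, Finsupp.range_linearCombination]
    rw [DenseRange, this, Submodule.dense_iff_topologicalClosure_eq_top]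
    exact hv
  have hU : ∀ a, f.extendOfNorm e (e a) = f a :=
    LinearMap.extendOfNorm_eq hdense ⟨1, fun a => by rw [hnorm, one_mul]⟩
  refine ⟨⟨(f.extendOfNorm e : E →L[ℂ] F).toLinearMap, fun x => ?_⟩, fun x => ?_⟩
  · refine hdense.induction_on (p := fun x => ‖f.extendOfNorm e x‖ = ‖x‖) x
      (isClosed_eq (by fun_prop) (by fun_prop)) fun a => ?_
    rw [hU, hnorm]
  · have := hU (Finsupp.single x 1)
    simpa [he, hf] using this

/-- A bounded linear relation with dense domain is contained in the graph of a bounded linear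
map. -/
theorem exists_clm_of_bounded_relation [NormedSpace ℂ E] [NormedSpace ℂ F] [CompleteSpace F]
    (G : Submodule ℂ (E × F)) (C : ℝ) (hG : ∀ x ∈ G, ‖x.2‖ ≤ C * ‖x.1‖)
    (hd : Dense {v : E | ∃ w, (v, w) ∈ G}) :
    ∃ T : E →L[ℂ] F, ∀ x ∈ G, T x.1 = x.2 := by
  set e : G →ₗ[ℂ] E := (LinearMap.fst ℂ E F).comp G.subtype with he
  set f : G →ₗ[ℂ] F := (LinearMap.snd ℂ E F).comp G.subtype with hf
  have hdense : DenseRange e := by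
    refine hd.mono ?_
    rintro v ⟨w, hw⟩
    exact ⟨⟨(v, w), hw⟩, rfl⟩
  refine ⟨f.extendOfNorm e, fun x hx => ?_⟩
  exact LinearMap.extendOfNorm_eq (f := f) (e := e) hdense ⟨C, fun a => hG a a.2⟩ ⟨x, hx⟩

end Extension

/-! ### Totality criteria in `L²` -/

section Totality

/-- An integrable function whose integrals over a generating `π`-system and over the whole space
vanish is zero almost everywhere. -/
theorem ae_eq_zero_of_setIntegral_piSystem {α : Type*} [m : MeasurableSpace α] {μ : Measure α}
    {f : α → ℂ} (hf : Integrable f μ) {C : Set (Set α)} (hC : IsPiSystem C)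
    (hgen : m = MeasurableSpace.generateFrom C) (h : ∀ s ∈ C, ∫ x in s, f x ∂μ = 0)
    (huniv : ∫ x, f x ∂μ = 0) : f =ᵐ[μ] 0 := by
  suffices H : ∀ s, MeasurableSet s → ∫ x in s, f x ∂μ = 0 from
    hf.ae_eq_zero_of_forall_setIntegral_eq_zero fun s hs _ => H s hs
  intro s hs
  induction s, hs using MeasurableSpace.induction_on_inter hgen hC with
  | empty => simp
  | basic s hs => exact h s hs
  | compl s hs ih =>
    rw [setIntegral_compl hs hf, huniv, ih, sub_zero]
  | iUnion g hd hg ih =>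
    rw [integral_iUnion hg hd hf.integrableOn]
    simp [ih]

variable {E : Type*} [NormedAddCommGroup E] [NormedSpace ℝ E] [MeasurableSpace E] [BorelSpace E]

theorem memLp_character (μ : Measure E) [IsFiniteMeasure μ] (L : StrongDual ℝ E) :
    MemLp (fun x => Complex.exp (L x * Complex.I)) 2 μ := by
  refine MemLp.of_bound (by fun_prop) 1 (.of_forall fun x => ?_)
  rw [Complex.norm_exp_ofReal_mul_I]

/-- The character `x ↦ exp(i L x)` as an element of `L²`. -/
def character (μ : Measure E) [IsFiniteMeasure μ] (L : StrongDual ℝ E) : Lp ℂ 2 μ :=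
  (memLp_character μ L).toLp

variable [SecondCountableTopology E] [CompleteSpace E]

/-- A real integrable density whose Fourier transform vanishes is zero almost everywhere. -/
theorem ae_eq_zero_of_fourier_eq_zero_real {μ : Measure E} {g : E → ℝ}
    (hg : Integrable g μ) (h : ∀ L : StrongDual ℝ E, ∫ x, Complex.exp (L x * Complex.I) * g x ∂μ = 0) :
    g =ᵐ[μ] 0 := by
  have hfin : ∀ f : E → ℝ, Integrable f μ →
      IsFiniteMeasure (μ.withDensity fun x => ENNReal.ofReal (f x)) := fun f hf =>
    isFiniteMeasure_withDensity_ofReal hf.2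
  have hp := hfin _ hg.pos_part
  have hn := hfin _ hg.neg_part
  have hbd : ∀ (L : StrongDual ℝ E) (f : E → ℝ), Integrable f μ →
      Integrable (fun x => Complex.exp (L x * Complex.I) * (f x : ℂ)) μ := by
    intro L f hf
    refine hf.ofReal.bdd_mul (c := 1) (by fun_prop) ?_
    filter_upwards with x
    rw [Complex.norm_exp_ofReal_mul_I]
  have hchar : ∀ (L : StrongDual ℝ E) (f : E → ℝ), Integrable f μ → (∀ x, 0 ≤ f x) →
      charFunDual (μ.withDensity fun x => ENNReal.ofReal (f x)) L
        = ∫ x, Complex.exp (L x * Complex.I) * f x ∂μ := by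
    intro L f hf hf0
    rw [charFunDual_apply, integral_withDensity_eq_integral_toReal_smul₀
      hf.aestronglyMeasurable.aemeasurable.ennreal_ofReal (by simp)]
    refine integral_congr_ae (.of_forall fun x => ?_)
    simp [ENNReal.toReal_ofReal (hf0 x), mul_comm]
  -- the positive and the negative part of `g` are densities with equal characteristic functions
  have heq : (μ.withDensity fun x => ENNReal.ofReal (max (g x) 0))
      = μ.withDensity fun x => ENNReal.ofReal (max (-g x) 0) := by
    refine Measure.ext_of_charFunDual (funext fun L => ?_)
    rw [hchar L _ hg.pos_part (by simp), hchar L _ hg.neg_part (by simp), ← sub_eq_zero,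
      ← integral_sub (hbd L _ hg.pos_part) (hbd L _ hg.neg_part), ← h L]
    refine integral_congr_ae (.of_forall fun x => ?_)
    dsimp only
    rw [← mul_sub, ← Complex.ofReal_sub]
    congr 2
    rcases le_total (g x) 0 with h0 | h0 <;> simp [h0]
  refine hg.ae_eq_zero_of_forall_setIntegral_eq_zero fun s hs _ => ?_
  have h1 : ∀ f : E → ℝ, Integrable f μ → (∀ x, 0 ≤ f x) →
      ((μ.withDensity fun x => ENNReal.ofReal (f x)) s).toReal = ∫ x in s, f x ∂μ := by
    intro f hf hf0
    rw [withDensity_apply _ hs, integral_eq_lintegral_of_nonneg_ae (.of_forall hf0)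
      hf.aestronglyMeasurable.restrict]
  have h2 : ∫ x in s, max (g x) 0 ∂μ = ∫ x in s, max (-g x) 0 ∂μ := by
    rw [← h1 _ hg.pos_part (by simp), ← h1 _ hg.neg_part (by simp), heq]
  rw [← sub_eq_zero, ← integral_sub hg.pos_part.integrableOn hg.neg_part.integrableOn] at h2
  rw [← h2]
  refine integral_congr_ae (.of_forall fun x => ?_)
  dsimp only
  rcases le_total (g x) 0 with h0 | h0 <;> simp [h0]

/-- Injectivity of the Fourier transform for a complex density, by splitting it into its real and
imaginary parts. -/
theorem ae_eq_zero_of_fourier_eq_zero {μ : Measure E} {g : E → ℂ}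
    (hg : Integrable g μ) (h : ∀ L : StrongDual ℝ E, ∫ x, Complex.exp (L x * Complex.I) * g x ∂μ = 0) :
    g =ᵐ[μ] 0 := by
  have hbd : ∀ (L : StrongDual ℝ E) (f : E → ℂ), Integrable f μ →
      Integrable (fun x => Complex.exp (L x * Complex.I) * f x) μ := by
    intro L f hf
    refine hf.bdd_mul (c := 1) (by fun_prop) ?_
    filter_upwards with x
    rw [Complex.norm_exp_ofReal_mul_I]
  have hg' : Integrable (fun x => star (g x)) μ := by
    refine ⟨hg.1.star, ?_⟩
    simpa [HasFiniteIntegral] using hg.2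
  -- conjugating the hypothesis at `-L` gives it for the conjugate of `g`
  have h' : ∀ L : StrongDual ℝ E, ∫ x, Complex.exp (L x * Complex.I) * star (g x) ∂μ = 0 := by
    intro L
    have := congrArg star (h (-L))
    rw [star_zero] at this
    rw [← this]
    change _ = (starRingEnd ℂ) _
    rw [← integral_conj]
    refine integral_congr_ae (.of_forall fun x => ?_)
    simp [← Complex.exp_conj]
  have hre : (fun x => (g x).re) =ᵐ[μ] 0 := by
    refine ae_eq_zero_of_fourier_eq_zero_real hg.re fun L => ?_
    have : ∀ x, Complex.exp (L x * Complex.I) * ((g x).re : ℂ)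
        = (1 / 2 : ℂ) * (Complex.exp (L x * Complex.I) * g x
          + Complex.exp (L x * Complex.I) * star (g x)) := by
      intro x
      rw [Complex.re_eq_add_conj]
      simp only [Complex.star_def]
      ring
    simp_rw [this]
    rw [integral_const_mul, integral_add (hbd L _ hg) (hbd L _ hg'), h, h']
    simp
  have him : (fun x => (g x).im) =ᵐ[μ] 0 := by
    refine ae_eq_zero_of_fourier_eq_zero_real hg.im fun L => ?_
    have : ∀ x, Complex.exp (L x * Complex.I) * ((g x).im : ℂ)
        = (1 / (2 * Complex.I) : ℂ) * (Complex.exp (L x * Complex.I) * g x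
          - Complex.exp (L x * Complex.I) * star (g x)) := by
      intro x
      rw [Complex.im_eq_sub_conj]
      simp only [Complex.star_def]
      ring
    simp_rw [this]
    rw [integral_const_mul, integral_sub (hbd L _ hg) (hbd L _ hg'), h, h']
    simp
  filter_upwards [hre, him] with x h1 h2
  exact Complex.ext h1 h2

/-- Trigonometric polynomials are dense in `L²` of a finite measure on a separable Banach
space. -/
theorem span_character_dense (μ : Measure E) [IsFiniteMeasure μ] :
    (Submodule.span ℂ (Set.range (character μ))).topologicalClosure = ⊤ := by
  rw [Submodule.topologicalClosure_eq_top_iff, Submodule.eq_bot_iff]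
  intro g hg
  rw [Submodule.mem_orthogonal] at hg
  have hint : Integrable g μ := (Lp.memLp g).integrable (by norm_num)
  have : (g : E → ℂ) =ᵐ[μ] 0 := by
    refine ae_eq_zero_of_fourier_eq_zero hint fun L => ?_
    have h1 := hg (character μ (-L)) (Submodule.subset_span ⟨_, rfl⟩)
    rw [L2.inner_def] at h1
    rw [← h1]
    refine integral_congr_ae ?_
    filter_upwards [(memLp_character μ (-L)).coeFn_toLp] with x hx
    rw [character, hx]
    simp [← Complex.exp_conj, mul_comm]
  exact (Lp.eq_zero_iff_ae_eq_zero).2 this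

end Totality

/-! ### The operator `e^{-L/2}` on polynomials -/

section PolynomialAlgebra

open MvPolynomial

variable {σ : Type*}

theorem pderiv_pderiv_comm (i j : σ) (p : MvPolynomial σ ℂ) :
    pderiv i (pderiv j p) = pderiv j (pderiv i p) := by
  classical
  induction p using MvPolynomial.induction_on with
  | C a => simp
  | add p q hp hq => simp [hp, hq]
  | mul_X p k hp =>
    simp only [pderiv_mul, map_add, hp, pderiv_X, Pi.single_apply]
    split_ifs <;> simp [add_comm, add_left_comm]

theorem pderiv_prod {ι : Type*} [DecidableEq ι] (s : Finset ι) (f : ι → MvPolynomial σ ℂ) (j : σ) :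
    pderiv j (∏ i ∈ s, f i) = ∑ i ∈ s, (∏ k ∈ s.erase i, f k) * pderiv j (f i) := by
  induction s using Finset.induction_on with
  | empty => simp
  | insert a s ha ih =>
    rw [Finset.prod_insert ha, pderiv_mul, ih, Finset.sum_insert ha, Finset.erase_insert ha,
      mul_comm, Finset.mul_sum]
    congr 1
    refine Finset.sum_congr rfl fun i hi => ?_
    have hai : a ≠ i := fun h => ha (h ▸ hi)
    rw [Finset.erase_insert_of_ne hai,
      Finset.prod_insert (fun h => ha (Finset.mem_of_mem_erase h)), mul_assoc]

theorem pderiv_aeval {τ : Type*} [Fintype σ] (f : σ → MvPolynomial τ ℂ) (i : τ)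
    (p : MvPolynomial σ ℂ) :
    pderiv i (aeval f p) = ∑ j, aeval f (pderiv j p) * pderiv i (f j) := by
  classical
  induction p using MvPolynomial.induction_on with
  | C a => simp
  | add p q hp hq => simp only [map_add, hp, hq, add_mul, Finset.sum_add_distrib]
  | mul_X p k hp =>
    have h1 : ∀ j, aeval f (pderiv j (p * X k)) * pderiv i (f j)
        = aeval f (pderiv j p) * pderiv i (f j) * f k
          + if j = k then aeval f p * pderiv i (f k) else 0 := by
      intro j
      rw [pderiv_mul, map_add, map_mul, map_mul, aeval_X, pderiv_X, Pi.single_apply]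
      rcases eq_or_ne j k with rfl | h
      · rw [if_pos rfl, if_pos rfl, map_one]; ring
      · rw [if_neg h, if_neg (Ne.symm h), map_zero]; ring
    rw [map_mul, aeval_X, pderiv_mul, hp, Finset.sum_congr rfl fun j _ => h1 j,
      Finset.sum_add_distrib, ← Finset.sum_mul, Finset.sum_ite_eq' Finset.univ k,
      if_pos (Finset.mem_univ k)]

/-- A linear map on polynomials is determined by its value at `1` and by a first-order recursion
for multiplication by the coordinates. -/
theorem linearMap_eq_of_recursion {E : Type*} [AddCommGroup E] [Module ℂ E]
    {f g : MvPolynomial σ ℂ →ₗ[ℂ] E} (A : σ → E →ₗ[ℂ] E) (a : ℂ)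
    (h1 : f 1 = g 1)
    (hf : ∀ j p, f (X j * p) = A j (f p) + a • f (pderiv j p))
    (hg : ∀ j p, g (X j * p) = A j (g p) + a • g (pderiv j p)) : f = g := by
  classical
  have key : ∀ n : ℕ, ∀ m : σ →₀ ℕ, m.degree = n → ∀ b : ℂ,
      f (monomial m b) = g (monomial m b) := by
    intro n
    induction n using Nat.strong_induction_on with
    | _ n ih =>
      intro m hm b
      by_cases hm0 : m = 0
      · subst hm0
        have : (monomial 0 b : MvPolynomial σ ℂ) = b • 1 := by
          rw [smul_eq_C_mul, mul_one]; rfl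
        rw [this, map_smul, map_smul, h1]
      · obtain ⟨j, hj⟩ := Finsupp.ne_iff.1 hm0
        have hle : Finsupp.single j 1 ≤ m := by
          rw [Finsupp.single_le_iff]
          exact Nat.one_le_iff_ne_zero.2 hj
        set m' := m - Finsupp.single j 1 with hm'
        have hadd : Finsupp.single j 1 + m' = m := add_tsub_cancel_of_le hle
        have hdeg : m'.degree + 1 = n := by
          rw [← hm, ← hadd, map_add, Finsupp.degree_single, add_comm]
        have hmon : (monomial m b : MvPolynomial σ ℂ) = X j * monomial m' b := by
          rw [X, monomial_mul, hadd, one_mul]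
        have hder : ∀ c, f (pderiv j (monomial m' c)) = g (pderiv j (monomial m' c)) := by
          intro c
          rw [pderiv_monomial]
          by_cases h0 : m' j = 0
          · simp [h0]
          · have hle' : Finsupp.single j 1 ≤ m' := by
              rw [Finsupp.single_le_iff]
              exact Nat.one_le_iff_ne_zero.2 h0
            have := congrArg Finsupp.degree (add_tsub_cancel_of_le hle')
            rw [map_add, Finsupp.degree_single] at this
            exact ih _ (by omega) _ rfl _
        rw [hmon, hf, hg, ih _ (by omega) m' rfl, hder]
  refine LinearMap.ext fun p => ?_
  induction p using MvPolynomial.induction_on' with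
  | monomial m b => exact key _ m rfl b
  | add p q hp hq => rw [map_add, map_add, hp, hq]

variable [Fintype σ] (g : σ → ℝ)

theorem polyLap_apply (p : MvPolynomial σ ℂ) :
    polyLap g p = ∑ i, (g i : ℂ) • pderiv i (pderiv i p) := by
  simp [polyLap, LinearMap.sum_apply]

theorem polyLap_pderiv (j : σ) (p : MvPolynomial σ ℂ) :
    polyLap g (pderiv j p) = pderiv j (polyLap g p) := by
  simp only [polyLap_apply, map_sum, Derivation.map_smul]
  refine Finset.sum_congr rfl fun i _ => ?_
  rw [pderiv_pderiv_comm i j, pderiv_pderiv_comm i j]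

theorem polyLap_pow_pderiv (k : ℕ) (j : σ) (p : MvPolynomial σ ℂ) :
    (polyLap g ^ k) (pderiv j p) = pderiv j ((polyLap g ^ k) p) := by
  induction k generalizing p with
  | zero => simp
  | succ k ih => rw [pow_succ, Module.End.mul_apply, polyLap_pderiv, ih, Module.End.mul_apply]

theorem polyLap_X_mul (j : σ) (p : MvPolynomial σ ℂ) :
    polyLap g (X j * p) = X j * polyLap g p + (2 * g j : ℂ) • pderiv j p := by
  classical
  have h : ∀ i, pderiv i (pderiv i (X j * p))
      = X j * pderiv i (pderiv i p) + if i = j then (2 : ℂ) • pderiv j p else 0 := by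
    intro i
    by_cases hij : i = j
    · subst hij
      simp only [pderiv_mul, pderiv_X_self, map_add, one_mul, if_true]
      rw [two_smul]
      ring
    · simp [pderiv_X_of_ne (Ne.symm hij), hij]
  simp only [polyLap_apply, h, smul_add, Finset.sum_add_distrib, Finset.mul_sum, mul_smul_comm]
  congr 1
  simp [smul_smul, mul_comm]

theorem polyLap_pow_succ_X_mul (k : ℕ) (j : σ) (p : MvPolynomial σ ℂ) :
    (polyLap g ^ (k + 1)) (X j * p) = X j * (polyLap g ^ (k + 1)) p
      + (2 * (k + 1) * g j : ℂ) • pderiv j ((polyLap g ^ k) p) := by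
  induction k with
  | zero => simp [polyLap_X_mul]
  | succ k ih =>
    rw [pow_succ', Module.End.mul_apply, ih, map_add, polyLap_X_mul, map_smul, polyLap_pderiv,
      ← Module.End.mul_apply, ← pow_succ', ← Module.End.mul_apply (polyLap g) (polyLap g ^ k) p,
      ← pow_succ', add_assoc, ← add_smul]
    congr 2
    push_cast
    ring

theorem isHomogeneous_polyLap {n : ℕ} {p : MvPolynomial σ ℂ} (hp : p.IsHomogeneous n) :
    (polyLap g p).IsHomogeneous (n - 2) := by
  rw [polyLap_apply]
  refine IsHomogeneous.sum _ _ _ fun i _ => ?_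
  rw [smul_eq_C_mul]
  exact (hp.pderiv.pderiv).C_mul _

theorem polyLap_eq_zero_of_isHomogeneous_zero {p : MvPolynomial σ ℂ} (hp : p.IsHomogeneous 0) :
    polyLap g p = 0 := by
  rw [← totalDegree_zero_iff_isHomogeneous, totalDegree_eq_zero_iff_eq_C] at hp
  rw [hp]
  simp [polyLap_apply]

theorem polyLap_pow_eq_zero_of_isHomogeneous {k n : ℕ} (hk : n < k) {p : MvPolynomial σ ℂ}
    (hp : p.IsHomogeneous n) : (polyLap g ^ k) p = 0 := by
  induction k generalizing n p with
  | zero => omega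
  | succ k ih =>
    rw [pow_succ, Module.End.mul_apply]
    rcases Nat.eq_zero_or_pos n with rfl | hn
    · rw [polyLap_eq_zero_of_isHomogeneous_zero g hp, map_zero]
    · exact ih (by omega) (isHomogeneous_polyLap g hp)

theorem polyLap_pow_eq_zero {k : ℕ} {p : MvPolynomial σ ℂ} (hk : p.totalDegree < k) :
    (polyLap g ^ k) p = 0 := by
  rw [← sum_homogeneousComponent p, map_sum]
  refine Finset.sum_eq_zero fun i hi => ?_
  rw [Finset.mem_range] at hi
  exact polyLap_pow_eq_zero_of_isHomogeneous g (by omega) (homogeneousComponent_isHomogeneous i p)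

/-- The exponential series of `e^{-L/2}` may be truncated anywhere above the degree. -/
theorem expNegHalf_eq_sum {N : ℕ} {p : MvPolynomial σ ℂ} (hN : p.totalDegree < N) :
    expNegHalf g p
      = ∑ k ∈ Finset.range N, ((-1 / 2 : ℂ) ^ k / (k.factorial : ℂ)) • (polyLap g ^ k) p := by
  rw [expNegHalf]
  refine Finset.sum_subset (Finset.range_mono hN) fun k _ hk => ?_
  rw [Finset.mem_range, not_lt] at hk
  rw [polyLap_pow_eq_zero g (by omega), smul_zero]

/-- `e^{-L/2}` as a linear map. -/
def expNegHalfₗ : MvPolynomial σ ℂ →ₗ[ℂ] MvPolynomial σ ℂ where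
  toFun := expNegHalf g
  map_add' p q := by
    have hN := totalDegree_add p q
    set N := max p.totalDegree q.totalDegree + 1 with hNdef
    have h1 := le_max_left p.totalDegree q.totalDegree
    have h2 := le_max_right p.totalDegree q.totalDegree
    rw [expNegHalf_eq_sum g (N := N) (by omega), expNegHalf_eq_sum g (p := p) (N := N) (by omega),
      expNegHalf_eq_sum g (p := q) (N := N) (by omega), ← Finset.sum_add_distrib]
    simp
  map_smul' a p := by
    rw [expNegHalf_eq_sum g (N := p.totalDegree + 1)
      (Nat.lt_succ_of_le (totalDegree_smul_le a p)), RingHom.id_apply, expNegHalf,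
      Finset.smul_sum]
    refine Finset.sum_congr rfl fun k _ => ?_
    rw [map_smul, smul_comm]

@[simp]
theorem expNegHalfₗ_apply (p : MvPolynomial σ ℂ) : expNegHalfₗ g p = expNegHalf g p := rfl

theorem expNegHalf_add (p q : MvPolynomial σ ℂ) :
    expNegHalf g (p + q) = expNegHalf g p + expNegHalf g q := (expNegHalfₗ g).map_add p q

theorem expNegHalf_smul (a : ℂ) (p : MvPolynomial σ ℂ) :
    expNegHalf g (a • p) = a • expNegHalf g p := (expNegHalfₗ g).map_smul a p

theorem expNegHalf_one : expNegHalf g 1 = 1 := by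
  simp [expNegHalf]

theorem pderiv_expNegHalf (j : σ) (p : MvPolynomial σ ℂ) :
    pderiv j (expNegHalf g p) = expNegHalf g (pderiv j p) := by
  have h1 := le_max_left p.totalDegree (pderiv j p).totalDegree
  have h2 := le_max_right p.totalDegree (pderiv j p).totalDegree
  rw [expNegHalf_eq_sum g (p := p) (Nat.lt_succ_of_le h1),
    expNegHalf_eq_sum g (p := pderiv j p) (Nat.lt_succ_of_le h2), map_sum]
  refine Finset.sum_congr rfl fun k _ => ?_
  rw [Derivation.map_smul, polyLap_pow_pderiv]

/-- The creation operator: multiplication by `X j` is intertwined with `X j - g j ∂ⱼ`. -/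
theorem expNegHalf_X_mul (j : σ) (p : MvPolynomial σ ℂ) :
    expNegHalf g (X j * p)
      = X j * expNegHalf g p - (g j : ℂ) • expNegHalf g (pderiv j p) := by
  set N := max p.totalDegree (X j * p).totalDegree + 1 with hN
  have h1 := le_max_left p.totalDegree (X j * p).totalDegree
  have h2 := le_max_right p.totalDegree (X j * p).totalDegree
  rw [← pderiv_expNegHalf, expNegHalf_eq_sum g (p := X j * p) (N := N + 1) (by omega)]
  nth_rewrite 1 [expNegHalf_eq_sum g (p := p) (N := N + 1) (by omega)]
  rw [expNegHalf_eq_sum g (p := p) (N := N) (by omega), Finset.sum_range_succ',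
    Finset.sum_range_succ' _ N, mul_add, Finset.mul_sum, map_sum, Finset.smul_sum]
  simp only [polyLap_pow_succ_X_mul, smul_add, Finset.sum_add_distrib, mul_smul_comm,
    Derivation.map_smul, smul_smul]
  rw [add_sub_right_comm, ← sub_eq_zero]
  simp only [pow_zero, Module.End.one_apply]
  have : ∀ k : ℕ, ((-1 / 2 : ℂ) ^ (k + 1) / ((k + 1).factorial : ℂ) * (2 * (k + 1) * g j))
      = -((g j : ℂ) * ((-1 / 2 : ℂ) ^ k / (k.factorial : ℂ))) := by
    intro k
    have hk : (k.factorial : ℂ) ≠ 0 := by exact_mod_cast k.factorial_ne_zero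
    have hk1 : (k : ℂ) + 1 ≠ 0 := by exact_mod_cast k.succ_ne_zero
    rw [Nat.factorial_succ]
    push_cast
    field_simp
    ring
  simp only [this, neg_smul, Finset.sum_neg_distrib]
  ring

/-- The leading homogeneous part of `e^{-L/2} p` is `p`. -/
theorem homogeneousComponent_expNegHalf {n : ℕ} {p : MvPolynomial σ ℂ} (hp : p.IsHomogeneous n) :
    homogeneousComponent n (expNegHalf g p) = p := by
  rw [expNegHalf, Finset.sum_range_succ', map_add, map_sum, Finset.sum_eq_zero]
  · simp [homogeneousComponent_of_mem hp]
  · intro k _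
    rw [map_smul]
    rcases Nat.eq_zero_or_pos n with rfl | hn
    · rw [polyLap_pow_eq_zero_of_isHomogeneous g (Nat.succ_pos k) hp, map_zero, smul_zero]
    · have h : ∀ k : ℕ, ((polyLap g ^ k) p).IsHomogeneous (n - 2 * k) := by
        intro k
        induction k with
        | zero => simpa using hp
        | succ k ih =>
          rw [pow_succ', Module.End.mul_apply]
          exact isHomogeneous_polyLap g ih
      rw [homogeneousComponent_of_mem (h (k + 1)), if_neg (by omega), smul_zero]

end PolynomialAlgebra

/-! ### Complexification and orthogonal substitutions -/

section Substitution

open MvPolynomial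

variable {d : ℕ}

theorem complexify_add (p q : MvPolynomial (Fin d) ℂ) :
    complexify (p + q) = complexify p + complexify q := map_add _ _ _

theorem complexify_mul (p q : MvPolynomial (Fin d) ℂ) :
    complexify (p * q) = complexify p * complexify q := map_mul _ _ _

theorem complexify_smul (a : ℂ) (p : MvPolynomial (Fin d) ℂ) :
    complexify (a • p) = a • complexify p := map_smul _ _ _

theorem complexify_X (j : Fin d) : complexify (X j : MvPolynomial (Fin d) ℂ)
    = X (Sum.inl j) + C Complex.I * X (Sum.inr j) := aeval_X _ _

/-- `complexify` as an algebra homomorphism. -/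
def complexifyₐ (d : ℕ) : MvPolynomial (Fin d) ℂ →ₐ[ℂ] MvPolynomial (Fin d ⊕ Fin d) ℂ :=
  aeval fun j => X (Sum.inl j) + C Complex.I * X (Sum.inr j)

theorem complexifyₐ_apply (p : MvPolynomial (Fin d) ℂ) : complexifyₐ d p = complexify p := rfl

theorem pderiv_inl_complexify (j : Fin d) (p : MvPolynomial (Fin d) ℂ) :
    pderiv (Sum.inl j) (complexify p) = complexify (pderiv j p) := by
  classical
  rw [complexify, pderiv_aeval, Finset.sum_eq_single j]
  · simp [complexify, pderiv_X]
  · intro b _ hb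
    simp [pderiv_X, hb]
  · simp

theorem pderiv_inr_complexify (j : Fin d) (p : MvPolynomial (Fin d) ℂ) :
    pderiv (Sum.inr j) (complexify p) = Complex.I • complexify (pderiv j p) := by
  classical
  rw [complexify, pderiv_aeval, Finset.sum_eq_single j]
  · simp [complexify, pderiv_X, smul_eq_C_mul, mul_comm]
  · intro b _ hb
    simp [pderiv_X, hb]
  · simp

/-- On holomorphic polynomials `A_{s,t}` acts as `(s - t) ∑ ∂²/∂z_k²`, because
`∂²/∂y² = -∂²/∂z²`. -/
theorem expNegHalf_complexify (s t : ℝ) (p : MvPolynomial (Fin d) ℂ) :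
    expNegHalf (complexCoeff d s t) (complexify p)
      = complexify (expNegHalf (realCoeff d (s - t)) p) := by
  have h : (expNegHalfₗ (complexCoeff d s t)).comp (complexifyₐ d).toLinearMap
      = (complexifyₐ d).toLinearMap.comp (expNegHalfₗ (realCoeff d (s - t))) := by
    refine linearMap_eq_of_recursion
      (fun j => LinearMap.mulLeft ℂ (complexify (X j))) (-(s - t : ℂ)) ?_ ?_ ?_
    · simp [expNegHalf_one]
    · intro j p
      simp only [LinearMap.comp_apply, AlgHom.toLinearMap_apply, expNegHalfₗ_apply,
        complexifyₐ_apply, LinearMap.mulLeft_apply]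
      rw [complexify_mul, complexify_X, add_mul, expNegHalf_add, expNegHalf_X_mul, mul_assoc,
        ← smul_eq_C_mul, expNegHalf_smul, expNegHalf_X_mul, pderiv_inl_complexify,
        pderiv_inr_complexify, expNegHalf_smul, add_mul, mul_assoc, ← smul_eq_C_mul, smul_sub,
        smul_smul, smul_smul]
      have : Complex.I * (complexCoeff d s t (Sum.inr j) : ℝ) * Complex.I
          = -((t / 2 : ℝ) : ℂ) := by
        simp only [complexCoeff, Sum.elim_inr]
        rw [mul_right_comm, Complex.I_mul_I]
        ring
      rw [this]
      have h2 : (-(s - t) : ℂ) = -((s - t / 2 : ℝ) : ℂ) + ((t / 2 : ℝ) : ℂ) := by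
        push_cast; ring
      rw [h2, add_smul, neg_smul, neg_smul]
      simp only [complexCoeff, Sum.elim_inl]
      abel
    · intro j p
      simp only [LinearMap.comp_apply, AlgHom.toLinearMap_apply, expNegHalfₗ_apply,
        complexifyₐ_apply, LinearMap.mulLeft_apply]
      rw [expNegHalf_X_mul, sub_eq_add_neg, complexify_add, complexify_mul, ← neg_smul,
        complexify_smul]
      simp [realCoeff]
  exact LinearMap.congr_fun h p

theorem evalXY_complexify (p : MvPolynomial (Fin d) ℂ) (z : Fin d → ℂ) :
    evalXY (complexify p) z = eval z p := by
  rw [evalXY, complexify, ← coe_aeval_eq_eval, ← coe_aeval_eq_eval]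
  change (aeval _) ((aeval _) p) = aeval _ p
  rw [comp_aeval_apply]
  congr 2
  funext j
  simp only [map_add, map_mul, aeval_X, aeval_C, Sum.elim_inl, Sum.elim_inr]
  rw [mul_comm]
  exact Complex.re_add_im (z j)

theorem isHomogeneous_complexify {n : ℕ} {p : MvPolynomial (Fin d) ℂ} (hp : p.IsHomogeneous n) :
    (complexify p).IsHomogeneous n := by
  have := hp.aeval (fun j => X (Sum.inl j) + C Complex.I * X (Sum.inr j) :
    Fin d → MvPolynomial (Fin d ⊕ Fin d) ℂ) (n := 1) fun j =>
      (isHomogeneous_X ℂ _).add ((isHomogeneous_X ℂ _).C_mul _)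
  rwa [one_mul] at this

/-- The linear substitution `X_j ↦ ∑_l R_{jl} X_l`. -/
def linSubst {m : ℕ} (R : Fin d → Fin m → ℝ) :
    MvPolynomial (Fin d) ℂ →ₐ[ℂ] MvPolynomial (Fin m) ℂ :=
  aeval fun j => ∑ l, (R j l : ℂ) • X l

theorem evalR_linSubst {m : ℕ} (R : Fin d → Fin m → ℝ) (p : MvPolynomial (Fin d) ℂ)
    (x : Fin m → ℝ) : evalR (linSubst R p) x = evalR p fun j => ∑ l, R j l * x l := by
  rw [evalR, evalR, linSubst, ← coe_aeval_eq_eval, ← coe_aeval_eq_eval]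
  change (aeval _) ((aeval _) p) = aeval _ p
  rw [comp_aeval_apply]
  congr 2
  funext j
  rw [map_sum, Complex.ofReal_sum]
  refine Finset.sum_congr rfl fun l _ => ?_
  rw [map_smul, aeval_X, smul_eq_mul, Complex.ofReal_mul]

/-- The Laplacian is invariant under substitutions with orthonormal rows. -/
theorem expNegHalf_linSubst {m : ℕ} {R : Fin d → Fin m → ℝ}
    (hR : ∀ i j, ∑ l, R i l * R j l = if i = j then 1 else 0) (s : ℝ)
    (p : MvPolynomial (Fin d) ℂ) :
    expNegHalf (realCoeff m s) (linSubst R p) = linSubst R (expNegHalf (realCoeff d s) p) := by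
  classical
  have h : (expNegHalfₗ (realCoeff m s)).comp (linSubst R).toLinearMap
      = (linSubst R).toLinearMap.comp (expNegHalfₗ (realCoeff d s)) := by
    refine linearMap_eq_of_recursion
      (fun j => LinearMap.mulLeft ℂ (linSubst R (X j))) (-(s : ℂ)) ?_ ?_ ?_
    · simp [expNegHalf_one]
    · intro j p
      simp only [LinearMap.comp_apply, AlgHom.toLinearMap_apply, expNegHalfₗ_apply,
        LinearMap.mulLeft_apply, map_mul]
      have hX : linSubst R (X j) = ∑ l, (R j l : ℂ) • X l := aeval_X _ _
      have hder : ∑ l, (R j l : ℂ) • pderiv l (linSubst R p) = linSubst R (pderiv j p) := by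
        have h1 : ∀ l, pderiv l (linSubst R p)
            = ∑ i, (R i l : ℂ) • linSubst R (pderiv i p) := by
          intro l
          rw [linSubst, pderiv_aeval]
          refine Finset.sum_congr rfl fun i _ => ?_
          rw [map_sum, Finset.sum_eq_single l]
          · simp [smul_eq_C_mul, mul_comm]
          · intro b _ hb
            simp [pderiv_X_of_ne hb]
          · simp
        simp_rw [h1, Finset.smul_sum, smul_smul]
        rw [Finset.sum_comm]
        simp_rw [← Finset.sum_smul]
        have h2 : ∀ i, ∑ l, (R j l : ℂ) * (R i l : ℂ) = if j = i then 1 else 0 := by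
          intro i
          have := hR j i
          rw [← Complex.ofReal_inj] at this
          push_cast at this
          rw [this]
          split_ifs <;> simp
        simp [h2]
      have hsum : ∀ (f : Fin m → MvPolynomial (Fin m) ℂ), expNegHalf (realCoeff m s) (∑ l, f l)
          = ∑ l, expNegHalf (realCoeff m s) (f l) := fun f => map_sum (expNegHalfₗ _) f _
      rw [← hder, hsum, hX, Finset.sum_mul, hsum, Finset.sum_mul, Finset.smul_sum,
        ← Finset.sum_add_distrib]
      refine Finset.sum_congr rfl fun l _ => ?_
      rw [smul_mul_assoc, expNegHalf_smul, expNegHalf_X_mul, expNegHalf_smul, smul_mul_assoc,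
        smul_sub, sub_eq_add_neg, smul_comm (-(s : ℂ)), neg_smul, smul_neg, realCoeff]
    · intro j p
      simp only [LinearMap.comp_apply, AlgHom.toLinearMap_apply, expNegHalfₗ_apply,
        LinearMap.mulLeft_apply]
      rw [expNegHalf_X_mul, sub_eq_add_neg, map_add, map_mul, ← neg_smul, map_smul]
      rfl
  exact LinearMap.congr_fun h p

end Substitution

/-! ### Stratonovich polynomials of symmetric tensors -/

section Stratonovich

open MvPolynomial

variable {d : ℕ}

/-- Contraction of a symmetric tensor in its first argument is symmetric. -/
theorem symmetric_cons {n : ℕ} {c : (Fin (n + 1) → Fin d) → ℂ}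
    (hc : ∀ (π : Equiv.Perm (Fin (n + 1))) α, c (α ∘ π) = c α) (j : Fin d)
    (π : Equiv.Perm (Fin n)) (α : Fin n → Fin d) :
    c (Fin.cons j (α ∘ π)) = c (Fin.cons j α) := by
  rw [← hc (Equiv.Perm.decomposeFin.symm (0, π)) (Fin.cons j α)]
  congr 1
  funext i
  refine Fin.cases ?_ (fun i => ?_) i
  · simp
  · simp

/-- Differentiating the Stratonovich polynomial of a symmetric tensor contracts the tensor. -/
theorem pderiv_stratPoly {n : ℕ} {c : (Fin (n + 1) → Fin d) → ℂ}
    (hc : ∀ (π : Equiv.Perm (Fin (n + 1))) α, c (α ∘ π) = c α) (j : Fin d) :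
    pderiv j (stratPoly c) = stratPoly fun α => c (Fin.cons j α) := by
  classical
  have hprod : ∀ α : Fin (n + 1) → Fin d,
      pderiv j (∏ i, (X (α i) : MvPolynomial (Fin d) ℂ))
        = ∑ i, if α i = j then ∏ k, X (α (i.succAbove k)) else 0 := by
    intro α
    rw [pderiv_prod]
    refine Finset.sum_congr rfl fun i _ => ?_
    rw [pderiv_X, Pi.single_apply]
    have : (Finset.univ.erase i) = Finset.univ.map (Fin.succAboveEmb i) := by
      ext k
      simp [Fin.exists_succAbove_eq_iff]
    simp only [this, Finset.prod_map, Fin.coe_succAboveEmb]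
    split_ifs with h1 <;> simp
  have hslot : ∀ i : Fin (n + 1),
      ∑ α : Fin (n + 1) → Fin d, c α • (if α i = j then
        (∏ k, X (α (i.succAbove k)) : MvPolynomial (Fin d) ℂ) else 0)
      = ∑ β : Fin n → Fin d, c (Fin.cons j β) • ∏ k, X (β k) := by
    intro i
    rw [← (Fin.insertNthEquiv (fun _ => Fin d) i).sum_comp, Fintype.sum_prod_type,
      Finset.sum_eq_single j]
    · refine Finset.sum_congr rfl fun β _ => ?_
      have : c (Fin.insertNth i j β) = c (Fin.cons j β) := by
        have h := Fin.insertNth_comp_cycleRange_symm i j β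
        rw [← h, hc]
      simp [Fin.insertNthEquiv, this]
    · intro b _ hb
      simp [Fin.insertNthEquiv, hb]
    · simp
  rw [stratPoly, stratPoly, Derivation.map_smul, map_sum]
  simp only [Derivation.map_smul, hprod, Finset.smul_sum]
  rw [Finset.sum_comm]
  simp only [← Finset.smul_sum]
  rw [Finset.sum_congr rfl fun i _ => hslot i, Finset.sum_const, Finset.card_univ,
    Fintype.card_fin, ← Nat.cast_smul_eq_nsmul ℂ, smul_smul]
  congr 1
  have hk : (n.factorial : ℂ) ≠ 0 := by exact_mod_cast n.factorial_ne_zero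
  have hk1 : (n : ℂ) + 1 ≠ 0 := by exact_mod_cast n.succ_ne_zero
  rw [Nat.factorial_succ]
  push_cast
  field_simp

theorem linSubst_stratPoly {n m : ℕ} (R : Fin d → Fin m → ℝ) (c : (Fin n → Fin d) → ℂ) :
    linSubst R (stratPoly c)
      = stratPoly fun β : Fin n → Fin m => ∑ α, c α * ∏ i, (R (α i) (β i) : ℂ) := by
  rw [stratPoly, stratPoly, map_smul, map_sum]
  congr 1
  simp only [map_smul, map_prod, Finset.sum_smul]
  rw [Finset.sum_comm]
  refine Finset.sum_congr rfl fun α _ => ?_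
  have : ∀ i, linSubst R (X (α i)) = ∑ l, (R (α i) l : ℂ) • X l := fun i => aeval_X _ _
  simp only [this]
  rw [Finset.prod_univ_sum, Finset.smul_sum, Fintype.piFinset_univ]
  refine Finset.sum_congr rfl fun β _ => ?_
  rw [Finset.prod_smul, smul_smul]

end Stratonovich

/-! ### Gaussian measures on `ℝ^d` and the finite-dimensional transform -/

section FiniteDimensional

open ProbabilityTheory MvPolynomial

/-- The centered Gaussian measure of variance `s` on `ℝ^d`, as a product measure. -/
def gaussPi (d : ℕ) (s : ℝ) : Measure (Fin d → ℝ) :=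
  Measure.pi fun _ => gaussianReal 0 s.toNNReal

instance (d : ℕ) (s : ℝ) : IsProbabilityMeasure (gaussPi d s) := by
  unfold gaussPi; infer_instance

/-- The Lebesgue density of `gaussPi d s`. -/
def gaussPiDensity {d : ℕ} (s : ℝ) (x : Fin d → ℝ) : ℝ :=
  ∏ j, gaussianPDFReal 0 s.toNNReal (x j)

theorem gaussPiDensity_pos {d : ℕ} {s : ℝ} (hs : 0 < s) (x : Fin d → ℝ) :
    0 < gaussPiDensity s x :=
  Finset.prod_pos fun _ _ => gaussianPDFReal_pos _ _ _ (Real.toNNReal_pos.2 hs).ne'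

theorem measurable_gaussPiDensity {d : ℕ} (s : ℝ) :
    Measurable (gaussPiDensity s : (Fin d → ℝ) → ℝ) := by
  unfold gaussPiDensity
  exact Finset.measurable_prod _ fun j _ =>
    (measurable_gaussianPDFReal _ _).comp (measurable_pi_apply j)

theorem gaussPi_eq_withDensity (d : ℕ) {s : ℝ} (hs : 0 < s) :
    gaussPi d s = volume.withDensity fun x => ENNReal.ofReal (gaussPiDensity s x) := by
  have hs' : s.toNNReal ≠ 0 := (Real.toNNReal_pos.2 hs).ne'
  refine Measure.pi_eq fun S hS => ?_
  rw [withDensity_apply _ (MeasurableSet.univ_pi hS), volume_pi, Measure.restrict_pi_pi,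
    ← ofReal_integral_eq_lintegral_ofReal]
  · simp only [gaussPiDensity]
    rw [integral_fintype_prod_eq_prod (fun _ => gaussianPDFReal 0 s.toNNReal),
      ENNReal.ofReal_prod_of_nonneg fun i _ => integral_nonneg fun x => gaussianPDFReal_nonneg _ _ _]
    refine Finset.prod_congr rfl fun i _ => ?_
    rw [gaussianReal_apply_eq_integral _ hs']
  · exact Integrable.fintype_prod fun i => (integrable_gaussianPDFReal _ _).restrict
  · exact .of_forall fun x => (gaussPiDensity_pos hs x).le

theorem integral_gaussPi {d : ℕ} {s : ℝ} (hs : 0 < s) (f : (Fin d → ℝ) → ℂ) :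
    ∫ x, f x ∂gaussPi d s = ∫ x, (gaussPiDensity s x : ℂ) * f x := by
  rw [gaussPi_eq_withDensity d hs, integral_withDensity_eq_integral_toReal_smul
    (measurable_gaussPiDensity s).ennreal_ofReal (by simp)]
  refine integral_congr_ae (.of_forall fun x => ?_)
  simp [ENNReal.toReal_ofReal (gaussPiDensity_pos hs x).le]

theorem integrable_gaussPi_iff {d : ℕ} {s : ℝ} (hs : 0 < s) (f : (Fin d → ℝ) → ℂ) :
    Integrable f (gaussPi d s) ↔ Integrable (fun x => (gaussPiDensity s x : ℂ) * f x) := by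
  rw [gaussPi_eq_withDensity d hs, integrable_withDensity_iff_integrable_smul'
    (measurable_gaussPiDensity s).ennreal_ofReal (by simp)]
  refine integrable_congr (.of_forall fun x => ?_)
  simp [ENNReal.toReal_ofReal (gaussPiDensity_pos hs x).le]

theorem memLp_two_prod {d : ℕ} {μ : Fin d → Measure ℝ} [∀ j, SigmaFinite (μ j)]
    {f : Fin d → ℝ → ℂ} (hf : ∀ j, MemLp (f j) 2 (μ j)) :
    MemLp (fun x : Fin d → ℝ => ∏ j, f j (x j)) 2 (Measure.pi μ) := by
  have hm : AEStronglyMeasurable (fun x : Fin d → ℝ => ∏ j, f j (x j)) (Measure.pi μ) := by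
    refine Finset.aestronglyMeasurable_fun_prod _ fun j _ => ?_
    exact (hf j).1.comp_quasiMeasurePreserving (Measure.quasiMeasurePreserving_eval μ j)
  rw [memLp_two_iff_integrable_sq_norm hm]
  simp only [norm_prod, ← Finset.prod_pow]
  exact Integrable.fintype_prod (f := fun j y => ‖f j y‖ ^ 2) fun j =>
    (memLp_two_iff_integrable_sq_norm (hf j).1).1 (hf j)

theorem memLp_pow_gaussianReal (v : NNReal) (k : ℕ) :
    MemLp (fun x : ℝ => (x : ℂ) ^ k) 2 (gaussianReal 0 v) := by
  have hm : AEStronglyMeasurable (fun x : ℝ => (x : ℂ) ^ k) (gaussianReal 0 v) := by fun_prop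
  rw [memLp_two_iff_integrable_sq_norm hm]
  have h := (memLp_id_gaussianReal (μ := 0) (v := v) ((k * 2 : ℕ) : NNReal)).integrable_norm_pow'
  simpa [← pow_mul] using h

theorem continuous_evalR {d : ℕ} (p : MvPolynomial (Fin d) ℂ) : Continuous (evalR p) := by
  unfold evalR
  exact (MvPolynomial.continuous_eval p).comp (by fun_prop)

theorem memLp_evalR {d : ℕ} (s : ℝ) (p : MvPolynomial (Fin d) ℂ) :
    MemLp (evalR p) 2 (gaussPi d s) := by
  induction p using MvPolynomial.induction_on' with
  | monomial m a =>
    have h := (memLp_two_prod (μ := fun _ : Fin d => gaussianReal 0 s.toNNReal)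
      (f := fun j x => (x : ℂ) ^ m j) fun j => memLp_pow_gaussianReal _ _).const_mul a
    refine h.ae_eq (.of_forall fun x => ?_)
    simp [evalR, eval_monomial, Finsupp.prod_fintype]
  | add p q hp hq =>
    refine (hp.add hq).ae_eq (.of_forall fun x => ?_)
    simp [evalR]

/-- One factor of `gaussDensity`. -/
def gaussFactor (t : ℝ) (w : ℂ) : ℂ :=
  (((2 * Real.pi * t) ^ (-(1 : ℝ) / 2) : ℝ) : ℂ) * Complex.exp (-w ^ 2 / (2 * (t : ℂ)))

theorem gaussDensity_eq_prod {d : ℕ} {t : ℝ} (ht : 0 < t) (w : Fin d → ℂ) :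
    gaussDensity t w = ∏ j, gaussFactor t (w j) := by
  have hpos : 0 < 2 * Real.pi * t := by positivity
  simp only [gaussDensity, gaussFactor, Finset.prod_mul_distrib, Finset.prod_const,
    Finset.card_univ, Fintype.card_fin]
  congr 1
  · rw [← Complex.ofReal_pow, ← Real.rpow_natCast, ← Real.rpow_mul hpos.le]
    congr 2
    ring
  · rw [← Complex.exp_sum]
    congr 1
    rw [← Finset.sum_neg_distrib, Finset.sum_div]

theorem gaussFactor_eq_pdf {s : ℝ} (hs : 0 < s) (x : ℝ) :
    gaussFactor s (0 - (x : ℂ)) = (gaussianPDFReal 0 s.toNNReal x : ℂ) := by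
  have hpos : 0 < 2 * Real.pi * s := by positivity
  rw [gaussFactor, gaussianPDFReal, Real.coe_toNNReal s hs.le, Complex.ofReal_mul]
  congr 1
  · rw [Real.sqrt_eq_rpow, ← Real.rpow_neg hpos.le]
    congr 2
    ring
  · rw [Complex.ofReal_exp]
    congr 1
    push_cast
    ring

theorem gaussDensity_zero_sub {d : ℕ} {s : ℝ} (hs : 0 < s) (x : Fin d → ℝ) :
    gaussDensity s (fun j => (0 : Fin d → ℂ) j - (x j : ℂ)) = (gaussPiDensity s x : ℂ) := by
  rw [gaussDensity_eq_prod hs, gaussPiDensity, Complex.ofReal_prod]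
  exact Finset.prod_congr rfl fun j _ => gaussFactor_eq_pdf hs (x j)

theorem finTransform_zero {d : ℕ} {s : ℝ} (hs : 0 < s) (φ : (Fin d → ℝ) → ℂ) :
    finTransform s φ 0 = ∫ x, φ x ∂gaussPi d s := by
  rw [integral_gaussPi hs, finTransform]
  simp only [gaussDensity_zero_sub hs]

/-- One factor of `memLp_segalKernel`. -/
theorem memLp_gaussFactor_div {s t : ℝ} (ht : 0 < t) (hst : t / 2 < s) (z : ℂ) :
    MemLp (fun x : ℝ => gaussFactor t (z - x) / (gaussianPDFReal 0 s.toNNReal x : ℂ)) 2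
      (gaussianReal 0 s.toNNReal) := by
  have hs : 0 < s := by linarith
  have hs' : s.toNNReal ≠ 0 := (Real.toNNReal_pos.2 hs).ne'
  have hm : AEStronglyMeasurable (fun x : ℝ => gaussFactor t (z - x)
      / (gaussianPDFReal 0 s.toNNReal x : ℂ)) (gaussianReal 0 s.toNNReal) := by
    refine Measurable.aestronglyMeasurable (Measurable.div ?_ ?_)
    · unfold gaussFactor; fun_prop
    · exact (measurable_gaussianPDFReal _ _).complex_ofReal
  rw [memLp_two_iff_integrable_sq_norm hm, gaussianReal_of_var_ne_zero _ hs',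
    integrable_withDensity_iff_integrable_smul' (measurable_gaussianPDF _ _) (by simp [gaussianPDF])]
  -- the exponents combine to a quadratic with leading coefficient `-(1/t - 1/(2s)) < 0`
  have hb : 0 < ((1 / t - 1 / (2 * s) : ℝ) : ℂ).re := by
    rw [Complex.ofReal_re, sub_pos]
    exact one_div_lt_one_div_of_lt ht (by linarith)
  have hq := (integrable_cexp_quadratic hb ((2 * z.re / t : ℝ) : ℂ)
    (((z.im ^ 2 - z.re ^ 2) / t : ℝ) : ℂ)).norm.const_mul
      (((2 * Real.pi * t) ^ (-(1 : ℝ) / 2)) ^ 2 * Real.sqrt (2 * Real.pi * s))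
  refine hq.congr (.of_forall fun x => ?_)
  have hsq : 0 < Real.sqrt (2 * Real.pi * s) := by positivity
  have hpdf : gaussianPDFReal 0 s.toNNReal x
      = (Real.sqrt (2 * Real.pi * s))⁻¹ * Real.exp (-x ^ 2 / (2 * s)) := by
    rw [gaussianPDFReal, Real.coe_toNNReal s hs.le, sub_zero]
  have hpos : 0 < gaussianPDFReal 0 s.toNNReal x := gaussianPDFReal_pos _ _ _ hs'
  have hn : ‖gaussFactor t (z - x)‖
      = (2 * Real.pi * t) ^ (-(1 : ℝ) / 2) * Real.exp (-((z.re - x) ^ 2 - z.im ^ 2) / (2 * t)) := by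
    rw [gaussFactor, norm_mul, Complex.norm_real, Real.norm_of_nonneg (by positivity),
      Complex.norm_exp]
    congr 2
    have : -(z - (x : ℂ)) ^ 2 / (2 * (t : ℂ)) = ((1 / (2 * t) : ℝ) : ℂ) * (-(z - (x : ℂ)) ^ 2) := by
      push_cast; ring
    rw [this, Complex.re_ofReal_mul]
    simp only [pow_two, Complex.neg_re, Complex.mul_re, Complex.sub_re, Complex.sub_im,
      Complex.ofReal_re, Complex.ofReal_im]
    ring
  have he : ‖Complex.exp (-((1 / t - 1 / (2 * s) : ℝ) : ℂ) * (x : ℂ) ^ 2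
      + ((2 * z.re / t : ℝ) : ℂ) * x + (((z.im ^ 2 - z.re ^ 2) / t : ℝ) : ℂ))‖
      = Real.exp (-((z.re - x) ^ 2 - z.im ^ 2) / (2 * t)) ^ 2 / Real.exp (-x ^ 2 / (2 * s)) := by
    rw [← Real.exp_nat_mul, ← Real.exp_sub, Complex.norm_exp]
    congr 1
    rw [← Complex.ofReal_neg, ← Complex.ofReal_pow, ← Complex.ofReal_mul, ← Complex.ofReal_mul,
      ← Complex.ofReal_add, ← Complex.ofReal_add, Complex.ofReal_re]
    push_cast
    field_simp
    ring
  dsimp only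
  rw [toReal_gaussianPDF, smul_eq_mul, norm_div, Complex.norm_real, Real.norm_of_nonneg hpos.le,
    hn, hpdf, he]
  have h3 := Real.exp_pos (-x ^ 2 / (2 * s))
  field_simp

/-- The density of `P_t(z - x) dx` with respect to the Gaussian measure of variance `s`. -/
def segalKernel {d : ℕ} (s t : ℝ) (z : Fin d → ℂ) (x : Fin d → ℝ) : ℂ :=
  gaussDensity t (fun j => z j - (x j : ℂ)) / (gaussPiDensity s x : ℂ)

/-- Point evaluations of the transform are bounded on `L²` of the Gaussian measure of variance
`s` exactly because `s > t/2`. -/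
theorem memLp_segalKernel {d : ℕ} {s t : ℝ} (ht : 0 < t) (hst : t / 2 < s) (z : Fin d → ℂ) :
    MemLp (segalKernel s t z) 2 (gaussPi d s) := by
  refine (memLp_two_prod (μ := fun _ : Fin d => gaussianReal 0 s.toNNReal)
    fun j => memLp_gaussFactor_div ht hst (z j)).ae_eq (.of_forall fun x => ?_)
  simp only [segalKernel, gaussDensity_eq_prod ht, gaussPiDensity, Finset.prod_div_distrib,
    Complex.ofReal_prod]

theorem gaussPiDensity_mul_segalKernel {d : ℕ} {s : ℝ} (hs : 0 < s) (t : ℝ) (z : Fin d → ℂ)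
    (x : Fin d → ℝ) : (gaussPiDensity s x : ℂ) * segalKernel s t z x
      = gaussDensity t (fun j => z j - (x j : ℂ)) := by
  have : (gaussPiDensity s x : ℂ) ≠ 0 := by exact_mod_cast (gaussPiDensity_pos hs x).ne'
  rw [segalKernel, mul_div_cancel₀ _ this]

theorem finTransform_eq_integral {d : ℕ} {s : ℝ} (hs : 0 < s) (t : ℝ) (φ : (Fin d → ℝ) → ℂ)
    (z : Fin d → ℂ) :
    finTransform t φ z = ∫ x, segalKernel s t z x * φ x ∂gaussPi d s := by
  rw [integral_gaussPi hs, finTransform]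
  simp only [← mul_assoc, gaussPiDensity_mul_segalKernel hs]

theorem integrable_gaussDensity_mul {d : ℕ} {s t : ℝ} (ht : 0 < t) (hst : t / 2 < s)
    {φ : (Fin d → ℝ) → ℂ} (hφ : MemLp φ 2 (gaussPi d s)) (z : Fin d → ℂ) :
    Integrable fun x : Fin d → ℝ => gaussDensity t (fun j => z j - (x j : ℂ)) * φ x := by
  have hs : 0 < s := by linarith
  have h := (memLp_segalKernel ht hst z).integrable_mul hφ
  rw [integrable_gaussPi_iff hs] at h
  refine h.congr (.of_forall fun x => ?_)
  dsimp only [Pi.mul_apply]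
  rw [← mul_assoc, gaussPiDensity_mul_segalKernel hs]

theorem integrable_gaussDensity_mul_evalR {d : ℕ} {t : ℝ} (ht : 0 < t)
    (p : MvPolynomial (Fin d) ℂ) (z : Fin d → ℂ) :
    Integrable fun x : Fin d → ℝ => gaussDensity t (fun j => z j - (x j : ℂ)) * evalR p x :=
  integrable_gaussDensity_mul ht (s := t) (by linarith) (memLp_evalR t p) z

theorem integral_gaussFactor_mul_exp {t : ℝ} (ht : 0 < t) (a : ℝ) (z : ℂ) :
    ∫ x : ℝ, gaussFactor t (z - x) * Complex.exp (Complex.I * (a * x))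
      = Complex.exp (-(t / 2) * a ^ 2 + Complex.I * (a * z)) := by
  have ht' : (t : ℂ) ≠ 0 := by exact_mod_cast ht.ne'
  have hb : (-(1 / (2 * t) : ℝ) : ℂ).re < 0 := by
    rw [← Complex.ofReal_neg, Complex.ofReal_re]
    have : 0 < 1 / (2 * t) := by positivity
    linarith
  have h := integral_cexp_quadratic hb (z / t + Complex.I * a) (-z ^ 2 / (2 * t))
  have hfun : ∀ x : ℝ, gaussFactor t (z - x) * Complex.exp (Complex.I * (a * x))
      = (((2 * Real.pi * t) ^ (-(1 : ℝ) / 2) : ℝ) : ℂ)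
        * Complex.exp (-((1 / (2 * t) : ℝ) : ℂ) * x ^ 2 + (z / t + Complex.I * a) * x
          + -z ^ 2 / (2 * t)) := by
    intro x
    rw [gaussFactor, mul_assoc, ← Complex.exp_add]
    congr 2
    push_cast
    field_simp
    ring
  simp_rw [hfun]
  rw [integral_const_mul, h, ← mul_assoc]
  have hc : (((2 * Real.pi * t) ^ (-(1 : ℝ) / 2) : ℝ) : ℂ)
      * ((Real.pi : ℂ) / - -((1 / (2 * t) : ℝ) : ℂ)) ^ (1 / 2 : ℂ) = 1 := by
    have hpos : 0 < 2 * Real.pi * t := by positivity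
    have h1 : (Real.pi : ℂ) / - -((1 / (2 * t) : ℝ) : ℂ) = ((2 * Real.pi * t : ℝ) : ℂ) := by
      rw [neg_neg]
      push_cast
      field_simp
    have h2 : (1 / 2 : ℂ) = ((1 / 2 : ℝ) : ℂ) := by push_cast; rfl
    rw [h1, h2, ← Complex.ofReal_cpow hpos.le, ← Complex.ofReal_mul, ← Real.rpow_add hpos]
    norm_num
  rw [hc, one_mul]
  congr 1
  push_cast
  field_simp
  linear_combination (4 * t ^ 2 * a ^ 2 : ℂ) * Complex.I_sq

theorem finTransform_exp {d : ℕ} {t : ℝ} (ht : 0 < t) (a : Fin d → ℝ) (z : Fin d → ℂ) :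
    finTransform t (fun x => Complex.exp (Complex.I * ∑ j, (a j : ℂ) * (x j : ℂ))) z
      = Complex.exp (-(t / 2) * ∑ j, (a j : ℂ) ^ 2 + Complex.I * ∑ j, (a j : ℂ) * z j) := by
  have h : ∀ x : Fin d → ℝ, gaussDensity t (fun j => z j - (x j : ℂ))
      * Complex.exp (Complex.I * ∑ j, (a j : ℂ) * (x j : ℂ))
      = ∏ j, (gaussFactor t (z j - x j) * Complex.exp (Complex.I * (a j * x j))) := by
    intro x
    rw [gaussDensity_eq_prod ht, Finset.prod_mul_distrib, ← Complex.exp_sum, Finset.mul_sum]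
  rw [finTransform]
  simp_rw [h]
  rw [integral_fintype_prod_volume_eq_prod
    (fun j (y : ℝ) => gaussFactor t (z j - y) * Complex.exp (Complex.I * (a j * y)))]
  simp_rw [integral_gaussFactor_mul_exp ht]
  rw [← Complex.exp_sum, Finset.sum_add_distrib, Finset.mul_sum, Finset.mul_sum]

theorem hasLineDerivAt_gaussDensity {d : ℕ} {t : ℝ} (ht : 0 < t) (z : Fin d → ℂ)
    (x : Fin d → ℝ) (j : Fin d) :
    HasLineDerivAt ℝ (fun x : Fin d → ℝ => gaussDensity t (fun j => z j - (x j : ℂ)))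
      ((z j - x j) / t * gaussDensity t (fun j => z j - (x j : ℂ))) x (Pi.single j 1) := by
  have ht' : (t : ℂ) ≠ 0 := by exact_mod_cast ht.ne'
  have h1 : ∀ k, HasDerivAt
      (fun τ : ℝ => (z k - (((x + τ • (Pi.single j 1 : Fin d → ℝ)) k : ℝ) : ℂ)) ^ 2)
      (-(2 * (z k - x k) * ((Pi.single j 1 : Fin d → ℝ) k : ℂ))) 0 := by
    intro k
    have h0 : HasDerivAt (fun τ : ℝ => ((x + τ • (Pi.single j 1 : Fin d → ℝ)) k : ℝ))
        ((Pi.single j 1 : Fin d → ℝ) k) 0 := by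
      simpa using ((hasDerivAt_id (0 : ℝ)).mul_const ((Pi.single j 1 : Fin d → ℝ) k)).const_add
        (x k)
    have h2 := (h0.ofReal_comp.const_sub (z k)).pow 2
    refine h2.congr_deriv ?_
    simp
  have h2 := HasDerivAt.fun_sum (u := Finset.univ) fun k _ => h1 k
  have h3 := ((h2.neg.div_const (2 * (t : ℂ))).cexp).const_mul
    ((((2 * Real.pi * t) ^ (-(d : ℝ) / 2) : ℝ) : ℂ))
  refine HasDerivAt.congr_deriv h3 ?_
  have hsum : ∑ k, -(2 * (z k - x k) * ((Pi.single j 1 : Fin d → ℝ) k : ℂ)) = -(2 * (z j - x j)) := by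
    rw [Finset.sum_eq_single j]
    · simp
    · intro b _ hb
      simp [hb]
    · simp
  rw [hsum, gaussDensity]
  simp only [Pi.neg_apply, zero_smul, add_zero]
  field_simp

theorem hasLineDerivAt_evalR {d : ℕ} (p : MvPolynomial (Fin d) ℂ) (x : Fin d → ℝ) (j : Fin d) :
    HasLineDerivAt ℝ (evalR p) (evalR (pderiv j p) x) x (Pi.single j 1) := by
  classical
  unfold HasLineDerivAt
  induction p using MvPolynomial.induction_on with
  | C a =>
    simp only [evalR, eval_C, pderiv_C, map_zero]
    exact hasDerivAt_const _ _
  | add p q hp hq =>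
    simp only [evalR, map_add] at hp hq ⊢
    exact hp.add hq
  | mul_X p k hp =>
    have h0 : HasDerivAt (fun τ : ℝ => ((x + τ • (Pi.single j 1 : Fin d → ℝ)) k : ℝ))
        ((Pi.single j 1 : Fin d → ℝ) k) 0 := by
      simpa using ((hasDerivAt_id (0 : ℝ)).mul_const ((Pi.single j 1 : Fin d → ℝ) k)).const_add
        (x k)
    have h1 := hp.mul h0.ofReal_comp
    simp only [evalR, map_mul, eval_X, pderiv_mul, map_add, pderiv_X] at h1 ⊢
    refine h1.congr_deriv ?_
    rcases eq_or_ne k j with rfl | h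
    · simp
    · simp [h]

/-- Gaussian integration by parts. -/
theorem finTransform_X_mul {d : ℕ} {t : ℝ} (ht : 0 < t) (z : Fin d → ℂ) (j : Fin d)
    (p : MvPolynomial (Fin d) ℂ) :
    finTransform t (evalR (X j * p)) z
      = z j * finTransform t (evalR p) z + t * finTransform t (evalR (pderiv j p)) z := by
  have ht' : (t : ℂ) ≠ 0 := by exact_mod_cast ht.ne'
  have hX : ∀ x, evalR (X j * p) x = x j * evalR p x := fun x => by simp [evalR]
  have hi1 := integrable_gaussDensity_mul_evalR ht p z
  have hi2 := integrable_gaussDensity_mul_evalR ht (X j * p) z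
  have hfun : ∀ x : Fin d → ℝ, (z j - x j) / t * gaussDensity t (fun j => z j - (x j : ℂ)) * evalR p x
      = (z j / t) * (gaussDensity t (fun j => z j - (x j : ℂ)) * evalR p x)
        - (1 / t) * (gaussDensity t (fun j => z j - (x j : ℂ)) * evalR (X j * p) x) := by
    intro x
    rw [hX]
    ring
  have h := integral_bilinear_hasLineDerivAt_right_eq_neg_left_of_integrable
    (μ := (volume : Measure (Fin d → ℝ))) (B := ContinuousLinearMap.mul ℝ ℂ)
    (f := fun x : Fin d → ℝ => gaussDensity t (fun j => z j - (x j : ℂ)))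
    (f' := fun x => (z j - x j) / t * gaussDensity t (fun j => z j - (x j : ℂ)))
    (g := evalR p) (g' := evalR (pderiv j p)) (v := Pi.single j 1) ?_ ?_ ?_
    (fun x _ => hasLineDerivAt_gaussDensity ht z x j) (fun x _ => hasLineDerivAt_evalR p x j)
  · simp only [ContinuousLinearMap.mul_apply', hfun] at h
    rw [integral_sub (hi1.const_mul _) (hi2.const_mul _), integral_const_mul,
      integral_const_mul] at h
    simp only [finTransform]
    rw [h]
    field_simp
    ring
  · simp only [ContinuousLinearMap.mul_apply', hfun]
    exact (hi1.const_mul _).sub (hi2.const_mul _)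
  · exact integrable_gaussDensity_mul_evalR ht _ z
  · exact hi1

/-- The transform of polynomials, evaluated at `z`, as a linear functional. -/
def polyTransform {d : ℕ} {t : ℝ} (ht : 0 < t) (z : Fin d → ℂ) : MvPolynomial (Fin d) ℂ →ₗ[ℂ] ℂ where
  toFun p := finTransform t (evalR p) z
  map_add' p q := by
    simp only [finTransform]
    rw [← integral_add (integrable_gaussDensity_mul_evalR ht p z)
      (integrable_gaussDensity_mul_evalR ht q z)]
    simp [evalR, mul_add]
  map_smul' a p := by
    simp only [finTransform, RingHom.id_apply, smul_eq_mul]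
    rw [← integral_const_mul]
    simp [evalR, smul_eval, mul_left_comm]

theorem finTransform_one {d : ℕ} {t : ℝ} (ht : 0 < t) (z : Fin d → ℂ) :
    finTransform t (evalR 1) z = 1 := by
  have := finTransform_exp ht (0 : Fin d → ℝ) z
  simp only [Pi.zero_apply, Complex.ofReal_zero, zero_mul, Finset.sum_const_zero, mul_zero,
    Complex.exp_zero] at this
  have h1 : (evalR 1 : (Fin d → ℝ) → ℂ) = fun _ => 1 := by
    funext x; simp [evalR]
  rw [h1, this]
  simp

/-- The transform turns `e^{-sΔ/2} p` into `e^{-(s-t)Δ/2} p`, analytically continued. -/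
theorem finTransform_expNegHalf {d : ℕ} {t : ℝ} (ht : 0 < t) (s : ℝ)
    (p : MvPolynomial (Fin d) ℂ) (z : Fin d → ℂ) :
    finTransform t (evalR (expNegHalf (realCoeff d s) p)) z
      = eval z (expNegHalf (realCoeff d (s - t)) p) := by
  have h : (polyTransform ht z).comp (expNegHalfₗ (realCoeff d s))
      = (aeval z).toLinearMap.comp (expNegHalfₗ (realCoeff d (s - t))) := by
    refine linearMap_eq_of_recursion
      (fun j => LinearMap.mulLeft ℂ (z j)) (-(s - t : ℂ)) ?_ ?_ ?_
    · simp only [LinearMap.comp_apply, expNegHalfₗ_apply, expNegHalf_one]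
      exact (finTransform_one ht z).trans (map_one (aeval z)).symm
    · intro j p
      simp only [LinearMap.comp_apply, expNegHalfₗ_apply, LinearMap.mulLeft_apply]
      rw [expNegHalf_X_mul, map_sub, map_smul]
      have := finTransform_X_mul ht z j (expNegHalf (realCoeff d s) p)
      rw [pderiv_expNegHalf] at this
      have h2 : polyTransform ht z (X j * expNegHalf (realCoeff d s) p)
        = z j * polyTransform ht z (expNegHalf (realCoeff d s) p)
          + t * polyTransform ht z (expNegHalf (realCoeff d s) (pderiv j p)) := this
      rw [h2]
      simp only [realCoeff, smul_eq_mul]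
      ring
    · intro j p
      simp only [LinearMap.comp_apply, expNegHalfₗ_apply, LinearMap.mulLeft_apply,
        AlgHom.toLinearMap_apply]
      rw [expNegHalf_X_mul, map_sub, map_smul, map_mul, aeval_X]
      simp only [realCoeff, smul_eq_mul]
      push_cast
      ring
  have := LinearMap.congr_fun h p
  simpa [polyTransform, coe_aeval_eq_eval] using this

/-- On `hermiteFin` the transform is `e^{-A_{s,t}/2} p_ℂ`. -/
theorem finTransform_expNegHalf_eq_evalXY {d : ℕ} {t : ℝ} (ht : 0 < t) (s : ℝ)
    (p : MvPolynomial (Fin d) ℂ) (z : Fin d → ℂ) :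
    finTransform t (evalR (expNegHalf (realCoeff d s) p)) z
      = evalXY (expNegHalf (complexCoeff d s t) (complexify p)) z := by
  rw [finTransform_expNegHalf ht, expNegHalf_complexify, evalXY_complexify]

end FiniteDimensional

/-! ### Orthogonality of Hermite polynomials -/

section HermiteInner

open MvPolynomial

variable {d : ℕ}

theorem integrable_evalR (s : ℝ) (p : MvPolynomial (Fin d) ℂ) :
    Integrable (evalR p) (gaussPi d s) :=
  (memLp_evalR s p).integrable (by norm_num)

theorem integral_X_mul {s : ℝ} (hs : 0 < s) (j : Fin d) (p : MvPolynomial (Fin d) ℂ) :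
    ∫ x, evalR (X j * p) x ∂gaussPi d s = s * ∫ x, evalR (pderiv j p) x ∂gaussPi d s := by
  have := finTransform_X_mul hs 0 j p
  rwa [finTransform_zero hs, finTransform_zero hs, finTransform_zero hs, Pi.zero_apply, zero_mul,
    zero_add] at this

/-- In `L²`, multiplication by `X j` before `e^{-sΔ/2}` is `s` times the adjoint of `∂ⱼ`. -/
theorem integral_hermite_X_mul {s : ℝ} (hs : 0 < s) (j : Fin d) (p q : MvPolynomial (Fin d) ℂ) :
    ∫ x, evalR (expNegHalf (realCoeff d s) (X j * p)) x
        * evalR (expNegHalf (realCoeff d s) q) x ∂gaussPi d s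
      = s * ∫ x, evalR (expNegHalf (realCoeff d s) p) x
        * evalR (expNegHalf (realCoeff d s) (pderiv j q)) x ∂gaussPi d s := by
  set P := expNegHalf (realCoeff d s) p with hP
  set Q := expNegHalf (realCoeff d s) q with hQ
  have h1 : ∀ x, evalR (expNegHalf (realCoeff d s) (X j * p)) x * evalR Q x
      = evalR (X j * (P * Q)) x - s * evalR (pderiv j P * Q) x := by
    intro x
    rw [expNegHalf_X_mul, ← pderiv_expNegHalf, ← hP]
    simp only [evalR, map_sub, map_mul, smul_eval, realCoeff]
    ring
  have h2 : ∀ x, evalR P x * evalR (expNegHalf (realCoeff d s) (pderiv j q)) x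
      = evalR (pderiv j (P * Q)) x - evalR (pderiv j P * Q) x := by
    intro x
    rw [← pderiv_expNegHalf, ← hQ, pderiv_mul]
    simp only [evalR, map_mul, map_add]
    ring
  simp_rw [h1, h2]
  rw [integral_sub (integrable_evalR s _) ((integrable_evalR s _).const_mul _),
    integral_sub (integrable_evalR s _) (integrable_evalR s _), integral_X_mul hs,
    integral_const_mul, mul_sub]

/-- The Hermite polynomials of monomials pair with that of a symmetric tensor to `sⁿ`
times its coefficients: each variable is moved across as a derivative, which contracts the tensor. -/
theorem integral_hermite_prod_stratPoly {s : ℝ} (hs : 0 < s) {n : ℕ} (α : Fin n → Fin d)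
    {c : (Fin n → Fin d) → ℂ} (hc : ∀ (π : Equiv.Perm (Fin n)) α, c (α ∘ π) = c α) :
    ∫ x, evalR (expNegHalf (realCoeff d s) (∏ i, X (α i))) x
        * evalR (expNegHalf (realCoeff d s) (stratPoly c)) x ∂gaussPi d s = s ^ n * c α := by
  induction n with
  | zero =>
    have h1 : stratPoly c = c α • 1 := by
      simp [stratPoly, Subsingleton.elim α default]
    rw [h1, expNegHalf_smul]
    simp [expNegHalf_one, evalR, smul_eval]
  | succ n ih =>
    rw [Fin.prod_univ_succ, integral_hermite_X_mul hs, pderiv_stratPoly hc,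
      ih _ (fun π β => symmetric_cons hc (α 0) π β), ← mul_assoc, ← pow_succ']
    congr 2
    exact Fin.cons_self_tail α

theorem polyLap_map_conj (g : Fin d → ℝ) (p : MvPolynomial (Fin d) ℂ) :
    polyLap g (map (starRingEnd ℂ) p) = map (starRingEnd ℂ) (polyLap g p) := by
  simp only [polyLap_apply, map_sum, smul_eq_C_mul, map_mul, map_C, Complex.conj_ofReal,
    pderiv_map]

theorem expNegHalf_map_conj (g : Fin d → ℝ) (p : MvPolynomial (Fin d) ℂ) :
    expNegHalf g (map (starRingEnd ℂ) p) = map (starRingEnd ℂ) (expNegHalf g p) := by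
  have hpow : ∀ k : ℕ, (polyLap g ^ k) (map (starRingEnd ℂ) p)
      = map (starRingEnd ℂ) ((polyLap g ^ k) p) := by
    intro k
    induction k with
    | zero => simp
    | succ k ih =>
      rw [pow_succ', Module.End.mul_apply, ih, polyLap_map_conj, Module.End.mul_apply]
  have h1 := le_max_left p.totalDegree (map (starRingEnd ℂ) p).totalDegree
  have h2 := le_max_right p.totalDegree (map (starRingEnd ℂ) p).totalDegree
  rw [expNegHalf_eq_sum g (p := p) (Nat.lt_succ_of_le h1),
    expNegHalf_eq_sum g (p := map (starRingEnd ℂ) p) (Nat.lt_succ_of_le h2), map_sum]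
  refine Finset.sum_congr rfl fun k _ => ?_
  rw [hpow, smul_eq_C_mul, smul_eq_C_mul, map_mul, map_C]
  congr 2
  simp only [map_div₀, map_pow, map_neg, map_one, map_ofNat, map_natCast]

theorem conj_evalR (p : MvPolynomial (Fin d) ℂ) (x : Fin d → ℝ) :
    (starRingEnd ℂ) (evalR p x) = evalR (map (starRingEnd ℂ) p) x := by
  induction p using MvPolynomial.induction_on with
  | C a => simp [evalR]
  | add p q hp hq => simp only [evalR, map_add] at *; rw [hp, hq]
  | mul_X p k hp => simp only [evalR, map_mul, map_X, eval_X, Complex.conj_ofReal] at *; rw [hp]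

/-- The `L²` norm of the Hermite polynomial of a symmetric tensor. -/
theorem integral_norm_sq_hermite {s : ℝ} (hs : 0 < s) {n : ℕ}
    {c : (Fin n → Fin d) → ℂ} (hc : ∀ (π : Equiv.Perm (Fin n)) α, c (α ∘ π) = c α) :
    ∫ x, ‖evalR (expNegHalf (realCoeff d s) (stratPoly c)) x‖ ^ 2 ∂gaussPi d s
      = s ^ n / n.factorial * ∑ α, ‖c α‖ ^ 2 := by
  -- one factor is expanded into monomials, the other is paired with each of them
  have hmap : map (starRingEnd ℂ) (stratPoly c)
      = ∑ α, (1 / (n.factorial : ℂ) * (starRingEnd ℂ) (c α)) • ∏ i, X (α i) := by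
    simp only [stratPoly, smul_eq_C_mul, map_mul, map_C, map_sum, map_prod, map_X, Finset.mul_sum,
      mul_assoc]
    simp
  have hpt : ∀ x, ((‖evalR (expNegHalf (realCoeff d s) (stratPoly c)) x‖ ^ 2 : ℝ) : ℂ)
      = ∑ α, (1 / (n.factorial : ℂ) * (starRingEnd ℂ) (c α))
        * (evalR (expNegHalf (realCoeff d s) (∏ i, X (α i))) x
          * evalR (expNegHalf (realCoeff d s) (stratPoly c)) x) := by
    intro x
    rw [Complex.ofReal_pow, ← Complex.conj_mul', conj_evalR, ← expNegHalf_map_conj, hmap,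
      ← expNegHalfₗ_apply _ (∑ α, _), map_sum]
    simp only [map_smul, expNegHalfₗ_apply]
    rw [evalR, map_sum, Finset.sum_mul]
    refine Finset.sum_congr rfl fun α _ => ?_
    rw [smul_eval, mul_assoc]
    rfl
  have hint : ∀ α : Fin n → Fin d, Integrable (fun x =>
      (1 / (n.factorial : ℂ) * (starRingEnd ℂ) (c α))
        * (evalR (expNegHalf (realCoeff d s) (∏ i, X (α i))) x
          * evalR (expNegHalf (realCoeff d s) (stratPoly c)) x)) (gaussPi d s) := fun α =>
    ((memLp_evalR s _).integrable_mul (memLp_evalR s _)).const_mul _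
  rw [← Complex.ofReal_inj, ← integral_complex_ofReal]
  simp_rw [hpt]
  rw [integral_finsetSum _ fun α _ => hint α]
  simp_rw [integral_const_mul, integral_hermite_prod_stratPoly hs _ hc]
  push_cast
  rw [Finset.mul_sum]
  refine Finset.sum_congr rfl fun α _ => ?_
  rw [← Complex.conj_mul']
  ring

end HermiteInner

/-! ### Linear functionals of white noise -/

section WhiteNoise

open ProbabilityTheory

variable {V : Type*} [NormedAddCommGroup V] [InnerProductSpace ℝ V]

theorem measurable_functional_pair (φ ψ : StrongDual ℝ (GenConn V)) :
    Measurable (fun C : GenConnC V => (φ C.1, ψ C.2)) :=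
  (φ.continuous.measurable.comp measurable_fst).prodMk (ψ.continuous.measurable.comp measurable_snd)

variable [FiniteDimensional ℝ V]

instance : CompleteSpace (GenConn V) := by
  have : CompleteSpace V := FiniteDimensional.complete ℝ V
  have hc : IsClosed ((pathSpace V : Submodule ℝ C(unitInterval, V)) : Set C(unitInterval, V)) :=
    isClosed_singleton.preimage (f := fun a : C(unitInterval, V) => a 0)
      (ContinuousEvalConst.continuous_eval_const 0)
  exact hc.completeSpace_coe

instance : SecondCountableTopology (GenConn V) := by
  have : ProperSpace V := FiniteDimensional.proper ℝ V
  exact inferInstanceAs (SecondCountableTopology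
    ((pathSpace V : Submodule ℝ C(unitInterval, V)) : Set C(unitInterval, V)))

instance : CompleteSpace (Conn V) := by
  have : CompleteSpace V := FiniteDimensional.complete ℝ V
  infer_instance

/-- The vector of `𝒜` representing the restriction to `𝒜` of a functional on `Ā`. -/
def rieszVec : StrongDual ℝ (GenConn V) →ₗ[ℝ] Conn V where
  toFun φ := (InnerProductSpace.toDual ℝ (Conn V)).symm (φ.comp incl)
  map_add' φ ψ := by rw [ContinuousLinearMap.add_comp, map_add]
  map_smul' a φ := by rw [ContinuousLinearMap.smul_comp, map_smulₛₗ]; rfl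

theorem inner_rieszVec (φ : StrongDual ℝ (GenConn V)) (f : Conn V) :
    inner ℝ (rieszVec φ) f = φ (incl f) :=
  InnerProductSpace.toDual_symm_apply

theorem rieszVec_neg (φ : StrongDual ℝ (GenConn V)) : rieszVec (-φ) = -rieszVec φ := by
  refine ext_inner_right ℝ fun f => ?_
  rw [inner_neg_left, inner_rieszVec, inner_rieszVec, neg_apply]

theorem rieszVec_sub (φ ψ : StrongDual ℝ (GenConn V)) :
    rieszVec (φ - ψ) = rieszVec φ - rieszVec ψ := by
  refine ext_inner_right ℝ fun f => ?_
  rw [inner_sub_left, inner_rieszVec, inner_rieszVec, inner_rieszVec, sub_apply]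

theorem connNorm_eq (φ : StrongDual ℝ (GenConn V)) : connNorm φ = ‖rieszVec φ‖ :=
  ((InnerProductSpace.toDual ℝ (Conn V)).symm.norm_map _).symm

theorem Frame.rieszVec_ext {d : ℕ} (F : Frame V d) (j : Fin d) : rieszVec (F.ext j) = F.e j := by
  refine ext_inner_right ℝ fun f => ?_
  rw [inner_rieszVec, F.ext_incl]

theorem norm_sq_rieszVec_sum {d : ℕ} (F : Frame V d) (a : Fin d → ℝ) :
    ‖rieszVec (∑ j, a j • F.ext j)‖ ^ 2 = ∑ j, a j ^ 2 := by
  rw [map_sum, ← real_inner_self_eq_norm_sq]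
  simp only [map_smul, F.rieszVec_ext]
  rw [F.orthonormal.inner_sum]
  simp [pow_two]

/-- The Gaussian law of a functional of white noise. -/
theorem IsWhiteNoise.map_functional {s : ℝ} (hs : 0 ≤ s) {P : Measure (GenConn V)}
    (hP : IsWhiteNoise s P) (φ : StrongDual ℝ (GenConn V)) :
    P.map φ = gaussianReal 0 (s * ‖rieszVec φ‖ ^ 2).toNNReal := by
  have := hP.isProbabilityMeasure
  have : IsProbabilityMeasure (P.map φ) := Measure.isProbabilityMeasure_map (by fun_prop)
  refine Measure.ext_of_charFun (funext fun u => ?_)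
  rw [charFun_gaussianReal, charFun_apply_real, integral_map (by fun_prop) (by fun_prop)]
  have h := hP.fourier (u • φ)
  rw [connNorm_eq, map_smul, norm_smul] at h
  have hfun : ∀ A, Complex.exp (u * (φ A : ℂ) * Complex.I)
      = Complex.exp (Complex.I * (((u • φ) A : ℝ) : ℂ)) := by
    intro A
    rw [mul_comm]
    simp
  simp_rw [hfun]
  rw [h, Real.coe_toNNReal _ (by positivity), mul_pow, Real.norm_eq_abs, sq_abs]
  congr 1
  push_cast
  ring

/-- A functional on `Ā` that vanishes on `𝒜` is almost surely zero. -/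
theorem IsWhiteNoise.ae_eq_zero {s : ℝ} (hs : 0 ≤ s) {P : Measure (GenConn V)}
    (hP : IsWhiteNoise s P) {φ : StrongDual ℝ (GenConn V)} (hφ : rieszVec φ = 0) :
    ∀ᵐ A ∂P, φ A = 0 := by
  have h := hP.map_functional hs φ
  rw [hφ, norm_zero, zero_pow two_ne_zero, mul_zero, Real.toNNReal_zero, gaussianReal_zero_var] at h
  have h1 : ∀ᵐ x ∂(P.map φ), x = 0 := by
    rw [h, ae_dirac_eq]
    exact Filter.eventually_pure.2 rfl
  exact ae_of_ae_map (by fun_prop) h1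

theorem continuous_coord {d : ℕ} (F : Frame V d) : Continuous F.coord := by
  unfold Frame.coord
  fun_prop

/-- The coordinates of white noise in a frame are independent Gaussian variables. -/
theorem IsWhiteNoise.measurePreserving_coord {s : ℝ} (hs : 0 ≤ s) {P : Measure (GenConn V)}
    (hP : IsWhiteNoise s P) {d : ℕ} (F : Frame V d) :
    MeasurePreserving F.coord P (gaussPi d s) := by
  have := hP.isProbabilityMeasure
  refine ⟨(continuous_coord F).measurable, ?_⟩
  have : IsProbabilityMeasure (P.map F.coord) :=
    Measure.isProbabilityMeasure_map (continuous_coord F).measurable.aemeasurable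
  refine Measure.ext_of_charFunDual (funext fun L => ?_)
  have hL : ∀ x : Fin d → ℝ, L x = ∑ j, L (Pi.single j 1) * x j := by
    intro x
    conv_lhs => rw [pi_eq_sum_univ' x]
    rw [map_sum]
    refine Finset.sum_congr rfl fun j _ => ?_
    rw [map_smul, smul_eq_mul, mul_comm]
  set a : Fin d → ℝ := fun j => L (Pi.single j 1) with ha
  rw [gaussPi, charFunDual_pi, charFunDual_apply,
    integral_map (continuous_coord F).measurable.aemeasurable (by fun_prop)]
  have h := hP.fourier (∑ j, a j • F.ext j)
  rw [connNorm_eq, norm_sq_rieszVec_sum] at h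
  have hfun : ∀ A, Complex.exp ((L (F.coord A) : ℂ) * Complex.I)
      = Complex.exp (Complex.I * (((∑ j, a j • F.ext j) A : ℝ) : ℂ)) := by
    intro A
    rw [mul_comm, hL]
    simp [Frame.coord, ha]
  simp_rw [hfun]
  rw [h, Finset.mul_sum, Complex.ofReal_sum, Complex.exp_sum]
  refine Finset.prod_congr rfl fun j _ => ?_
  have h1 := charFun_gaussianReal (μ := 0) (v := s.toNNReal) (a j)
  rw [charFun_apply_real] at h1
  rw [charFunDual_apply]
  have h2 : ∀ y : ℝ, (L.comp (ContinuousLinearMap.single ℝ (fun _ : Fin d => ℝ) j)) y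
      = a j * y := by
    intro y
    have : (Pi.single j y : Fin d → ℝ) = y • Pi.single j 1 := by
      rw [← Pi.single_smul, smul_eq_mul, mul_one]
    simp only [ContinuousLinearMap.comp_apply, ContinuousLinearMap.single_apply, this, map_smul,
      smul_eq_mul, ha]
    ring
  simp_rw [h2, Complex.ofReal_mul]
  rw [h1, Real.coe_toNNReal _ hs]
  congr 1
  push_cast
  ring

/-- Functionals of the real and of the imaginary part of complex white noise are independent
Gaussian variables. -/
theorem IsComplexWhiteNoise.map_functional {s t : ℝ} (ht : 0 < t) (hst : t / 2 < s)
    {M : Measure (GenConnC V)} (hM : IsComplexWhiteNoise s t M) (φ ψ : StrongDual ℝ (GenConn V)) :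
    M.map (fun C => (φ C.1, ψ C.2))
      = (gaussianReal 0 ((s - t / 2) * ‖rieszVec φ‖ ^ 2).toNNReal).prod
        (gaussianReal 0 (t / 2 * ‖rieszVec ψ‖ ^ 2).toNNReal) := by
  have := hM.isProbabilityMeasure
  have hmeas : Measurable (fun C : GenConnC V => (φ C.1, ψ C.2)) :=
    (φ.continuous.measurable.comp measurable_fst).prodMk
      (ψ.continuous.measurable.comp measurable_snd)
  have : IsProbabilityMeasure (M.map (fun C => (φ C.1, ψ C.2))) :=
    Measure.isProbabilityMeasure_map hmeas.aemeasurable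
  refine Measure.ext_of_charFunDual (funext fun L => ?_)
  have hL : ∀ x y : ℝ, L (x, y) = L (1, 0) * x + L (0, 1) * y := by
    intro x y
    have : ((x, y) : ℝ × ℝ) = x • (1, 0) + y • (0, 1) := by simp
    rw [this, map_add, map_smul, map_smul, smul_eq_mul, smul_eq_mul]
    ring
  rw [charFunDual_prod, charFunDual_apply, integral_map hmeas.aemeasurable (by fun_prop)]
  have h := hM.fourier (L (1, 0) • φ) (L (0, 1) • ψ)
  rw [connNorm_eq, connNorm_eq, map_smul, map_smul, norm_smul, norm_smul] at h
  have hfun : ∀ C : GenConnC V, Complex.exp ((L (φ C.1, ψ C.2) : ℂ) * Complex.I)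
      = Complex.exp (Complex.I * (((L (1, 0) • φ) C.1 : ℝ) : ℂ)
        + Complex.I * (((L (0, 1) • ψ) C.2 : ℝ) : ℂ)) := by
    intro C
    rw [mul_comm, hL]
    simp [mul_add]
  simp_rw [hfun]
  have hone : ∀ (L' : StrongDual ℝ ℝ) (v : ℝ), 0 ≤ v → charFunDual (gaussianReal 0 v.toNNReal) L'
      = Complex.exp ((-(v * L' 1 ^ 2 / 2) : ℝ) : ℂ) := by
    intro L' v hv
    have h1 := charFun_gaussianReal (μ := 0) (v := v.toNNReal) (L' 1)
    rw [charFun_apply_real] at h1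
    have h2 : ∀ y : ℝ, L' y = L' 1 * y := by
      intro y
      conv_lhs => rw [← mul_one y, ← smul_eq_mul, map_smul, smul_eq_mul, mul_comm]
    rw [charFunDual_apply]
    simp_rw [fun y => congrArg Complex.ofReal (h2 y), Complex.ofReal_mul]
    rw [h1, Real.coe_toNNReal _ hv]
    congr 1
    push_cast
    ring
  have hst' : 0 ≤ s - t / 2 := by linarith
  rw [h, hone _ _ (by positivity), hone _ _ (by positivity), ← Complex.exp_add,
    ← Complex.ofReal_add]
  congr 2
  simp only [ContinuousLinearMap.comp_apply, ContinuousLinearMap.inl_apply,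
    ContinuousLinearMap.inr_apply, mul_pow, Real.norm_eq_abs, sq_abs]
  ring

theorem IsComplexWhiteNoise.integral_exp {s t : ℝ} (ht : 0 < t) (hst : t / 2 < s)
    {M : Measure (GenConnC V)} (hM : IsComplexWhiteNoise s t M) (φ ψ : StrongDual ℝ (GenConn V)) :
    ∫ C, Complex.exp ((φ C.1 : ℂ) * Complex.I) * Complex.exp (ψ C.2 : ℂ) ∂M
      = Complex.exp ((-((s - t / 2) / 2) * ‖rieszVec φ‖ ^ 2 + t / 4 * ‖rieszVec ψ‖ ^ 2 : ℝ) : ℂ) := by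
  have h := integral_map (measurable_functional_pair φ ψ).aemeasurable (μ := M)
    (f := fun p : ℝ × ℝ => Complex.exp ((p.1 : ℂ) * Complex.I) * Complex.exp (p.2 : ℂ))
    (by fun_prop)
  have hst' : 0 ≤ s - t / 2 := by linarith
  rw [← h, hM.map_functional ht hst,
    integral_prod_mul (fun x : ℝ => Complex.exp ((x : ℂ) * Complex.I))
      (fun y : ℝ => Complex.exp (y : ℂ))]
  have h1 := charFun_gaussianReal (μ := 0) (v := ((s - t / 2) * ‖rieszVec φ‖ ^ 2).toNNReal) 1
  rw [charFun_apply_real] at h1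
  simp only [Complex.ofReal_one, one_mul] at h1
  have h2 := mgf_gaussianReal (p := gaussianReal 0 (t / 2 * ‖rieszVec ψ‖ ^ 2).toNNReal)
    (X := id) Measure.map_id 1
  rw [mgf] at h2
  simp only [id, one_mul] at h2
  have h3 : ∫ y : ℝ, Complex.exp (y : ℂ) ∂gaussianReal 0 (t / 2 * ‖rieszVec ψ‖ ^ 2).toNNReal
      = ((∫ y : ℝ, Real.exp y ∂gaussianReal 0 (t / 2 * ‖rieszVec ψ‖ ^ 2).toNNReal : ℝ) : ℂ) := by
    rw [← integral_complex_ofReal]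
    simp
  rw [h1, h3, h2, Complex.ofReal_exp, ← Complex.exp_add, Real.coe_toNNReal _ (by positivity),
    Real.coe_toNNReal _ (by positivity)]
  congr 1
  push_cast
  ring

end WhiteNoise

/-! ### The Segal–Bargmann transform on exponentials -/

section Transform

open ProbabilityTheory

variable {V : Type*} [NormedAddCommGroup V] [InnerProductSpace ℝ V] [FiniteDimensional ℝ V]

/-- The transform `e^{-t‖φ‖²/2} e^{iφ(C)}` of the exponential `e^{iφ(A)}`. -/
def holExp (t : ℝ) (φ : StrongDual ℝ (GenConn V)) (C : GenConnC V) : ℂ :=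
  Complex.exp ((-(t / 2) * ‖rieszVec φ‖ ^ 2 : ℝ) : ℂ)
    * (Complex.exp ((φ C.1 : ℂ) * Complex.I) * Complex.exp (((-φ) C.2 : ℝ) : ℂ))

theorem memLp_holExp {s t : ℝ} (ht : 0 < t) (hst : t / 2 < s)
    {M : Measure (GenConnC V)} (hM : IsComplexWhiteNoise s t M) (φ : StrongDual ℝ (GenConn V)) :
    MemLp (holExp t φ) 2 M := by
  refine MemLp.const_mul ?_ _
  have h1 : Measurable fun C : GenConnC V => φ C.1 := φ.continuous.measurable.comp measurable_fst
  have h2 : Measurable fun C : GenConnC V => (-φ) C.2 :=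
    (-φ).continuous.measurable.comp measurable_snd
  rw [memLp_two_iff_integrable_sq_norm (Measurable.aestronglyMeasurable (by fun_prop))]
  have hmap : M.map (fun C => (-φ) C.2) = gaussianReal 0 (t / 2 * ‖rieszVec (-φ)‖ ^ 2).toNNReal := by
    have h := congrArg Measure.snd (hM.map_functional ht hst φ (-φ))
    rwa [Measure.snd_prod, Measure.snd, Measure.map_map measurable_snd
      (measurable_functional_pair _ _)] at h
  have h3 := integrable_exp_mul_gaussianReal (μ := 0)
    (v := (t / 2 * ‖rieszVec (-φ)‖ ^ 2).toNNReal) 2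
  rw [← hmap] at h3
  have h4 := h3.comp_measurable h2
  refine h4.congr (.of_forall fun C => ?_)
  simp only [Function.comp_apply]
  rw [norm_mul, Complex.norm_exp_ofReal_mul_I, one_mul, Complex.norm_exp, Complex.ofReal_re,
    ← Real.exp_nat_mul]
  norm_num

/-- The exponentials of a real white noise and their transforms have the same Gram matrix.  By the
parallelogram law the growth `t/4 ‖φ + ψ‖²` in the imaginary directions is compensated by the
prefactors of the transform. -/
theorem inner_holExp {s t : ℝ} (ht : 0 < t) (hst : t / 2 < s)
    {P : Measure (GenConn V)} [IsFiniteMeasure P] (hP : IsWhiteNoise s P)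
    {M : Measure (GenConnC V)} (hM : IsComplexWhiteNoise s t M) (φ ψ : StrongDual ℝ (GenConn V)) :
    inner ℂ (memLp_holExp ht hst hM φ).toLp (memLp_holExp ht hst hM ψ).toLp
      = inner ℂ (character P φ) (character P ψ) := by
  have hleft : inner ℂ (memLp_holExp ht hst hM φ).toLp (memLp_holExp ht hst hM ψ).toLp
      = ∫ C, Complex.exp ((-(t / 2) * ‖rieszVec φ‖ ^ 2 : ℝ) : ℂ)
        * Complex.exp ((-(t / 2) * ‖rieszVec ψ‖ ^ 2 : ℝ) : ℂ)
        * (Complex.exp (((ψ - φ) C.1 : ℝ) * Complex.I)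
          * Complex.exp (((-(φ + ψ)) C.2 : ℝ) : ℂ)) ∂M := by
    rw [L2.inner_def]
    refine integral_congr_ae ?_
    filter_upwards [(memLp_holExp ht hst hM φ).coeFn_toLp, (memLp_holExp ht hst hM ψ).coeFn_toLp]
      with C h1 h2
    rw [h1, h2, RCLike.inner_apply, holExp, holExp]
    simp only [map_mul, ← Complex.exp_conj, Complex.conj_ofReal, Complex.conj_I]
    simp only [← Complex.exp_add]
    congr 1
    simp only [neg_apply, sub_apply,
      add_apply]
    push_cast
    ring
  have hright : inner ℂ (character P φ) (character P ψ)
      = ∫ A, Complex.exp (Complex.I * (((ψ - φ) A : ℝ) : ℂ)) ∂P := by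
    rw [L2.inner_def]
    refine integral_congr_ae ?_
    filter_upwards [(memLp_character P φ).coeFn_toLp, (memLp_character P ψ).coeFn_toLp]
      with A h1 h2
    rw [character, character, h1, h2, RCLike.inner_apply]
    simp only [← Complex.exp_conj, map_mul, Complex.conj_ofReal, Complex.conj_I, ← Complex.exp_add]
    congr 1
    simp only [sub_apply]
    push_cast
    ring
  rw [hleft, hright, hP.fourier, integral_const_mul, hM.integral_exp ht hst, ← Complex.exp_add,
    ← Complex.exp_add, ← Complex.ofReal_add, ← Complex.ofReal_add, connNorm_eq]
  congr 2
  have hpar := parallelogram_law_with_norm ℝ (rieszVec φ) (rieszVec ψ)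
  rw [rieszVec_neg, rieszVec_sub, norm_neg, map_add, norm_sub_rev (rieszVec ψ)]
  linear_combination (t / 4) * hpar

theorem holExp_frame {d : ℕ} {t : ℝ} (ht : 0 < t) (F : Frame V d) (a : Fin d → ℝ)
    (C : GenConnC V) :
    holExp t (∑ j, a j • F.ext j) C
      = finTransform t (fun x => Complex.exp (Complex.I * ∑ j, (a j : ℂ) * (x j : ℂ)))
        (F.coordC C) := by
  rw [finTransform_exp ht, holExp, norm_sq_rieszVec_sum, ← Complex.exp_add, ← Complex.exp_add]
  congr 1
  simp only [Frame.coordC, neg_apply, sum_apply,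
    smul_apply, smul_eq_mul, mul_add, Finset.sum_add_distrib]
  push_cast
  simp only [Finset.mul_sum, Finset.sum_mul]
  rw [← Finset.sum_neg_distrib]
  congr 1
  congr 1
  · exact Finset.sum_congr rfl fun j _ => by ring
  · refine Finset.sum_congr rfl fun j _ => ?_
    linear_combination -((a j : ℂ) * (F.ext j C.2 : ℂ)) * Complex.I_sq

theorem finTransform_congr_ae {d : ℕ} {s : ℝ} (hs : 0 < s) (t : ℝ) {φ ψ : (Fin d → ℝ) → ℂ}
    (h : φ =ᵐ[gaussPi d s] ψ) : finTransform t φ = finTransform t ψ := by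
  funext z
  rw [finTransform_eq_integral hs, finTransform_eq_integral hs]
  refine integral_congr_ae ?_
  filter_upwards [h] with x hx
  rw [hx]

/-- Point evaluation of the transform as a continuous linear functional on `L²`. -/
def finTransformL {d : ℕ} {s t : ℝ} (ht : 0 < t) (hst : t / 2 < s) (z : Fin d → ℂ) :
    Lp ℂ 2 (gaussPi d s) →L[ℂ] ℂ :=
  innerSL ℂ (memLp_segalKernel ht hst z).star.toLp

theorem finTransformL_apply {d : ℕ} {s t : ℝ} (ht : 0 < t) (hst : t / 2 < s) (z : Fin d → ℂ)
    (f : Lp ℂ 2 (gaussPi d s)) : finTransformL ht hst z f = finTransform t f z := by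
  have hs : 0 < s := by linarith
  rw [finTransformL, innerSL_apply_apply, L2.inner_def, finTransform_eq_integral hs]
  refine integral_congr_ae ?_
  filter_upwards [(memLp_segalKernel ht hst z).star.coeFn_toLp] with x hx
  rw [hx, RCLike.inner_apply, mul_comm]
  simp

/-- An isometry with the right values on exponentials acts on every cylinder function by the
finite-dimensional transform: exponentials are dense, and point evaluations of the
finite-dimensional transform are continuous on `L²`. -/
theorem isSegalBargmann_of_exp {s t : ℝ} (ht : 0 < t) (hst : t / 2 < s)
    {P : Measure (GenConn V)} [IsFiniteMeasure P] (hP : IsWhiteNoise s P)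
    {M : Measure (GenConnC V)} (S : Lp ℂ 2 P →ₗᵢ[ℂ] Lp ℂ 2 M)
    (hS : ∀ φ, (S (character P φ) : GenConnC V → ℂ) =ᵐ[M] holExp t φ) :
    IsSegalBargmann t S := by
  have hs : 0 < s := by linarith
  intro d F φ hφm hφ
  have hmp := hP.measurePreserving_coord hs.le F
  set U := Lp.compMeasurePreservingₗᵢ (E := ℂ) (p := 2) ℂ F.coord hmp with hU
  -- the functions of the coordinates on which `S` acts by the finite-dimensional transform
  let K : Submodule ℂ (Lp ℂ 2 (gaussPi d s)) :=
    { carrier := {f | (S (U f) : GenConnC V → ℂ) =ᵐ[M]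
        fun C => finTransformL ht hst (F.coordC C) f}
      zero_mem' := by
        simp only [Set.mem_ofPred_eq, map_zero]
        exact Lp.coeFn_zero _ _ _
      add_mem' := by
        intro f g hf hg
        simp only [Set.mem_ofPred_eq, map_add] at *
        filter_upwards [hf, hg, Lp.coeFn_add (S (U f)) (S (U g))] with C h1 h2 h3
        rw [h3, Pi.add_apply, h1, h2]
      smul_mem' := by
        intro a f hf
        simp only [Set.mem_ofPred_eq, map_smul] at *
        filter_upwards [hf, Lp.coeFn_smul a (S (U f))] with C h1 h2
        rw [h2, Pi.smul_apply, h1] }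
  have hclosed : IsClosed (K : Set (Lp ℂ 2 (gaussPi d s))) := by
    refine isClosed_of_closure_subset fun f hf => ?_
    obtain ⟨u, huK, hu⟩ := mem_closure_iff_seq_limit.1 hf
    have hSu : Filter.Tendsto (fun n => S (U (u n))) Filter.atTop (nhds (S (U f))) :=
      ((S.continuous.comp U.continuous).tendsto f).comp hu
    -- along a subsequence the images converge almost everywhere, and the formula converges at
    -- every point
    obtain ⟨ns, hns, hae⟩ := (tendstoInMeasure_of_tendsto_Lp hSu).exists_seq_tendsto_ae
    have hall : ∀ᵐ C ∂M, ∀ n, S (U (u n)) C = finTransformL ht hst (F.coordC C) (u n) :=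
      ae_all_iff.2 fun n => huK n
    change (S (U f) : GenConnC V → ℂ) =ᵐ[M] fun C => finTransformL ht hst (F.coordC C) f
    filter_upwards [hae, hall] with C h1 h2
    simp only [h2] at h1
    exact tendsto_nhds_unique h1
      ((((finTransformL ht hst (F.coordC C)).continuous.tendsto f).comp hu).comp hns.tendsto_atTop)
  have hchar : ∀ L, character (gaussPi d s) L ∈ K := by
    intro L
    set a : Fin d → ℝ := fun j => L (Pi.single j 1) with ha
    have hL : ∀ x : Fin d → ℝ, L x = ∑ j, a j * x j := by
      intro x
      conv_lhs => rw [pi_eq_sum_univ' x]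
      rw [map_sum]
      refine Finset.sum_congr rfl fun j _ => ?_
      rw [map_smul, smul_eq_mul, mul_comm]
    have hUchar : U (character (gaussPi d s) L) = character P (∑ j, a j • F.ext j) := by
      change Lp.compMeasurePreserving F.coord hmp _ = _
      rw [character, Lp.toLp_compMeasurePreserving, character]
      refine MemLp.toLp_congr _ _ (.of_forall fun A => ?_)
      simp only [Function.comp_apply]
      rw [hL]
      simp [Frame.coord]
    have hfun : (character (gaussPi d s) L : (Fin d → ℝ) → ℂ) =ᵐ[gaussPi d s]
        fun x => Complex.exp (Complex.I * ∑ j, (a j : ℂ) * (x j : ℂ)) := by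
      filter_upwards [(memLp_character (gaussPi d s) L).coeFn_toLp] with x hx
      rw [character, hx, hL, mul_comm]
      push_cast
      rfl
    change (S (U (character (gaussPi d s) L)) : GenConnC V → ℂ) =ᵐ[M] _
    rw [hUchar]
    filter_upwards [hS (∑ j, a j • F.ext j)] with C hC
    refine hC.trans ?_
    rw [holExp_frame ht, finTransformL_apply, finTransform_congr_ae hs t hfun]
  have htop : ∀ f, f ∈ K := by
    intro f
    have h1 : (Submodule.span ℂ (Set.range (character (gaussPi d s)))).topologicalClosure ≤ K :=
      Submodule.topologicalClosure_minimal _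
        (Submodule.span_le.2 (by rintro _ ⟨L, rfl⟩; exact hchar L)) hclosed
    rw [span_character_dense] at h1
    exact h1 Submodule.mem_top
  have hφ' : MemLp φ 2 (gaussPi d s) := by
    rw [← hmp.map_eq, memLp_map_measure_iff hφm.aestronglyMeasurable hmp.measurable.aemeasurable]
    exact hφ
  have hlp : hφ.toLp = U hφ'.toLp := (Lp.toLp_compMeasurePreserving hφ' hmp).symm
  rw [hlp]
  filter_upwards [htop hφ'.toLp] with C hC
  rw [hC, finTransformL_apply, finTransform_congr_ae hs t hφ'.coeFn_toLp]

/-- Every exponential is a cylinder function: a functional vanishing on `𝒜` vanishes almost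
surely, and any other one spans a one-dimensional frame. -/
theorem exists_frame_character {s : ℝ} (hs : 0 ≤ s)
    {P : Measure (GenConn V)} [IsFiniteMeasure P] (hP : IsWhiteNoise s P)
    (φ : StrongDual ℝ (GenConn V)) :
    ∃ (d : ℕ) (F : Frame V d) (f : (Fin d → ℝ) → ℂ), Measurable f ∧
      ∃ hf : MemLp (fun A => f (F.coord A)) 2 P, hf.toLp = character P φ := by
  by_cases h0 : rieszVec φ = 0
  · refine ⟨0, ⟨Fin.elim0, ⟨fun i => i.elim0, fun i => i.elim0⟩, Fin.elim0, fun i => i.elim0⟩,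
      fun _ => 1, measurable_const, memLp_const 1, ?_⟩
    refine MemLp.toLp_congr _ _ ?_
    filter_upwards [hP.ae_eq_zero hs h0] with A hA
    simp [hA]
  · have hn : ‖rieszVec φ‖ ≠ 0 := norm_ne_zero_iff.2 h0
    let F : Frame V 1 :=
      { e := fun _ => ‖rieszVec φ‖⁻¹ • rieszVec φ
        orthonormal := by
          refine ⟨fun i => ?_, fun i j hij => absurd (Subsingleton.elim i j) hij⟩
          rw [norm_smul, norm_inv, norm_norm, inv_mul_cancel₀ hn]
        ext := fun _ => ‖rieszVec φ‖⁻¹ • φ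
        ext_incl := fun j f => by
          rw [real_inner_smul_left, inner_rieszVec]
          rfl }
    have hf : ∀ A, Complex.exp ((‖rieszVec φ‖ : ℂ) * (F.coord A 0 : ℂ) * Complex.I)
        = Complex.exp ((φ A : ℂ) * Complex.I) := by
      intro A
      have : (‖rieszVec φ‖ : ℂ) ≠ 0 := by exact_mod_cast hn
      have h1 : F.coord A 0 = ‖rieszVec φ‖⁻¹ * φ A := rfl
      rw [h1]
      push_cast
      field_simp
    refine ⟨1, F, fun x => Complex.exp ((‖rieszVec φ‖ : ℂ) * (x 0 : ℂ) * Complex.I), by fun_prop,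
      (memLp_character P φ).ae_eq (.of_forall fun A => (hf A).symm), ?_⟩
    exact MemLp.toLp_congr _ _ (.of_forall hf)

/-- Existence and uniqueness of the Segal–Bargmann transform. -/
theorem exists_unique_segalBargmann {s t : ℝ} (ht : 0 < t) (hst : t / 2 < s)
    {P : Measure (GenConn V)} (hP : IsWhiteNoise s P)
    {M : Measure (GenConnC V)} (hM : IsComplexWhiteNoise s t M) :
    ∃ S : Lp ℂ 2 P →ₗᵢ[ℂ] Lp ℂ 2 M, IsSegalBargmann t S ∧
      ∀ S' : Lp ℂ 2 P →ₗᵢ[ℂ] Lp ℂ 2 M, IsSegalBargmann t S' → S' = S := by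
  have hs : 0 < s := by linarith
  have := hP.isProbabilityMeasure
  obtain ⟨S, hS⟩ := exists_linearIsometry_of_inner_eq (character P)
    (fun φ => (memLp_holExp ht hst hM φ).toLp) (inner_holExp ht hst hP hM)
    (span_character_dense P)
  have hSB : IsSegalBargmann t S := isSegalBargmann_of_exp ht hst hP S fun φ => by
    rw [hS]
    exact (memLp_holExp ht hst hM φ).coeFn_toLp
  refine ⟨S, hSB, fun S' hS' => ?_⟩
  have hchar : ∀ φ, S' (character P φ) = S (character P φ) := by
    intro φ
    obtain ⟨d, F, f, hfm, hf, heq⟩ := exists_frame_character hs.le hP φ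
    rw [← heq]
    exact Lp.ext ((hS' d F f hfm hf).trans (hSB d F f hfm hf).symm)
  have hle : (Submodule.span ℂ (Set.range (character P))).topologicalClosure
      ≤ LinearMap.eqLocus S'.toLinearMap S.toLinearMap := by
    refine Submodule.topologicalClosure_minimal _ (Submodule.span_le.2 ?_)
      (isClosed_eq S'.continuous S.continuous)
    rintro _ ⟨φ, rfl⟩
    exact hchar φ
  rw [span_character_dense] at hle
  exact LinearIsometry.ext fun f => hle Submodule.mem_top

end Transform

/-! ### Holomorphic Hermite polynomials -/

section Holomorphic

open MvPolynomial

variable {d : ℕ}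

theorem differentiable_eval (p : MvPolynomial (Fin d) ℂ) :
    Differentiable ℂ fun z : Fin d → ℂ => eval z p := by
  induction p using MvPolynomial.induction_on with
  | C a => simp
  | add p q hp hq => simpa using hp.fun_add hq
  | mul_X p k hp =>
    simp only [map_mul, eval_X]
    exact hp.fun_mul (differentiable_apply k)

theorem evalXY_ofReal_add (Q : MvPolynomial (Fin d ⊕ Fin d) ℂ) (a b : Fin d → ℝ) :
    evalXY Q (fun j => (a j : ℂ) + Complex.I * b j)
      = eval (Sum.elim (fun j => (a j : ℂ)) fun j => (b j : ℂ)) Q := by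
  simp [evalXY]

/-- A polynomial in the real coordinates which is a holomorphic function is the analytic
continuation of its restriction to `ℝ^d`: on each complexified line `ζ ↦ a + ζ b` both sides are
entire functions of one variable that agree for real `ζ`. -/
theorem eq_complexify_of_differentiable {Q : MvPolynomial (Fin d ⊕ Fin d) ℂ}
    (hQ : Differentiable ℂ (evalXY Q)) :
    Q = complexify (aeval (Sum.elim X 0) Q) := by
  set R : MvPolynomial (Fin d) ℂ := aeval (Sum.elim X 0) Q with hR
  refine MvPolynomial.funext_set (fun _ => Set.range Complex.ofReal)
    (fun _ => Set.infinite_range_of_injective Complex.ofReal_injective) fun x hx => ?_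
  choose y hy using fun i => hx i (Set.mem_univ i)
  set a : Fin d → ℝ := fun j => y (Sum.inl j) with ha
  set b : Fin d → ℝ := fun j => y (Sum.inr j) with hb
  have hxab : x = Sum.elim (fun j => (a j : ℂ)) fun j => (b j : ℂ) := by
    funext i
    rcases i with i | i <;> simp [← hy, ha, hb]
  rw [hxab, ← evalXY_ofReal_add, ← evalXY_ofReal_add, evalXY_complexify]
  have hreal : ∀ u : Fin d → ℝ, evalXY Q (fun j => (u j : ℂ)) = eval (fun j => (u j : ℂ)) R := by
    intro u
    rw [evalXY, hR, ← coe_aeval_eq_eval, ← coe_aeval_eq_eval]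
    change aeval _ Q = (aeval _) ((aeval _) Q)
    rw [comp_aeval_apply]
    congr 2
    funext i
    rcases i with i | i <;> simp
  set h : ℂ → ℂ := fun ζ => evalXY Q (fun j => (a j : ℂ) + ζ * b j)
    - eval (fun j => (a j : ℂ) + ζ * b j) R with hh
  have hline : Differentiable ℂ fun ζ : ℂ => fun j : Fin d => (a j : ℂ) + ζ * b j := by
    fun_prop
  have hdiff : Differentiable ℂ h :=
    (hQ.comp hline).sub ((differentiable_eval R).comp hline)
  have hzero : ∀ r : ℝ, h r = 0 := by
    intro r
    have := hreal fun j => a j + r * b j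
    push_cast at this
    simp only [hh, this, sub_self]
  have hfreq : ∃ᶠ ζ in nhdsWithin (0 : ℂ) {0}ᶜ, h ζ = 0 := by
    have ht : Filter.Tendsto (fun r : ℝ => (r : ℂ)) (nhdsWithin 0 {0}ᶜ)
        (nhdsWithin (0 : ℂ) {0}ᶜ) := by
      refine tendsto_nhdsWithin_of_tendsto_nhds_of_eventually_within _ ?_ ?_
      · exact (Complex.continuous_ofReal.tendsto' 0 0 (by simp)).mono_left nhdsWithin_le_nhds
      · filter_upwards [self_mem_nhdsWithin] with r hr
        simpa using hr
    exact ht.frequently (Filter.Frequently.of_forall hzero)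
  -- `ζ = i` gives the value at `a + i b`
  have hall := AnalyticOnNhd.eqOn_zero_of_preconnected_of_frequently_eq_zero
    (f := h) (U := Set.univ) (fun z _ => hdiff.analyticAt z) isPreconnected_univ
    (Set.mem_univ 0) hfreq (Set.mem_univ Complex.I)
  exact sub_eq_zero.1 hall

theorem homogeneousComponent_complexify (n : ℕ) (p : MvPolynomial (Fin d) ℂ) :
    homogeneousComponent n (complexify p) = complexify (homogeneousComponent n p) := by
  have h : ∀ i ∈ Finset.range (p.totalDegree + 1),
      homogeneousComponent n (complexifyₐ d (homogeneousComponent i p))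
        = if i = n then complexify (homogeneousComponent n p) else 0 := by
    intro i _
    rw [complexifyₐ_apply, homogeneousComponent_of_mem
      (isHomogeneous_complexify (homogeneousComponent_isHomogeneous i p))]
    rcases eq_or_ne i n with rfl | h
    · simp
    · simp [h, Ne.symm h]
  conv_lhs => rw [← sum_homogeneousComponent p, ← complexifyₐ_apply, map_sum, map_sum,
    Finset.sum_congr rfl h, Finset.sum_ite_eq']
  split_ifs with hn
  · rfl
  · rw [Finset.mem_range, not_lt] at hn
    rw [homogeneousComponent_eq_zero n p (by omega)]
    exact (map_zero (complexifyₐ d)).symm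

/-- The holomorphic elements of `e^{-A_{s,t}/2} 𝒫_n(ℂ^d)` are the `e^{-A_{s,t}/2} p_ℂ` with `p`
homogeneous of degree `n` on `ℝ^d`. -/
theorem mem_holHermiteFin_iff {n : ℕ} {s t : ℝ} {Φ : (Fin d → ℂ) → ℂ} :
    Φ ∈ holHermiteFin n d s t ↔ ∃ p : MvPolynomial (Fin d) ℂ, p.IsHomogeneous n ∧
      Φ = evalXY (expNegHalf (complexCoeff d s t) (complexify p)) := by
  constructor
  · rintro ⟨hΦ, p, hp, rfl⟩
    have h := eq_complexify_of_differentiable hΦ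
    -- the degree `n` part of the left side is `p`, that of the right side is a complexification
    have h2 := congrArg (homogeneousComponent n) h
    rw [homogeneousComponent_expNegHalf _ hp, homogeneousComponent_complexify] at h2
    exact ⟨_, homogeneousComponent_isHomogeneous n _, by rw [← h2]⟩
  · rintro ⟨p, hp, rfl⟩
    refine ⟨?_, _, isHomogeneous_complexify hp, rfl⟩
    have : evalXY (expNegHalf (complexCoeff d s t) (complexify p))
        = fun z => eval z (expNegHalf (realCoeff d (s - t)) p) := by
      funext z
      rw [expNegHalf_complexify, evalXY_complexify]
    rw [this]
    exact differentiable_eval _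

end Holomorphic

section HermiteSpaces

open MvPolynomial

variable {V : Type*} [NormedAddCommGroup V] [InnerProductSpace ℝ V] [FiniteDimensional ℝ V]

theorem memLp_evalR_coord {s : ℝ} (hs : 0 ≤ s) {P : Measure (GenConn V)} (hP : IsWhiteNoise s P)
    {d : ℕ} (F : Frame V d) (p : MvPolynomial (Fin d) ℂ) :
    MemLp (fun A => evalR p (F.coord A)) 2 P :=
  (memLp_evalR s p).comp_measurePreserving (hP.measurePreserving_coord hs F)

/-- The transform of a Hermite polynomial of white noise. -/
theorem IsSegalBargmann.hermite {s t : ℝ} (ht : 0 < t) (hst : t / 2 < s)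
    {P : Measure (GenConn V)} (hP : IsWhiteNoise s P) {M : Measure (GenConnC V)}
    {S : Lp ℂ 2 P →ₗᵢ[ℂ] Lp ℂ 2 M} (hS : IsSegalBargmann t S) {d : ℕ} (F : Frame V d)
    (p : MvPolynomial (Fin d) ℂ) {f : Lp ℂ 2 P}
    (hf : (f : GenConn V → ℂ) =ᵐ[P] fun A => evalR (expNegHalf (realCoeff d s) p) (F.coord A)) :
    (S f : GenConnC V → ℂ) =ᵐ[M]
      fun C => evalXY (expNegHalf (complexCoeff d s t) (complexify p)) (F.coordC C) := by
  have hs : 0 < s := by linarith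
  have hmem := memLp_evalR_coord hs.le hP F (expNegHalf (realCoeff d s) p)
  have hf' : f = hmem.toLp := Lp.ext (hf.trans hmem.coeFn_toLp.symm)
  rw [hf']
  filter_upwards [hS d F _ (continuous_evalR _).measurable hmem] with C hC
  rw [hC, finTransform_expNegHalf_eq_evalXY ht]

theorem IsSegalBargmann.image_hermiteSpace {s t : ℝ} (ht : 0 < t) (hst : t / 2 < s)
    {P : Measure (GenConn V)} (hP : IsWhiteNoise s P) {M : Measure (GenConnC V)}
    {S : Lp ℂ 2 P →ₗᵢ[ℂ] Lp ℂ 2 M} (hS : IsSegalBargmann t S) (n : ℕ) :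
    S '' hermiteSpace n s P = holHermiteSpace n s t M := by
  have hs : 0 < s := by linarith
  rw [hermiteSpace, holHermiteSpace, ← S.isometry.isClosedEmbedding.closure_image_eq]
  congr 1
  ext g
  constructor
  · rintro ⟨f, ⟨d, F, φ, ⟨p, hp, rfl⟩, hf⟩, rfl⟩
    exact ⟨d, F, _, mem_holHermiteFin_iff.2 ⟨p, hp, rfl⟩, hS.hermite ht hst hP F p hf⟩
  · rintro ⟨d, F, Φ, hΦ, hg⟩
    obtain ⟨p, hp, rfl⟩ := mem_holHermiteFin_iff.1 hΦ
    have hmem := memLp_evalR_coord hs.le hP F (expNegHalf (realCoeff d s) p)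
    refine ⟨hmem.toLp, ⟨d, F, _, ⟨p, hp, rfl⟩, hmem.coeFn_toLp⟩, ?_⟩
    exact Lp.ext ((hS.hermite ht hst hP F p hmem.coeFn_toLp).trans hg.symm)

end HermiteSpaces

/-! ### Refinement of frames -/

section Refinement

variable {V : Type*} [NormedAddCommGroup V] [InnerProductSpace ℝ V] [FiniteDimensional ℝ V]

/-- Expansion of the vectors of a frame in a larger frame. -/
theorem Frame.e_eq_sum {d m : ℕ} (F : Frame V d) (G : Frame V m)
    (h : ∀ j, F.e j ∈ Submodule.span ℝ (Set.range G.e)) (j : Fin d) :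
    F.e j = ∑ l, inner ℝ (F.e j) (G.e l) • G.e l := by
  obtain ⟨a, ha⟩ := (Submodule.mem_span_range_iff_exists_fun ℝ).1 (h j)
  have hl : ∀ l, inner ℝ (F.e j) (G.e l) = a l := by
    intro l
    rw [← ha, G.orthonormal.inner_left_fintype]
    rfl
  simp only [hl, ha]

theorem Frame.sum_inner_mul_inner {d m : ℕ} (F : Frame V d) (G : Frame V m)
    (h : ∀ j, F.e j ∈ Submodule.span ℝ (Set.range G.e)) (i j : Fin d) :
    ∑ l, inner ℝ (F.e i) (G.e l) * inner ℝ (F.e j) (G.e l) = if i = j then 1 else 0 := by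
  rw [← orthonormal_iff_ite.1 F.orthonormal i j]
  conv_rhs => rw [F.e_eq_sum G h j]
  rw [inner_sum]
  refine Finset.sum_congr rfl fun l _ => ?_
  rw [real_inner_smul_right, mul_comm]

/-- Finitely many vectors of `𝒜` whose functionals extend continuously lie in the span of a
frame. -/
theorem exists_frame_span {κ : Type*} [Finite κ] (φ : κ → StrongDual ℝ (GenConn V)) :
    ∃ (m : ℕ) (G : Frame V m), ∀ k, rieszVec (φ k) ∈ Submodule.span ℝ (Set.range G.e) := by
  set N : Submodule ℝ (Conn V) := Submodule.span ℝ (Set.range fun k => rieszVec (φ k)) with hN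
  have hfin : FiniteDimensional ℝ N := FiniteDimensional.span_of_finite ℝ (Set.finite_range _)
  set b := stdOrthonormalBasis ℝ N with hb
  have hlift : ∀ l, ∃ ψ : StrongDual ℝ (GenConn V), rieszVec ψ = (b l : Conn V) := by
    intro l
    have h1 : N = (Submodule.span ℝ (Set.range φ)).map rieszVec := by
      rw [Submodule.map_span, ← Set.range_comp]
      rfl
    have h2 := (b l).2
    have h3 : (b l : Conn V) ∈ (Submodule.span ℝ (Set.range φ)).map rieszVec := h1.le h2
    rw [Submodule.mem_map] at h3
    obtain ⟨ψ, -, hψ⟩ := h3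
    exact ⟨ψ, hψ⟩
  choose ψ hψ using hlift
  refine ⟨_, ⟨fun l => (b l : Conn V), ?_, ψ, fun j f => ?_⟩, fun k => ?_⟩
  · exact b.orthonormal.comp_linearIsometry N.subtypeₗᵢ
  · rw [← inner_rieszVec, hψ]
  · have hk : rieszVec (φ k) ∈ N := Submodule.subset_span ⟨k, rfl⟩
    have h1 := b.sum_repr' ⟨_, hk⟩
    have h2 := congrArg (N.subtype) h1
    rw [map_sum] at h2
    change _ = rieszVec (φ k) at h2
    rw [← h2]
    refine Submodule.sum_mem _ fun l _ => ?_
    rw [map_smul]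
    exact Submodule.smul_mem _ _ (Submodule.subset_span ⟨l, rfl⟩)

/-- Two frames have a common refinement. -/
theorem exists_common_frame {d d' : ℕ} (F : Frame V d) (F' : Frame V d') :
    ∃ (m : ℕ) (G : Frame V m), (∀ j, F.e j ∈ Submodule.span ℝ (Set.range G.e)) ∧
      ∀ j, F'.e j ∈ Submodule.span ℝ (Set.range G.e) := by
  obtain ⟨m, G, hG⟩ := exists_frame_span (Sum.elim F.ext F'.ext)
  refine ⟨m, G, fun j => ?_, fun j => ?_⟩
  · simpa [F.rieszVec_ext] using hG (Sum.inl j)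
  · simpa [F'.rieszVec_ext] using hG (Sum.inr j)

/-- Change of coordinates to a finer frame. The two sides differ by functionals vanishing on `𝒜`,
which vanish almost surely. -/
theorem IsWhiteNoise.coord_refine {s : ℝ} (hs : 0 ≤ s) {P : Measure (GenConn V)}
    (hP : IsWhiteNoise s P) {d m : ℕ} (F : Frame V d) (G : Frame V m)
    (h : ∀ j, F.e j ∈ Submodule.span ℝ (Set.range G.e)) :
    ∀ᵐ A ∂P, F.coord A = fun j => ∑ l, inner ℝ (F.e j) (G.e l) * G.coord A l := by
  have hj : ∀ j, ∀ᵐ A ∂P, F.ext j A = ∑ l, inner ℝ (F.e j) (G.e l) * G.ext l A := by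
    intro j
    have h0 : rieszVec (F.ext j - ∑ l, inner ℝ (F.e j) (G.e l) • G.ext l) = 0 := by
      rw [rieszVec_sub, map_sum]
      simp only [map_smul, Frame.rieszVec_ext]
      rw [← F.e_eq_sum G h j, sub_self]
    filter_upwards [hP.ae_eq_zero hs h0] with A hA
    rw [sub_apply, sub_eq_zero] at hA
    rw [hA]
    simp
  filter_upwards [ae_all_iff.2 hj] with A hA
  exact funext hA

end Refinement

/-! ### Elementary kernels -/

section Kernels

/-- Lebesgue measure on the simplex. -/
abbrev simplexVol (n : ℕ) : Measure (Fin n → ℝ) := volume.restrict (simplex n)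

theorem pi_unitVol (n : ℕ) : (Measure.pi fun _ : Fin n => unitVol)
    = (volume : Measure (Fin n → ℝ)).restrict (Set.univ.pi fun _ => Set.Icc 0 1) := by
  rw [volume_pi, Measure.restrict_pi_pi]

theorem measurableSet_simplex (n : ℕ) : MeasurableSet (simplex n) := by
  have h : simplex n = (Set.univ.pi fun _ => Set.Icc (0 : ℝ) 1) ∩ {τ | Monotone τ} := by
    ext τ
    simp only [simplex, Set.mem_ofPred_eq, Set.mem_inter_iff, Set.mem_pi, Set.mem_univ, true_imp_iff]
  rw [h]
  exact (MeasurableSet.univ_pi fun _ => measurableSet_Icc).inter isClosed_monotone.measurableSet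

theorem simplexVol_le (n : ℕ) : simplexVol n ≤ Measure.pi fun _ : Fin n => unitVol := by
  rw [pi_unitVol]
  exact Measure.restrict_mono (fun τ hτ i _ => hτ.1 i) le_rfl

/-- A property of almost all times holds at all coordinates of almost every point of the
simplex. -/
theorem ae_simplex_of_ae_unitVol {n : ℕ} {p : ℝ → Prop} (h : ∀ᵐ x ∂unitVol, p x) :
    ∀ᵐ τ ∂simplexVol n, ∀ i, p (τ i) := by
  refine ae_all_iff.2 fun i => ae_mono (simplexVol_le n) ?_
  exact (Measure.quasiMeasurePreserving_eval (fun _ : Fin n => unitVol) i).ae h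

variable {V : Type*} [NormedAddCommGroup V] [InnerProductSpace ℝ V]
  {ι : Type*} [Fintype ι] (X : OrthonormalBasis ι ℝ V)

theorem measurable_component (f : Conn V) (k : ι) :
    Measurable fun x => inner ℝ (X k) (f x) :=
  ((continuous_const.inner continuous_id).comp_stronglyMeasurable
    (Lp.stronglyMeasurable f)).measurable

theorem memLp_component (f : Conn V) (k : ι) :
    MemLp (fun x => ((inner ℝ (X k) (f x) : ℝ) : ℂ)) 2 unitVol :=
  ((Lp.memLp f).const_inner (X k)).ofReal

variable [FiniteDimensional ℝ V]

theorem measurable_elemKernel {n d : ℕ} (F : Frame V d) (c : (Fin n → Fin d) → ℂ)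
    (k : Fin n → ι) : Measurable (elemKernel X F c k) := by
  unfold elemKernel
  refine Finset.measurable_fun_sum _ fun α _ => Measurable.const_mul ?_ _
  refine Finset.measurable_fun_prod _ fun i _ => Complex.measurable_ofReal.comp ?_
  exact (measurable_component X _ _).comp (measurable_pi_apply i)

theorem memLp_elemKernel {n d : ℕ} (F : Frame V d) (c : (Fin n → Fin d) → ℂ) (k : Fin n → ι) :
    MemLp (elemKernel X F c k) 2 (Measure.pi fun _ : Fin n => unitVol) := by
  unfold elemKernel
  refine memLp_finsetSum _ fun α _ => MemLp.const_mul ?_ _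
  exact memLp_two_prod (μ := fun _ : Fin n => unitVol)
    (f := fun i x => ((inner ℝ (X (k i)) (F.e (α i) x) : ℝ) : ℂ))
    fun i => memLp_component X _ _

/-- Passing to a finer frame transforms the coefficient tensor linearly. -/
theorem elemKernel_refine {n d m : ℕ} (F : Frame V d) (G : Frame V m)
    (h : ∀ j, F.e j ∈ Submodule.span ℝ (Set.range G.e)) (c : (Fin n → Fin d) → ℂ)
    (k : Fin n → ι) :
    elemKernel X F c k =ᵐ[simplexVol n] elemKernel X G
      (fun β => ∑ α, c α * ∏ i, ((inner ℝ (F.e (α i)) (G.e (β i)) : ℝ) : ℂ)) k := by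
  have hj : ∀ j, ∀ᵐ x ∂unitVol, F.e j x = ∑ l, inner ℝ (F.e j) (G.e l) • G.e l x := by
    intro j
    have h1 := Lp.coeFn_finsetSum (μ := unitVol) (p := 2) Finset.univ
      fun l => inner ℝ (F.e j) (G.e l) • G.e l
    have h2 : ∀ᵐ x ∂unitVol, ∀ l, (inner ℝ (F.e j) (G.e l) • G.e l : Conn V) x
        = inner ℝ (F.e j) (G.e l) • G.e l x :=
      ae_all_iff.2 fun l => Lp.coeFn_smul _ _
    rw [← F.e_eq_sum G h j] at h1
    filter_upwards [h1, h2] with x hx1 hx2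
    rw [hx1]
    simp [hx2]
  filter_upwards [ae_simplex_of_ae_unitVol (ae_all_iff.2 hj)] with τ hτ
  simp only [elemKernel, Finset.sum_mul]
  rw [Finset.sum_comm]
  refine Finset.sum_congr rfl fun α _ => ?_
  simp only [hτ, inner_sum, real_inner_smul_right, Complex.ofReal_sum, Complex.ofReal_mul]
  rw [Finset.prod_univ_sum, Fintype.piFinset_univ, Finset.mul_sum]
  refine Finset.sum_congr rfl fun β _ => ?_
  rw [Finset.prod_mul_distrib, mul_assoc]

theorem symmetric_refine {n d m : ℕ} {c : (Fin n → Fin d) → ℂ}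
    (hc : ∀ (π : Equiv.Perm (Fin n)) α, c (α ∘ π) = c α) (R : Fin d → Fin m → ℂ)
    (π : Equiv.Perm (Fin n)) (β : Fin n → Fin m) :
    ∑ α, c α * ∏ i, R (α i) ((β ∘ π) i) = ∑ α, c α * ∏ i, R (α i) (β i) := by
  rw [← (π.arrowCongr (Equiv.refl (Fin d))).sum_comp fun α => c α * ∏ i, R (α i) (β i)]
  refine Finset.sum_congr rfl fun α _ => ?_
  have h1 : (π.arrowCongr (Equiv.refl (Fin d))) α = α ∘ π.symm := rfl
  rw [h1, hc]
  congr 1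
  rw [← Equiv.prod_comp π fun i => R ((α ∘ π.symm) i) (β i)]
  simp

/-- Simultaneous permutation of times and tensor indices leaves a symmetric elementary kernel
unchanged. -/
theorem elemKernel_comp_perm {n d : ℕ} (F : Frame V d) {c : (Fin n → Fin d) → ℂ}
    (hc : ∀ (π : Equiv.Perm (Fin n)) α, c (α ∘ π) = c α) (k : Fin n → ι)
    (π : Equiv.Perm (Fin n)) (τ : Fin n → ℝ) :
    elemKernel X F c (k ∘ π) (τ ∘ π) = elemKernel X F c k τ := by
  rw [elemKernel, elemKernel, ← (π.arrowCongr (Equiv.refl (Fin d))).sum_comp fun α =>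
    c α * ∏ i, ((inner ℝ (X (k i)) (F.e (α i) (τ i)) : ℝ) : ℂ)]
  refine Finset.sum_congr rfl fun α _ => ?_
  have h1 : (π.arrowCongr (Equiv.refl (Fin d))) α = α ∘ π.symm := rfl
  rw [h1, hc, ← Equiv.prod_comp π fun i =>
    ((inner ℝ (X (k i)) (F.e ((α ∘ π.symm) i) (τ i)) : ℝ) : ℂ)]
  simp

/-- Products of orthonormal functions are orthonormal in `L²([0,1]^n; V^{⊗n})`. -/
theorem sum_integral_norm_sq_elemKernel {n d : ℕ} (F : Frame V d) (c : (Fin n → Fin d) → ℂ) :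
    ∑ k, ∫ τ, ‖elemKernel X F c k τ‖ ^ 2 ∂(Measure.pi fun _ : Fin n => unitVol)
      = ∑ α, ‖c α‖ ^ 2 := by
  classical
  set g : ι → Fin d → ℝ → ℂ := fun κ j x => ((inner ℝ (X κ) (F.e j x) : ℝ) : ℂ) with hg
  have hgL : ∀ κ j, MemLp (g κ j) 2 unitVol := fun κ j => memLp_component X _ _
  have hgg : ∀ κ j j', Integrable (fun x => g κ j x * g κ j' x) unitVol :=
    fun κ j j' => (hgL κ j).integrable_mul (hgL κ j')
  have hpt : ∀ k τ, ((‖elemKernel X F c k τ‖ ^ 2 : ℝ) : ℂ)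
      = ∑ α, ∑ β, ((starRingEnd ℂ) (c α) * c β)
        * ∏ i, (g (k i) (α i) (τ i) * g (k i) (β i) (τ i)) := by
    intro k τ
    rw [Complex.ofReal_pow, ← Complex.conj_mul', elemKernel, map_sum, Finset.sum_mul_sum]
    refine Finset.sum_congr rfl fun α _ => Finset.sum_congr rfl fun β _ => ?_
    rw [map_mul, map_prod, Finset.prod_mul_distrib]
    simp only [Complex.conj_ofReal, hg]
    ring
  have hprod : ∀ (k : Fin n → ι) (α β : Fin n → Fin d), Integrable (fun τ : Fin n → ℝ =>
      ∏ i, (g (k i) (α i) (τ i) * g (k i) (β i) (τ i))) (Measure.pi fun _ => unitVol) :=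
    fun k α β => Integrable.fintype_prod
      (f := fun i x => g (k i) (α i) x * g (k i) (β i) x) fun i => hgg _ _ _
  have hint : ∀ k, ∫ τ, ((‖elemKernel X F c k τ‖ ^ 2 : ℝ) : ℂ) ∂(Measure.pi fun _ => unitVol)
      = ∑ α, ∑ β, ((starRingEnd ℂ) (c α) * c β)
        * ∏ i, ∫ x, g (k i) (α i) x * g (k i) (β i) x ∂unitVol := by
    intro k
    simp_rw [hpt]
    rw [integral_finsetSum _ fun α _ => integrable_finsetSum _ fun β _ =>
      (hprod k α β).const_mul _]
    refine Finset.sum_congr rfl fun α _ => ?_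
    rw [integral_finsetSum _ fun β _ => (hprod k α β).const_mul _]
    refine Finset.sum_congr rfl fun β _ => ?_
    rw [integral_const_mul, integral_fintype_prod_eq_prod
      (fun i x => g (k i) (α i) x * g (k i) (β i) x)]
  -- the sum over the basis of `V` turns products of components into inner products in `V`
  have hone : ∀ j j', ∑ κ, ∫ x, g κ j x * g κ j' x ∂unitVol = if j = j' then 1 else 0 := by
    intro j j'
    rw [← integral_finsetSum _ fun κ _ => hgg κ j j']
    have h1 : ∀ x, ∑ κ, g κ j x * g κ j' x = ((inner ℝ (F.e j x) (F.e j' x) : ℝ) : ℂ) := by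
      intro x
      rw [← X.sum_inner_mul_inner (F.e j x) (F.e j' x), Complex.ofReal_sum]
      refine Finset.sum_congr rfl fun κ _ => ?_
      rw [real_inner_comm (X κ) (F.e j x), Complex.ofReal_mul]
    simp_rw [h1]
    have h2 := orthonormal_iff_ite.1 F.orthonormal j j'
    rw [L2.inner_def] at h2
    rw [integral_complex_ofReal, h2]
    split_ifs <;> simp
  rw [← Complex.ofReal_inj, Complex.ofReal_sum]
  simp_rw [← integral_complex_ofReal, hint]
  rw [Finset.sum_comm, Complex.ofReal_sum]
  refine Finset.sum_congr rfl fun α _ => ?_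
  rw [Finset.sum_comm]
  simp_rw [← Finset.mul_sum]
  -- the sum over multi-indices factors into one sum per coordinate
  have hfac : ∀ β : Fin n → Fin d,
      ∑ k : Fin n → ι, ∏ i, ∫ x, g (k i) (α i) x * g (k i) (β i) x ∂unitVol
        = if α = β then 1 else 0 := by
    intro β
    have h1 := Finset.prod_univ_sum (fun _ : Fin n => (Finset.univ : Finset ι))
      (fun i κ => ∫ x, g κ (α i) x * g κ (β i) x ∂unitVol)
    rw [Fintype.piFinset_univ] at h1
    rw [← h1]
    simp_rw [hone]
    split_ifs with h
    · subst h; simp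
    · obtain ⟨i, hi⟩ := Function.ne_iff.1 h
      exact Finset.prod_eq_zero (Finset.mem_univ i) (if_neg hi)
  simp_rw [hfac]
  rw [Finset.sum_eq_single α]
  · rw [if_pos rfl, mul_one, Complex.conj_mul', Complex.ofReal_pow]
  · intro β _ hβ
    rw [if_neg (Ne.symm hβ), mul_zero]
  · simp

/-- The `n!` permuted copies of the simplex cover the cube. -/
theorem lintegral_cube_le {n : ℕ} {g : (Fin n → ℝ) → ENNReal}
    (hg : ∀ (π : Equiv.Perm (Fin n)) τ, g (τ ∘ π) = g τ) :
    ∫⁻ τ, g τ ∂(Measure.pi fun _ : Fin n => unitVol)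
      ≤ n.factorial * ∫⁻ τ, g τ ∂simplexVol n := by
  rw [pi_unitVol]
  have hcover : (Set.univ.pi fun _ : Fin n => Set.Icc (0 : ℝ) 1)
      ⊆ ⋃ π : Equiv.Perm (Fin n), (fun τ : Fin n → ℝ => τ ∘ π) ⁻¹' simplex n := by
    intro τ hτ
    exact Set.mem_iUnion.2 ⟨Tuple.sort τ, fun i => hτ _ (Set.mem_univ _), Tuple.monotone_sort τ⟩
  refine (lintegral_mono_set hcover).trans ((lintegral_iUnion_le _ _).trans ?_)
  have hπ : ∀ π : Equiv.Perm (Fin n),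
      ∫⁻ τ in (fun τ : Fin n → ℝ => τ ∘ π) ⁻¹' simplex n, g τ = ∫⁻ τ, g τ ∂simplexVol n := by
    intro π
    have hmp := volume_measurePreserving_piCongrLeft (fun _ : Fin n => ℝ) π.symm
    have hfun : ∀ τ : Fin n → ℝ, MeasurableEquiv.piCongrLeft (fun _ : Fin n => ℝ) π.symm τ
        = τ ∘ π := by
      intro τ
      funext i
      have := MeasurableEquiv.piCongrLeft_apply_apply (β := fun _ : Fin n => ℝ) π.symm τ (π i)
      simpa using this
    have h := hmp.setLIntegral_comp_preimage_emb (MeasurableEquiv.measurableEmbedding _) g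
      (simplex n)
    rw [← h]
    have hset : (fun τ : Fin n → ℝ => τ ∘ π) ⁻¹' simplex n
        = (MeasurableEquiv.piCongrLeft (fun _ : Fin n => ℝ) π.symm) ⁻¹' simplex n := by
      ext τ
      rw [Set.mem_preimage, Set.mem_preimage, hfun]
    rw [hset]
    refine lintegral_congr fun τ => ?_
    rw [hfun, hg]
  simp_rw [hπ]
  rw [tsum_fintype, Finset.sum_const, Finset.card_univ, Fintype.card_perm, Fintype.card_fin,
    nsmul_eq_mul]

theorem norm_sq_eq_integral {α : Type*} [MeasurableSpace α] {μ : Measure α} (f : Lp ℂ 2 μ) :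
    ‖f‖ ^ 2 = ∫ x, ‖f x‖ ^ 2 ∂μ := by
  have h := @inner_self_eq_norm_sq_to_K ℂ _ _ _ _ f
  rw [L2.inner_def] at h
  simp only [inner_self_eq_norm_sq_to_K] at h
  have h2 : ∫ x, ((‖f x‖ : ℂ)) ^ 2 ∂μ = ((∫ x, ‖f x‖ ^ 2 ∂μ : ℝ) : ℂ) := by
    rw [← integral_complex_ofReal]
    simp
  have h3 : ((∫ x, ‖f x‖ ^ 2 ∂μ : ℝ) : ℂ) = ((‖f‖ ^ 2 : ℝ) : ℂ) := by
    rw [← h2]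
    push_cast
    exact h
  exact (Complex.ofReal_inj.1 h3).symm

/-- On elementary kernels the tensor norm is controlled by the norm on the simplex. -/
theorem sum_norm_sq_coeff_le {n d : ℕ} (F : Frame V d) {c : (Fin n → Fin d) → ℂ}
    (hc : ∀ (π : Equiv.Perm (Fin n)) α, c (α ∘ π) = c α) {H : Kernel ι n}
    (hH : ∀ k, (H k : (Fin n → ℝ) → ℂ) =ᵐ[simplexVol n] elemKernel X F c k) :
    ∑ α, ‖c α‖ ^ 2 ≤ n.factorial * ∑ k, ‖H k‖ ^ 2 := by
  have hint : ∀ k, Integrable (fun τ => ‖elemKernel X F c k τ‖ ^ 2)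
      (Measure.pi fun _ : Fin n => unitVol) := fun k =>
    (memLp_two_iff_integrable_sq_norm (memLp_elemKernel X F c k).1).1 (memLp_elemKernel X F c k)
  have hintS : ∀ k, Integrable (fun τ => ‖elemKernel X F c k τ‖ ^ 2) (simplexVol n) :=
    fun k => (hint k).mono_measure (simplexVol_le n)
  have hHk : ∀ k, ‖H k‖ ^ 2 = ∫ τ, ‖elemKernel X F c k τ‖ ^ 2 ∂simplexVol n := by
    intro k
    rw [norm_sq_eq_integral]
    refine integral_congr_ae ?_
    filter_upwards [hH k] with τ hτ
    rw [hτ]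
  simp_rw [hHk]
  rw [← sum_integral_norm_sq_elemKernel X F c, ← integral_finsetSum _ fun k _ => hint k,
    ← integral_finsetSum _ fun k _ => hintS k]
  have hnn : ∀ τ, 0 ≤ ∑ k, ‖elemKernel X F c k τ‖ ^ 2 := fun τ =>
    Finset.sum_nonneg fun k _ => by positivity
  have hmeas : Measurable fun τ => ∑ k, ‖elemKernel X F c k τ‖ ^ 2 :=
    Finset.measurable_fun_sum _ fun k _ => (measurable_elemKernel X F c k).norm.pow_const 2
  rw [integral_eq_lintegral_of_nonneg_ae (.of_forall hnn) hmeas.aestronglyMeasurable,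
    integral_eq_lintegral_of_nonneg_ae (.of_forall hnn) hmeas.aestronglyMeasurable]
  have hfin : ∫⁻ τ, ENNReal.ofReal (∑ k, ‖elemKernel X F c k τ‖ ^ 2) ∂simplexVol n ≠ ⊤ :=
    (integrable_finsetSum _ fun k _ => hintS k).lintegral_lt_top.ne
  -- only the sum over all `k` is invariant under permutations of the times
  have hsym : ∀ (π : Equiv.Perm (Fin n)) (τ : Fin n → ℝ),
      ENNReal.ofReal (∑ k, ‖elemKernel X F c k (τ ∘ π)‖ ^ 2)
        = ENNReal.ofReal (∑ k, ‖elemKernel X F c k τ‖ ^ 2) := by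
    intro π τ
    congr 1
    rw [← (π.symm.arrowCongr (Equiv.refl ι)).sum_comp fun k => ‖elemKernel X F c k (τ ∘ π)‖ ^ 2]
    refine Finset.sum_congr rfl fun k _ => ?_
    have h1 : (π.symm.arrowCongr (Equiv.refl ι)) k = k ∘ π := rfl
    rw [h1, elemKernel_comp_perm X F hc]
  have h := ENNReal.toReal_mono (ENNReal.mul_ne_top (ENNReal.natCast_ne_top _) hfin)
    (lintegral_cube_le hsym)
  rwa [ENNReal.toReal_mul, ENNReal.toReal_natCast] at h

end Kernels

/-! ### Density of elementary kernels -/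

section Density

/-- The points `a`, `b` bound consecutive subintervals `(a i, b i]` of `[0,1]`, so that the box
`∏ (a i, b i]` lies in the simplex. -/
structure IsOrderedBox {n : ℕ} (a b : Fin n → ℝ) : Prop where
  nonneg : ∀ i, 0 ≤ a i
  lt : ∀ i, a i < b i
  le_one : ∀ i, b i ≤ 1
  le : ∀ i j, i < j → b i ≤ a j

/-- The half-open box `∏ (a i, b i]`. -/
abbrev box {n : ℕ} (a b : Fin n → ℝ) : Set (Fin n → ℝ) :=
  Set.univ.pi fun i => Set.Ioc (a i) (b i)

theorem measurableSet_box {n : ℕ} (a b : Fin n → ℝ) : MeasurableSet (box a b) :=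
  MeasurableSet.univ_pi fun _ => measurableSet_Ioc

instance isFiniteMeasure_simplexVol (n : ℕ) : IsFiniteMeasure (simplexVol n) :=
  isFiniteMeasure_of_le _ (simplexVol_le n)

theorem generateFrom_lowerBoxes (n : ℕ) : (MeasurableSpace.pi : MeasurableSpace (Fin n → ℝ))
    = MeasurableSpace.generateFrom (Set.univ.pi '' Set.univ.pi fun _ : Fin n =>
      Set.range (Set.Iic : ℝ → Set ℝ)) := by
  have hc : IsCountablySpanning (Set.range (Set.Iic : ℝ → Set ℝ)) := by
    refine ⟨fun m : ℕ => Set.Iic (m : ℝ), fun m => ⟨m, rfl⟩, ?_⟩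
    refine Set.eq_univ_of_forall fun x => ?_
    obtain ⟨m, hm⟩ := exists_nat_ge x
    exact Set.mem_iUnion.2 ⟨m, hm⟩
  rw [← generateFrom_pi_eq fun _ => hc]
  congr 1
  funext i
  rw [← borel_eq_generateFrom_Iic ℝ]
  exact (BorelSpace.measurable_eq (α := ℝ))

/-- A function on the simplex whose integrals over all ordered boxes vanish is zero on every
ordered box. -/
theorem ae_eq_zero_on_box {n : ℕ} {f : (Fin n → ℝ) → ℂ} (hf : Integrable f (simplexVol n))
    (h : ∀ a b : Fin n → ℝ, IsOrderedBox a b → ∫ τ in box a b, f τ ∂simplexVol n = 0)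
    {a b : Fin n → ℝ} (hab : IsOrderedBox a b) :
    ∀ᵐ τ ∂simplexVol n, τ ∈ box a b → f τ = 0 := by
  rw [← ae_restrict_iff' (measurableSet_box a b)]
  refine ae_eq_zero_of_setIntegral_piSystem hf.restrict
    (C := Set.univ.pi '' Set.univ.pi fun _ : Fin n => Set.range (Set.Iic : ℝ → Set ℝ))
    (IsPiSystem.pi fun _ => ?_) (generateFrom_lowerBoxes n) ?_ (h a b hab)
  · rintro _ ⟨x, rfl⟩ _ ⟨y, rfl⟩ _
    exact ⟨min x y, by rw [Set.Iic_inter_Iic]⟩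
  · rintro _ ⟨S, hS, rfl⟩
    choose y hy using fun i => hS i (Set.mem_univ i)
    have hSm : MeasurableSet (Set.univ.pi S) := MeasurableSet.univ_pi fun i => by
      rw [← hy i]; exact measurableSet_Iic
    have hinter : Set.univ.pi S ∩ box a b = box a fun i => min (b i) (y i) := by
      ext τ
      simp only [Set.mem_inter_iff, Set.mem_pi, Set.mem_univ, true_imp_iff, ← hy, Set.mem_Iic,
        Set.mem_Ioc, le_min_iff]
      exact ⟨fun h i => ⟨(h.2 i).1, (h.2 i).2, h.1 i⟩,
        fun h => ⟨fun i => (h i).2.2, fun i => ⟨(h i).1, (h i).2.1⟩⟩⟩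
    rw [Measure.restrict_restrict hSm, hinter]
    by_cases hlt : ∀ i, a i < min (b i) (y i)
    · exact h _ _ ⟨hab.nonneg, hlt, fun i => (min_le_left _ _).trans (hab.le_one i),
        fun i j hij => (min_le_left _ _).trans (hab.le i j hij)⟩
    · push Not at hlt
      obtain ⟨i, hi⟩ := hlt
      have hempty : box a (fun i => min (b i) (y i)) = ∅ := by
        refine Set.univ_pi_eq_empty (i := i) ?_
        exact Set.Ioc_eq_empty (not_lt.2 hi)
      rw [hempty, Measure.restrict_empty, integral_zero_measure]

/-- The hyperplanes `τ i = 0` and `τ i = τ j` are null. -/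
theorem ae_simplex_pos_strictMono (n : ℕ) :
    ∀ᵐ τ ∂simplexVol n, (∀ i, 0 < τ i) ∧ StrictMono τ := by
  have hmem : ∀ᵐ τ ∂simplexVol n, τ ∈ simplex n := ae_restrict_mem (measurableSet_simplex n)
  have hnull : ∀ L : (Fin n → ℝ) →ₗ[ℝ] ℝ, L ≠ 0 → ∀ᵐ τ ∂simplexVol n, L τ ≠ 0 := by
    intro L hL
    have h := Measure.addHaar_submodule (volume : Measure (Fin n → ℝ)) (LinearMap.ker L)
      (fun htop => hL (LinearMap.ker_eq_top.1 htop))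
    have hvol : ∀ᵐ τ ∂(volume : Measure (Fin n → ℝ)), L τ ≠ 0 := by
      rw [ae_iff]
      convert h using 2
      ext τ
      simp
    exact ae_mono Measure.restrict_le_self hvol
  have h0 : ∀ᵐ τ ∂simplexVol n, ∀ i, τ i ≠ 0 := by
    refine ae_all_iff.2 fun i => hnull (LinearMap.proj i) fun h => ?_
    have := LinearMap.congr_fun h (Pi.single i 1)
    simp at this
  have hne : ∀ᵐ τ ∂simplexVol n, ∀ i j, i ≠ j → τ i ≠ τ j := by
    refine ae_all_iff.2 fun i => ae_all_iff.2 fun j => ?_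
    by_cases hij : i = j
    · exact .of_forall fun τ h => absurd hij h
    · have h1 := hnull ((LinearMap.proj i : (Fin n → ℝ) →ₗ[ℝ] ℝ) - LinearMap.proj j)
        fun h => by
          have := LinearMap.congr_fun h (Pi.single i 1)
          rw [LinearMap.sub_apply, LinearMap.proj_apply, LinearMap.proj_apply, Pi.single_eq_same,
            Pi.single_eq_of_ne (Ne.symm hij)] at this
          simp at this
      filter_upwards [h1] with τ hτ _ heq
      refine hτ ?_
      rw [LinearMap.sub_apply, LinearMap.proj_apply, LinearMap.proj_apply, heq, sub_self]
  filter_upwards [hmem, h0, hne] with τ h1 h2 h3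
  refine ⟨fun i => lt_of_le_of_ne (h1.1 i).1 (Ne.symm (h2 i)), fun i j hij => ?_⟩
  exact lt_of_le_of_ne (h1.2 hij.le) (h3 i j hij.ne)

/-- The ordered grid boxes cover the interior of the simplex: a mesh finer than all gaps
separates the coordinates. -/
theorem exists_grid_box {n : ℕ} {τ : Fin n → ℝ} (h0 : ∀ i, 0 < τ i) (h1 : ∀ i, τ i ≤ 1)
    (hτ : StrictMono τ) : ∃ (N : ℕ) (m : Fin n → ℕ),
      IsOrderedBox (fun i => (m i : ℝ) / N) (fun i => ((m i : ℝ) + 1) / N) ∧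
      τ ∈ box (fun i => (m i : ℝ) / N) (fun i => ((m i : ℝ) + 1) / N) := by
  have hev : ∀ᶠ N : ℕ in Filter.atTop, 0 < N ∧ ∀ i j, i < j → 1 ≤ (τ j - τ i) * N := by
    refine (Filter.eventually_gt_atTop 0).and ?_
    refine Filter.eventually_all.2 fun i => Filter.eventually_all.2 fun j => ?_
    by_cases hij : i < j
    · have ht : Filter.Tendsto (fun N : ℕ => (τ j - τ i) * N) Filter.atTop Filter.atTop :=
        tendsto_natCast_atTop_atTop.const_mul_atTop (sub_pos.2 (hτ hij))
      filter_upwards [ht.eventually_ge_atTop 1] with N hN _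
      exact hN
    · exact .of_forall fun N h => absurd h hij
  obtain ⟨N, hN, hgap⟩ := hev.exists
  have hN' : (0 : ℝ) < N := by exact_mod_cast hN
  have hc : ∀ i, ((⌈τ i * N⌉₊ - 1 : ℕ) : ℝ) + 1 = (⌈τ i * N⌉₊ : ℝ) := by
    intro i
    have : 0 < ⌈τ i * N⌉₊ := Nat.ceil_pos.2 (mul_pos (h0 i) hN')
    have h2 : ⌈τ i * N⌉₊ - 1 + 1 = ⌈τ i * N⌉₊ := by omega
    exact_mod_cast h2
  refine ⟨N, fun i => ⌈τ i * N⌉₊ - 1, ⟨fun i => by positivity, fun i => ?_, fun i => ?_,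
    fun i j hij => ?_⟩, fun i _ => ⟨?_, ?_⟩⟩
  · exact div_lt_div_of_pos_right (lt_add_one _) hN'
  · rw [hc, div_le_one hN', Nat.cast_le, Nat.ceil_le]
    exact (mul_le_mul_of_nonneg_right (h1 i) hN'.le).trans (one_mul _).le
  · refine div_le_div_of_nonneg_right ?_ hN'.le
    rw [hc]
    have h2 : ⌈τ i * N⌉₊ + 1 ≤ ⌈τ j * N⌉₊ := by
      rw [← Nat.ceil_add_one (by have := h0 i; positivity)]
      exact Nat.ceil_mono (by linarith [hgap i j hij])
    have h3 : ⌈τ i * N⌉₊ ≤ ⌈τ j * N⌉₊ - 1 := by omega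
    exact_mod_cast h3
  · rw [div_lt_iff₀ hN']
    have := Nat.ceil_lt_add_one (a := τ i * N) (by have := h0 i; positivity)
    linarith [hc i]
  · dsimp only
    rw [hc, le_div_iff₀ hN']
    exact Nat.le_ceil _

/-- A function on the simplex whose integrals over all ordered boxes vanish is zero. -/
theorem ae_eq_zero_of_orderedBox {n : ℕ} {f : (Fin n → ℝ) → ℂ} (hf : Integrable f (simplexVol n))
    (h : ∀ a b : Fin n → ℝ, IsOrderedBox a b → ∫ τ in box a b, f τ ∂simplexVol n = 0) :
    f =ᵐ[simplexVol n] 0 := by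
  have hmem : ∀ᵐ τ ∂simplexVol n, τ ∈ simplex n := ae_restrict_mem (measurableSet_simplex n)
  have hgrid : ∀ᵐ τ ∂simplexVol n, ∀ p : ℕ × (Fin n → ℕ),
      IsOrderedBox (fun i => (p.2 i : ℝ) / p.1) (fun i => ((p.2 i : ℝ) + 1) / p.1) →
      τ ∈ box (fun i => (p.2 i : ℝ) / p.1) (fun i => ((p.2 i : ℝ) + 1) / p.1) → f τ = 0 := by
    refine ae_all_iff.2 fun p => ?_
    by_cases hp : IsOrderedBox (fun i => (p.2 i : ℝ) / p.1) (fun i => ((p.2 i : ℝ) + 1) / p.1)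
    · filter_upwards [ae_eq_zero_on_box hf h hp] with τ hτ _
      exact hτ
    · exact .of_forall fun τ h => absurd h hp
  filter_upwards [hmem, ae_simplex_pos_strictMono n, hgrid] with τ h1 h2 h3
  obtain ⟨N, m, hbox, hτ⟩ := exists_grid_box h2.1 (fun i => (h1.1 i).2) h2.2
  exact h3 (N, m) hbox hτ

variable {V : Type*} [NormedAddCommGroup V] [InnerProductSpace ℝ V] [FiniteDimensional ℝ V]
  {ι : Type*} [Fintype ι] (X : OrthonormalBasis ι ℝ V)

theorem unitVol_Ioc {a b : ℝ} (ha : 0 ≤ a) (hb : b ≤ 1) :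
    unitVol (Set.Ioc a b) = ENNReal.ofReal (b - a) := by
  rw [unitVol, Measure.restrict_apply measurableSet_Ioc, Set.inter_eq_left.2, Real.volume_Ioc]
  exact fun x hx => ⟨ha.trans hx.1.le, hx.2.trans hb⟩

/-- The functional `A ↦ ⟨v, a(y) - a(x)⟩`. -/
def increment (v : V) (x y : unitInterval) : StrongDual ℝ (GenConn V) :=
  (innerSL ℝ v).comp
    (((ContinuousMap.evalCLM ℝ y : C(unitInterval, V) →L[ℝ] V)
      - ContinuousMap.evalCLM ℝ x).comp (pathSpace V).subtypeL)

theorem increment_incl (v : V) {x y : unitInterval} (hxy : x ≤ y) (f : Conn V) :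
    increment v x y (incl f) = inner ℝ (indicatorConstLp 2 (measurableSet_Ioc
      (a := (x : ℝ)) (b := (y : ℝ))) (measure_ne_top unitVol _) v) f := by
  have : CompleteSpace V := FiniteDimensional.complete ℝ V
  rw [L2.inner_indicatorConstLp_eq_inner_setIntegral]
  change inner ℝ v ((∫ u in (0 : ℝ)..(y : ℝ), f u ∂unitVol)
    - ∫ u in (0 : ℝ)..(x : ℝ), f u ∂unitVol) = _
  rw [intervalIntegral.integral_interval_sub_left (integrable_conn f).intervalIntegrable
    (integrable_conn f).intervalIntegrable, intervalIntegral.integral_of_le hxy]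

/-- The frame of normalized indicators of consecutive intervals, with values in the basis
vectors `X (k i)`. -/
def boxFrame {n : ℕ} {a b : Fin n → ℝ} (h : IsOrderedBox a b) (k : Fin n → ι) : Frame V n where
  e i := indicatorConstLp 2 (measurableSet_Ioc (a := a i) (b := b i)) (measure_ne_top unitVol _)
    ((Real.sqrt (b i - a i))⁻¹ • X (k i))
  orthonormal := by
    classical
    have : CompleteSpace V := FiniteDimensional.complete ℝ V
    rw [orthonormal_iff_ite]
    intro i j
    rw [L2.inner_indicatorConstLp_indicatorConstLp]
    rcases eq_or_ne i j with rfl | hij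
    · have hpos : 0 < b i - a i := sub_pos.2 (h.lt i)
      rw [if_pos rfl, Set.inter_self, Measure.real, unitVol_Ioc (h.nonneg i) (h.le_one i),
        ENNReal.toReal_ofReal hpos.le, real_inner_smul_left, real_inner_smul_right,
        real_inner_self_eq_norm_sq, X.norm_eq_one, ← mul_assoc, ← mul_inv,
        Real.mul_self_sqrt hpos.le]
      simp [hpos.ne']
    · have hdisj : Set.Ioc (a i) (b i) ∩ Set.Ioc (a j) (b j) = ∅ := by
        rw [← Set.disjoint_iff_inter_eq_empty, Set.Ioc_disjoint_Ioc]
        rcases lt_or_gt_of_ne hij with hlt | hlt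
        · exact (min_le_left _ _).trans ((h.le i j hlt).trans (le_max_right _ _))
        · exact (min_le_right _ _).trans ((h.le j i hlt).trans (le_max_left _ _))
      rw [if_neg hij, hdisj, measureReal_empty]
      simp
  ext i := increment ((Real.sqrt (b i - a i))⁻¹ • X (k i))
    ⟨a i, h.nonneg i, (h.lt i).le.trans (h.le_one i)⟩
    ⟨b i, (h.nonneg i).trans (h.lt i).le, h.le_one i⟩
  ext_incl i f := increment_incl _ (h.lt i).le f

theorem boxFrame_ae {n : ℕ} {a b : Fin n → ℝ} (h : IsOrderedBox a b) (k : Fin n → ι) :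
    ∀ᵐ τ ∂simplexVol n, ∀ i j, (boxFrame X h k).e j (τ i)
      = (Set.Ioc (a j) (b j)).indicator (fun _ => (Real.sqrt (b j - a j))⁻¹ • X (k j)) (τ i) := by
  have h1 : ∀ᵐ x ∂unitVol, ∀ j, (boxFrame X h k).e j x
      = (Set.Ioc (a j) (b j)).indicator (fun _ => (Real.sqrt (b j - a j))⁻¹ • X (k j)) x :=
    ae_all_iff.2 fun j => indicatorConstLp_coeFn (hs := measurableSet_Ioc)
      (hμs := measure_ne_top unitVol _)
  exact ae_simplex_of_ae_unitVol h1

/-- The coefficients of the symmetrization of a simple tensor. -/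
def permCoeff (n : ℕ) (α : Fin n → Fin n) : ℂ :=
  open Classical in if Function.Bijective α then 1 else 0

theorem permCoeff_comp {n : ℕ} (π : Equiv.Perm (Fin n)) (α : Fin n → Fin n) :
    permCoeff n (α ∘ π) = permCoeff n α := by
  simp only [permCoeff, EquivLike.bijective_comp]

/-- On the simplex only the identity term of the symmetrization of the indicator of an ordered box
survives. -/
theorem elemKernel_boxFrame [DecidableEq ι] {n : ℕ} {a b : Fin n → ℝ} (h : IsOrderedBox a b)
    (k k' : Fin n → ι) :
    elemKernel X (boxFrame X h k) (permCoeff n) k' =ᵐ[simplexVol n]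
      if k' = k then (box a b).indicator fun _ => ∏ i, (((Real.sqrt (b i - a i))⁻¹ : ℝ) : ℂ)
      else 0 := by
  have hmem : ∀ᵐ τ ∂simplexVol n, τ ∈ simplex n := ae_restrict_mem (measurableSet_simplex n)
  filter_upwards [hmem, boxFrame_ae X h k] with τ hτ he
  have hzero : ∀ α : Fin n → Fin n, (∃ i, τ i ∉ Set.Ioc (a (α i)) (b (α i))) →
      ∏ i, ((inner ℝ (X (k' i)) ((boxFrame X h k).e (α i) (τ i)) : ℝ) : ℂ) = 0 := by
    rintro α ⟨i, hi⟩
    refine Finset.prod_eq_zero (Finset.mem_univ i) ?_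
    rw [he, Set.indicator_of_notMem hi, inner_zero_right, Complex.ofReal_zero]
  rw [elemKernel, Finset.sum_eq_single id]
  · rw [permCoeff, if_pos Function.bijective_id, one_mul]
    by_cases hbox : τ ∈ box a b
    · have hin : ∀ i, τ i ∈ Set.Ioc (a i) (b i) := fun i => hbox i (Set.mem_univ i)
      have hterm : ∀ i, ((inner ℝ (X (k' i)) ((boxFrame X h k).e (id i) (τ i)) : ℝ) : ℂ)
          = (((Real.sqrt (b i - a i))⁻¹ : ℝ) : ℂ) * if k' i = k i then 1 else 0 := by
        intro i
        rw [id, he, Set.indicator_of_mem (hin i), real_inner_smul_right,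
          orthonormal_iff_ite.1 X.orthonormal, Complex.ofReal_mul]
        congr 1
        split_ifs <;> simp
      simp_rw [hterm]
      rw [Finset.prod_mul_distrib]
      split_ifs with hk
      · subst hk
        simp [Set.indicator_of_mem hbox]
      · obtain ⟨i, hi⟩ := Function.ne_iff.1 hk
        rw [Finset.prod_eq_zero (f := fun i => if k' i = k i then (1 : ℂ) else 0)
          (Finset.mem_univ i) (if_neg hi), mul_zero]
        rfl
    · rw [hzero id (by simpa [Set.mem_pi] using hbox)]
      split_ifs
      · rw [Set.indicator_of_notMem hbox]
      · rfl
  · intro α _ hα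
    by_cases hbij : Function.Bijective α
    · rw [hzero α, mul_zero]
      -- a bijection of `Fin n` compatible with the order of the intervals is the identity
      by_contra hcon
      push Not at hcon
      refine hα ?_
      have hmono : Monotone α := by
        intro i j hij
        by_contra hlt
        rw [not_le] at hlt
        have h1 := (hcon j).2
        have h2 := (hcon i).1
        have h3 := h.le _ _ hlt
        have h4 := hτ.2 hij
        linarith
      have hstrict := hmono.strictMono_of_injective hbij.1
      have hiso := Subsingleton.elim (StrictMono.orderIsoOfSurjective α hstrict hbij.2)
        (OrderIso.refl _)
      exact congrArg (fun f : Fin n ≃o Fin n => (f : Fin n → Fin n)) hiso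
    · rw [permCoeff, if_neg hbij, zero_mul]
  · intro hid
    exact absurd (Finset.mem_univ _) hid

/-- The symmetric elementary kernels. -/
def elementary (n : ℕ) : Set (Kernel ι n) :=
  {H | ∃ (d : ℕ) (F : Frame V d) (c : (Fin n → Fin d) → ℂ),
    (∀ (π : Equiv.Perm (Fin n)) (α : Fin n → Fin d), c (α ∘ π) = c α) ∧
    ∀ k, (H k : (Fin n → ℝ) → ℂ) =ᵐ[simplexVol n] elemKernel X F c k}

theorem dense_span_elementary (n : ℕ) :
    (Submodule.span ℂ (elementary X n)).topologicalClosure = ⊤ := by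
  classical
  -- `D` is shown to contain all kernels with a single nonzero component
  set D := (Submodule.span ℂ (elementary X n)).topologicalClosure with hD
  have hDc : IsClosed (D : Set (Kernel ι n)) := Submodule.isClosed_topologicalClosure _
  have hsingle : ∀ (k : Fin n → ι) (f : Lp ℂ 2 (simplexVol n)),
      (Pi.single k f : Kernel ι n) ∈ D := by
    intro k
    set L := ContinuousLinearMap.single ℂ (fun _ : Fin n → ι => Lp ℂ 2 (simplexVol n)) k with hL
    -- the functions `f` for which the kernel with component `k` equal to `f` and all others zero
    -- lies in `D`
    set N : Submodule ℂ (Lp ℂ 2 (simplexVol n)) := D.comap L.toLinearMap with hN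
    have hNc : IsClosed (N : Set (Lp ℂ 2 (simplexVol n))) := hDc.preimage L.continuous
    have hbox : ∀ a b : Fin n → ℝ, IsOrderedBox a b →
        indicatorConstLp 2 (measurableSet_box a b) (measure_ne_top (simplexVol n) _) (1 : ℂ) ∈ N := by
      intro a b hab
      set r : ℂ := ∏ i, (((Real.sqrt (b i - a i))⁻¹ : ℝ) : ℂ) with hr
      have hr0 : r ≠ 0 := by
        refine Finset.prod_ne_zero_iff.2 fun i _ => ?_
        have : 0 < Real.sqrt (b i - a i) := Real.sqrt_pos.2 (sub_pos.2 (hab.lt i))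
        exact_mod_cast (inv_pos.2 this).ne'
      have hmem : indicatorConstLp 2 (measurableSet_box a b)
          (measure_ne_top (simplexVol n) _) r ∈ N := by
        refine Submodule.le_topologicalClosure _ (Submodule.subset_span ?_)
        refine ⟨n, boxFrame X hab k, permCoeff n, permCoeff_comp, fun k' => ?_⟩
        refine Filter.EventuallyEq.trans ?_ (elemKernel_boxFrame X hab k k').symm
        by_cases hk : k' = k
        · subst hk
          rw [if_pos rfl]
          simp only [hL, ContinuousLinearMap.coe_coe, ContinuousLinearMap.single_apply,
            Pi.single_eq_same]
          exact indicatorConstLp_coeFn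
        · rw [if_neg hk]
          simp only [hL, ContinuousLinearMap.coe_coe, ContinuousLinearMap.single_apply,
            Pi.single_eq_of_ne hk]
          exact Lp.coeFn_zero _ _ _
      have h2 := N.smul_mem r⁻¹ hmem
      convert h2 using 1
      refine Lp.ext ?_
      filter_upwards [Lp.coeFn_smul r⁻¹ (indicatorConstLp 2 (measurableSet_box a b)
          (measure_ne_top (simplexVol n) _) r),
        indicatorConstLp_coeFn (p := 2) (hs := measurableSet_box a b)
          (hμs := measure_ne_top (simplexVol n) _) (c := (1 : ℂ)),
        indicatorConstLp_coeFn (p := 2) (hs := measurableSet_box a b)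
          (hμs := measure_ne_top (simplexVol n) _) (c := r)] with τ h3 h4 h5
      rw [h3, h4, Pi.smul_apply, h5]
      by_cases hτ : τ ∈ box a b
      · simp [Set.indicator_of_mem hτ, hr0]
      · simp [Set.indicator_of_notMem hτ]
    have htop : N = ⊤ := by
      rw [← hNc.submodule_topologicalClosure_eq, Submodule.topologicalClosure_eq_top_iff,
        Submodule.eq_bot_iff]
      intro f hf
      rw [Submodule.mem_orthogonal] at hf
      have hint : Integrable f (simplexVol n) := (Lp.memLp f).integrable (by norm_num)
      refine (Lp.eq_zero_iff_ae_eq_zero).2 (ae_eq_zero_of_orderedBox hint fun a b hab => ?_)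
      have h1 := hf _ (hbox a b hab)
      rwa [L2.inner_indicatorConstLp_one] at h1
    intro f
    have : f ∈ N := htop ▸ Submodule.mem_top
    exact this
  refine Submodule.eq_top_iff'.2 fun H => ?_
  rw [← Finset.univ_sum_single H]
  exact Submodule.sum_mem _ fun k _ => hsingle k (H k)

end Density

/-! ### The multiple Wiener integrals -/

section Integrals

variable {V : Type*} [NormedAddCommGroup V] [InnerProductSpace ℝ V] [FiniteDimensional ℝ V]
  {ι : Type*} [Fintype ι] (X : OrthonormalBasis ι ℝ V)

theorem elemKernel_add {n d : ℕ} (F : Frame V d) (c c' : (Fin n → Fin d) → ℂ) (k : Fin n → ι)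
    (τ : Fin n → ℝ) :
    elemKernel X F (c + c') k τ = elemKernel X F c k τ + elemKernel X F c' k τ := by
  simp only [elemKernel, Pi.add_apply, add_mul, Finset.sum_add_distrib]

theorem elemKernel_smul {n d : ℕ} (F : Frame V d) (a : ℂ) (c : (Fin n → Fin d) → ℂ)
    (k : Fin n → ι) (τ : Fin n → ℝ) :
    elemKernel X F (a • c) k τ = a * elemKernel X F c k τ := by
  simp only [elemKernel, Pi.smul_apply, smul_eq_mul, mul_assoc, Finset.mul_sum]

theorem stratPoly_add {n d : ℕ} (c c' : (Fin n → Fin d) → ℂ) :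
    stratPoly (c + c') = stratPoly c + stratPoly c' := by
  simp only [stratPoly, Pi.add_apply, add_smul, Finset.sum_add_distrib, smul_add]

theorem stratPoly_smul {n d : ℕ} (a : ℂ) (c : (Fin n → Fin d) → ℂ) :
    stratPoly (a • c) = a • stratPoly c := by
  simp only [stratPoly, Pi.smul_apply, smul_assoc, ← Finset.smul_sum]
  rw [smul_comm]

/-- The function `A ↦ (e^{-sΔ/2} p)(⟨e, A⟩)`, with `p` the polynomial of the Stratonovich integral
with coefficients `c`. -/
def hermiteFun {n d : ℕ} (s : ℝ) (F : Frame V d) (c : (Fin n → Fin d) → ℂ) (A : GenConn V) : ℂ :=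
  evalR (expNegHalf (realCoeff d s) (stratPoly c)) (F.coord A)

theorem hermiteFun_add {n d : ℕ} (s : ℝ) (F : Frame V d) (c c' : (Fin n → Fin d) → ℂ)
    (A : GenConn V) : hermiteFun s F (c + c') A = hermiteFun s F c A + hermiteFun s F c' A := by
  simp only [hermiteFun, stratPoly_add, expNegHalf_add, evalR, map_add]

theorem hermiteFun_smul {n d : ℕ} (s : ℝ) (F : Frame V d) (a : ℂ) (c : (Fin n → Fin d) → ℂ)
    (A : GenConn V) : hermiteFun s F (a • c) A = a * hermiteFun s F c A := by
  simp only [hermiteFun, stratPoly_smul, expNegHalf_smul, evalR, MvPolynomial.smul_eval]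

/-- The coefficients of an elementary kernel after passing from the frame `F` to a frame `G` whose
span contains that of `F`. -/
def refineCoeff {n d m : ℕ} (F : Frame V d) (G : Frame V m) (c : (Fin n → Fin d) → ℂ)
    (β : Fin n → Fin m) : ℂ :=
  ∑ α, c α * ∏ i, ((inner ℝ (F.e (α i)) (G.e (β i)) : ℝ) : ℂ)

/-- The Hermite function of a tensor does not depend on the frame in which it is written, since
the Laplacian is invariant under orthogonal substitutions. -/
theorem hermiteFun_refine {s : ℝ} (hs : 0 ≤ s) {P : Measure (GenConn V)} (hP : IsWhiteNoise s P)
    {n d m : ℕ} (F : Frame V d) (G : Frame V m)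
    (h : ∀ j, F.e j ∈ Submodule.span ℝ (Set.range G.e)) (c : (Fin n → Fin d) → ℂ) :
    hermiteFun s F c =ᵐ[P] hermiteFun s G (refineCoeff F G c) := by
  filter_upwards [hP.coord_refine hs F G h] with A hA
  rw [hermiteFun, hA, ← evalR_linSubst,
    ← expNegHalf_linSubst (fun i j => F.sum_inner_mul_inner G h i j), linSubst_stratPoly]
  rfl

theorem refineCoeff_comp {n d m : ℕ} (F : Frame V d) (G : Frame V m) {c : (Fin n → Fin d) → ℂ}
    (hc : ∀ (π : Equiv.Perm (Fin n)) (α : Fin n → Fin d), c (α ∘ π) = c α)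
    (π : Equiv.Perm (Fin n)) (β : Fin n → Fin m) :
    refineCoeff F G c (β ∘ π) = refineCoeff F G c β :=
  symmetric_refine hc (fun j l => ((inner ℝ (F.e j) (G.e l) : ℝ) : ℂ)) π β

/-- `H` is the elementary kernel with symmetric coefficients `c` along a frame, and `w` is its
multiple Wiener integral. -/
def IsElementaryPair {n : ℕ} (s : ℝ) {P : Measure (GenConn V)} (H : Kernel ι n) (w : Lp ℂ 2 P) :
    Prop :=
  ∃ (d : ℕ) (F : Frame V d) (c : (Fin n → Fin d) → ℂ),
    (∀ (π : Equiv.Perm (Fin n)) (α : Fin n → Fin d), c (α ∘ π) = c α) ∧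
    (∀ k, (H k : (Fin n → ℝ) → ℂ) =ᵐ[simplexVol n] elemKernel X F c k) ∧
    (w : GenConn V → ℂ) =ᵐ[P] hermiteFun s F c

variable {X}

theorem IsElementaryPair.smul {n : ℕ} {s : ℝ} {P : Measure (GenConn V)} {H : Kernel ι n}
    {w : Lp ℂ 2 P} (h : IsElementaryPair X s H w) (a : ℂ) :
    IsElementaryPair X s (a • H) (a • w) := by
  obtain ⟨d, F, c, hc, hH, hw⟩ := h
  refine ⟨d, F, a • c, fun π α => by simp [hc π α], fun k => ?_, ?_⟩
  · rw [Pi.smul_apply]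
    filter_upwards [Lp.coeFn_smul a (H k), hH k] with τ h1 h2
    rw [elemKernel_smul, ← h2, h1, Pi.smul_apply, smul_eq_mul]
  · filter_upwards [Lp.coeFn_smul a w, hw] with A h1 h2
    rw [hermiteFun_smul, ← h2, h1, Pi.smul_apply, smul_eq_mul]

theorem IsElementaryPair.zero (n : ℕ) (s : ℝ) (P : Measure (GenConn V)) :
    IsElementaryPair X s (0 : Kernel ι n) (0 : Lp ℂ 2 P) := by
  set F : Frame V 0 :=
    ⟨Fin.elim0, ⟨fun i => i.elim0, fun i => i.elim0⟩, Fin.elim0, fun i => i.elim0⟩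
  refine ⟨0, F, (0 : ℂ) • 0, fun _ _ => rfl, fun k => ?_, ?_⟩
  · rw [Pi.zero_apply]
    filter_upwards [Lp.coeFn_zero ℂ 2 (simplexVol n)] with τ hτ
    rw [hτ, elemKernel_smul, zero_mul, Pi.zero_apply]
  · filter_upwards [Lp.coeFn_zero ℂ 2 P] with A hA
    rw [hA, hermiteFun_smul, zero_mul, Pi.zero_apply]

theorem IsElementaryPair.add {n : ℕ} {s : ℝ} (hs : 0 ≤ s) {P : Measure (GenConn V)}
    (hP : IsWhiteNoise s P) {H H' : Kernel ι n} {w w' : Lp ℂ 2 P} (h : IsElementaryPair X s H w)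
    (h' : IsElementaryPair X s H' w') : IsElementaryPair X s (H + H') (w + w') := by
  obtain ⟨d, F, c, hc, hH, hw⟩ := h
  obtain ⟨d', F', c', hc', hH', hw'⟩ := h'
  obtain ⟨m, G, hF, hF'⟩ := exists_common_frame F F'
  refine ⟨m, G, refineCoeff F G c + refineCoeff F' G c', fun π β => ?_, fun k => ?_, ?_⟩
  · rw [Pi.add_apply, Pi.add_apply, refineCoeff_comp F G hc, refineCoeff_comp F' G hc']
  · rw [Pi.add_apply]
    filter_upwards [Lp.coeFn_add (H k) (H' k), hH k, hH' k, elemKernel_refine X F G hF c k,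
      elemKernel_refine X F' G hF' c' k] with τ h1 h2 h3 h4 h5
    rw [h1, Pi.add_apply, h2, h3, elemKernel_add, h4, h5]
    rfl
  · filter_upwards [Lp.coeFn_add w w', hw, hw', hermiteFun_refine hs hP F G hF c,
      hermiteFun_refine hs hP F' G hF' c'] with A h1 h2 h3 h4 h5
    rw [h1, Pi.add_apply, h2, h3, hermiteFun_add, h4, h5]

variable (X)

/-- The graph of the multiple Wiener integral on elementary kernels. -/
def elementaryGraph {s : ℝ} (hs : 0 ≤ s) {P : Measure (GenConn V)} (hP : IsWhiteNoise s P)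
    (n : ℕ) : Submodule ℂ (Kernel ι n × Lp ℂ 2 P) where
  carrier := {x | IsElementaryPair X s x.1 x.2}
  zero_mem' := IsElementaryPair.zero n s P
  smul_mem' a _ h := IsElementaryPair.smul h a
  add_mem' h h' := IsElementaryPair.add hs hP h h'

/-- The multiple Wiener integral is bounded on elementary kernels. The cardinality appears because
`Kernel` carries the supremum norm over the components. -/
theorem norm_le_of_mem_elementaryGraph {s : ℝ} (hs : 0 < s) {P : Measure (GenConn V)}
    (hP : IsWhiteNoise s P) {n : ℕ} {x : Kernel ι n × Lp ℂ 2 P}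
    (hx : x ∈ elementaryGraph X hs.le hP n) :
    ‖x.2‖ ≤ Real.sqrt (s ^ n * Fintype.card (Fin n → ι)) * ‖x.1‖ := by
  obtain ⟨d, F, c, hc, hH, hw⟩ := hx
  have h1 : ‖x.2‖ ^ 2 = s ^ n / n.factorial * ∑ α, ‖c α‖ ^ 2 := by
    rw [norm_sq_eq_integral, ← integral_norm_sq_hermite hs hc,
      ← (hP.measurePreserving_coord hs.le F).map_eq,
      integral_map (hP.measurePreserving_coord hs.le F).measurable.aemeasurable
        (by exact ((continuous_evalR _).norm.pow 2).aestronglyMeasurable)]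
    refine integral_congr_ae ?_
    filter_upwards [hw] with A hA
    rw [hA]
    rfl
  have h2 : ∑ k, ‖x.1 k‖ ^ 2 ≤ Fintype.card (Fin n → ι) * ‖x.1‖ ^ 2 := by
    refine (Finset.sum_le_card_nsmul _ _ (‖x.1‖ ^ 2) fun k _ => ?_).trans ?_
    · exact pow_le_pow_left₀ (norm_nonneg _) (norm_le_pi_norm x.1 k) 2
    · rw [nsmul_eq_mul, Finset.card_univ]
  have hfac : (0 : ℝ) < n.factorial := by exact_mod_cast n.factorial_pos
  have hsn : 0 < s ^ n := pow_pos hs n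
  have h3 : ‖x.2‖ ^ 2 ≤ s ^ n * Fintype.card (Fin n → ι) * ‖x.1‖ ^ 2 := by
    rw [h1, div_mul_eq_mul_div, mul_div_assoc, mul_assoc]
    refine mul_le_mul_of_nonneg_left ?_ hsn.le
    rw [div_le_iff₀ hfac]
    calc ∑ α, ‖c α‖ ^ 2 ≤ n.factorial * ∑ k, ‖x.1 k‖ ^ 2 := sum_norm_sq_coeff_le X F hc hH
      _ ≤ n.factorial * (Fintype.card (Fin n → ι) * ‖x.1‖ ^ 2) :=
        mul_le_mul_of_nonneg_left h2 hfac.le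
      _ = _ := mul_comm _ _
  refine le_of_sq_le_sq ?_ (by positivity)
  rwa [mul_pow, Real.sq_sqrt (by positivity)]

theorem dense_domain_elementaryGraph {s : ℝ} (hs : 0 ≤ s) {P : Measure (GenConn V)}
    (hP : IsWhiteNoise s P) (n : ℕ) :
    Dense {H : Kernel ι n | ∃ w, (H, w) ∈ elementaryGraph X hs hP n} := by
  have hle : Submodule.span ℂ (elementary X n)
      ≤ (elementaryGraph X hs hP n).map (LinearMap.fst ℂ (Kernel ι n) (Lp ℂ 2 P)) := by
    refine Submodule.span_le.2 ?_
    rintro H ⟨d, F, c, hc, hH⟩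
    have hmem := memLp_evalR_coord hs hP F (expNegHalf (realCoeff d s) (stratPoly c))
    exact ⟨(H, hmem.toLp), ⟨d, F, c, hc, hH, hmem.coeFn_toLp⟩, rfl⟩
  have hd : Dense (Submodule.span ℂ (elementary X n) : Set (Kernel ι n)) :=
    Submodule.dense_iff_topologicalClosure_eq_top.2 (dense_span_elementary X n)
  refine hd.mono fun H hH => ?_
  obtain ⟨⟨H', w⟩, hx, rfl⟩ := hle hH
  exact ⟨w, hx⟩

theorem exists_wienerIntegral {s : ℝ} (hs : 0 < s) {P : Measure (GenConn V)}
    (hP : IsWhiteNoise s P) (n : ℕ) :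
    ∃ I : Kernel ι n →L[ℂ] Lp ℂ 2 P, IsWienerIntegral X n s I := by
  obtain ⟨I, hI⟩ := exists_clm_of_bounded_relation (elementaryGraph X hs.le hP n) _
    (fun x hx => norm_le_of_mem_elementaryGraph X hs hP hx)
    (dense_domain_elementaryGraph X hs.le hP n)
  refine ⟨I, fun d F c hc H hH => ?_⟩
  have hw := MemLp.coeFn_toLp (memLp_evalR_coord hs.le hP F
    (expNegHalf (realCoeff d s) (stratPoly c)))
  rw [hI (H, _) ⟨d, F, c, hc, hH, hw⟩]
  exact hw

/-- Bounded maps on kernels are determined by their values on the elementary kernels. -/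
theorem clm_eq_of_eq_elementary {E : Type*} [NormedAddCommGroup E] [NormedSpace ℂ E] {n : ℕ}
    {T T' : Kernel ι n →L[ℂ] E} (h : ∀ H ∈ elementary X n, T H = T' H) : T = T' :=
  ContinuousLinearMap.ext_on
    (Submodule.dense_iff_topologicalClosure_eq_top.2 (dense_span_elementary X n)) h

theorem IsWienerIntegral.eq {n : ℕ} {s : ℝ} {P : Measure (GenConn V)}
    {I I' : Kernel ι n →L[ℂ] Lp ℂ 2 P} (hI : IsWienerIntegral X n s I)
    (hI' : IsWienerIntegral X n s I') : I' = I := by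
  refine clm_eq_of_eq_elementary X ?_
  rintro H ⟨d, F, c, hc, hH⟩
  exact Lp.ext ((hI' d F c hc H hH).trans (hI d F c hc H hH).symm)

theorem IsComplexWienerIntegral.eq {n : ℕ} {s t : ℝ} {M : Measure (GenConnC V)}
    {J J' : Kernel ι n →L[ℂ] Lp ℂ 2 M} (hJ : IsComplexWienerIntegral X n s t J)
    (hJ' : IsComplexWienerIntegral X n s t J') : J' = J := by
  refine clm_eq_of_eq_elementary X ?_
  rintro H ⟨d, F, c, hc, hH⟩
  exact Lp.ext ((hJ' d F c hc H hH).trans (hJ d F c hc H hH).symm)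

/-- The transform carries the Wiener integral to the complex Wiener integral. -/
theorem IsSegalBargmann.comp_wienerIntegral {s t : ℝ} (ht : 0 < t) (hst : t / 2 < s)
    {P : Measure (GenConn V)} (hP : IsWhiteNoise s P) {M : Measure (GenConnC V)} {S : Lp ℂ 2 P →ₗᵢ[ℂ] Lp ℂ 2 M} (hS : IsSegalBargmann t S)
    {n : ℕ} {I : Kernel ι n →L[ℂ] Lp ℂ 2 P} (hI : IsWienerIntegral X n s I) :
    IsComplexWienerIntegral X n s t (S.toContinuousLinearMap ∘L I) := by
  intro d F c hc H hH
  exact hS.hermite ht hst hP F (stratPoly c) (hI d F c hc H hH)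

end Integrals

end WienerSB

end

theorem theorem4p7 {V : Type*} [NormedAddCommGroup V] [InnerProductSpace ℝ V]
    [FiniteDimensional ℝ V] {ι : Type*} [Fintype ι] (X : OrthonormalBasis ι ℝ V)
    (s t : ℝ) (ht : 0 < t) (hst : t / 2 < s)
    (P : Measure (GenConn V)) (hP : IsWhiteNoise s P)
    (M : Measure (GenConnC V)) (hM : IsComplexWhiteNoise s t M) :
    ∃ S : Lp ℂ 2 P →ₗᵢ[ℂ] Lp ℂ 2 M,
      (IsSegalBargmann t S ∧
        ∀ S' : Lp ℂ 2 P →ₗᵢ[ℂ] Lp ℂ 2 M, IsSegalBargmann t S' → S' = S) ∧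
      ∀ n : ℕ,
        S '' hermiteSpace n s P = holHermiteSpace n s t M ∧
        ∃ (I : Kernel ι n →L[ℂ] Lp ℂ 2 P) (J : Kernel ι n →L[ℂ] Lp ℂ 2 M),
          (IsWienerIntegral X n s I ∧
            ∀ I' : Kernel ι n →L[ℂ] Lp ℂ 2 P, IsWienerIntegral X n s I' → I' = I) ∧
          (IsComplexWienerIntegral X n s t J ∧
            ∀ J' : Kernel ι n →L[ℂ] Lp ℂ 2 M, IsComplexWienerIntegral X n s t J' → J' = J) ∧
          ∀ H : Kernel ι n, S (I H) = J H := by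
  have hs : 0 < s := by linarith
  obtain ⟨S, hS, hSu⟩ := exists_unique_segalBargmann ht hst hP hM
  refine ⟨S, ⟨hS, hSu⟩, fun n => ⟨hS.image_hermiteSpace ht hst hP n, ?_⟩⟩
  obtain ⟨I, hI⟩ := exists_wienerIntegral X hs hP n
  have hJ := hS.comp_wienerIntegral X ht hst hP hI
  exact ⟨I, S.toContinuousLinearMap ∘L I, ⟨hI, fun I' hI' => hI.eq X hI'⟩,
    ⟨hJ, fun J' hJ' => hJ.eq X hJ'⟩, fun H => rfl⟩
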